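/- Let $M$ be a smooth ($C^\infty$, Hausdorff, second countable) surface without boundary and let $\nabla$ be a smooth torsion free connection on $TM$, with curvature $R(X,Y)=\nabla_X\nabla_Y-\nabla_Y\nabla_X-\nabla_{[X,Y]}$, Ricci tensor $\rho_\nabla(x,y)=\operatorname{Tr}\{z\mapsto R(z,x)y\}$, and symmetrized Ricci tensor $\rho_{s,\nabla}(x,y)=\frac12(\rho_\nabla(x,y)+\rho_\nabla(y,x))$. Let $\mathcal H_\nabla f=\nabla^2 f$ denote the Hessian, $(\mathcal H_\nabla f)(X,Y)=X(Yf)-(\nabla_XY)f$. For $\mu\in\mathbb R$ put $$E(\mu,\nabla)=\{f\in C^\infty(M):\ \mathcal H_\nabla f=\mu f\rho_{s,\nabla}\},$$ and for $P\in M$ let $E(P,\mu,\nabla)$ be the space of germs at $P$ of smooth real functions which are defined and satisfy $\mathcal H_\nabla f=\mu f\rho_{s,\nabla}$ near $P$. All dimensions are over $\mathbb R$. Two connections $\nabla,\tilde\nabla$ on an open set $U$ are strongly projectively equivalent on $U$ if there is a smooth closed $1$-form $\omega$ on $U$ with $\nabla_XY=\tilde\nabla_XY+\omega(X)Y+\omega(Y)X$.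 We say that $\nabla$ is strongly projectively flat on $U$ if it is strongly projectively equivalent on $U$ to a smooth torsion free connection on $U$ with zero curvature, strongly projectively flat near $P$ if it is strongly projectively flat on some open neighbourhood of $P$, and strongly projectively flat if it is so near every point of $M$. **A. Global solutions.** (0) If $M$ is simply connected, then $\dim E(-1,\nabla)\neq 2$. (1) If $M$ is simply connected, then $\nabla$ is strongly projectively flat if and only if $\dim E(-1,\nabla)=3$; the implication from $\dim E(-1,\nabla)=3$ to strong projective flatness holds for every connected $M$. (2) If $M$ is connected, $\nabla$ is strongly projectively flat, and $\operatorname{rank}\rho_\nabla=2$ at every point, then $\dim E(\mu,\nabla)=0$ for all $\mu\notin\{0,-1\}$, and $\dim E(0,\nabla)=1$. (3) If $M$ is connected and $\dim E(\mu,\nabla)=3$ for some $\mu\neq-1$, then $\rho_\nabla=0$ on $M$, and $\nabla$ is strongly projectively flat on all of $M$. **B. Germs.** For every $P\in M$, with no connectedness assumption on $M$: (0) $\dim E(P,-1,\nabla)\neq 2$. (1) $\nabla$ is strongly projectively flat near $P$ if and only if $\dim E(P,-1,\nabla)=3$. (2) If $\nabla$ is strongly projectively flat near $P$ and $\operatorname{rank}\rho_\nabla=2$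 at $P$, then $\dim E(P,\mu,\nabla)=0$ for all $\mu\notin\{0,-1\}$, and $\dim E(P,0,\nabla)=1$. (3) If $\dim E(P,\mu,\nabla)=3$ for some $\mu\neq-1$, then $\rho_\nabla=0$ near $P$, and $\nabla$ is strongly projectively flat near $P$. (Simply connected spaces are understood to be nonempty and path connected.) -/

import Mathlib

open Bundle FiberBundle Set Filter
open scoped Manifold ContDiff Topology

noncomputable section

namespace AffineSurface

/-- The model space of surfaces. -/
abbrev Plane : Type := EuclideanSpace ℝ (Fin 2)

section

variable {M : Type*} [TopologicalSpace M] [ChartedSpace Plane M] [IsManifold (𝓡 2) ∞ M]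

/-- Covariant derivatives on the tangent bundle of a surface.  The value `cov Y x u` is
`∇_u Y` at the point `x`. -/
abbrev Connection (M : Type*) [TopologicalSpace M] [ChartedSpace Plane M]
    [IsManifold (𝓡 2) ∞ M] : Type _ :=
  CovariantDerivative (𝓡 2) Plane (TangentSpace (𝓡 2) : M → Type _)

/-- The vector field around `x` with value `v` at `x` whose coefficients in the coordinates of
the preferred chart at `x` are constant.  The vectors of the standard basis are extended in this
way to the coordinate vector fields of that chart. -/
def coordField {x : M} (v : TangentSpace (𝓡 2) x) : (y : M) → TangentSpace (𝓡 2) y :=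
  extend Plane v

/-- The curvature operator `R(X, Y) Z = ∇_X ∇_Y Z - ∇_Y ∇_X Z - ∇_[X, Y] Z` on vector fields. -/
def curvature (cov : Connection M) (X Y Z : (y : M) → TangentSpace (𝓡 2) y) (x : M) :
    TangentSpace (𝓡 2) x :=
  cov (fun y => cov Z y (Y y)) x (X x) - cov (fun y => cov Z y (X y)) x (Y x)
    - cov Z x (VectorField.mlieBracket (𝓡 2) X Y x)

/-- The curvature tensor at a point.  Since `R` is tensorial, it is computed by extending the
three tangent vectors to smooth vector fields. -/
def curvatureAt (cov : Connection M) (x : M) (u v w : TangentSpace (𝓡 2) x) :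
    TangentSpace (𝓡 2) x :=
  curvature cov (coordField u) (coordField v) (coordField w) x

/-- The standard basis of the tangent space at `x`: the coordinate vectors of the preferred chart
at `x`. -/
def coordVec (x : M) (i : Fin 2) : TangentSpace (𝓡 2) x :=
  (EuclideanSpace.single i (1 : ℝ) : Plane)

/-- The Ricci tensor `ρ(v, w) = Tr (z ↦ R(z, v) w)`. -/
def ricci (cov : Connection M) (x : M) (v w : TangentSpace (𝓡 2) x) : ℝ :=
  ∑ i : Fin 2, (show Plane from curvatureAt cov x (coordVec x i) v w) i

/-- The symmetric part of the Ricci tensor. -/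
def ricciSym (cov : Connection M) (x : M) (v w : TangentSpace (𝓡 2) x) : ℝ :=
  (1 / 2) * (ricci cov x v w + ricci cov x w v)

/-- The rank of the Ricci tensor at a point. -/
def ricciRank (cov : Connection M) (x : M) : ℕ :=
  (Matrix.of fun i j : Fin 2 => ricci cov x (coordVec x i) (coordVec x j)).rank

/-- The Hessian `(∇² f)(u, v) = u (V f) - (∇_u V) f`, where `V` is a vector field extending `v`. -/
def hessian (cov : Connection M) (f : M → ℝ) (x : M) (u v : TangentSpace (𝓡 2) x) : ℝ :=
  mvfderiv (𝓡 2) (fun y => mvfderiv (𝓡 2) f y (coordField v y)) x u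
    - mvfderiv (𝓡 2) f x (cov (coordField v) x u)

/-- The affine quasi-Einstein equation `∇² f = μ f ρ_s` at the point `x`. -/
def QuasiEinsteinAt (cov : Connection M) (μ : ℝ) (f : M → ℝ) (x : M) : Prop :=
  ∀ u v : TangentSpace (𝓡 2) x, hessian cov f x u v = μ * f x * ricciSym cov x u v

theorem mdifferentiableAt_deriv_coordField {f : M → ℝ} {x : M}
    (hf : ContMDiffAt (𝓡 2) 𝓘(ℝ, ℝ) ∞ f x) (v : TangentSpace (𝓡 2) x) :
    MDifferentiableAt (𝓡 2) 𝓘(ℝ, ℝ) (fun y => mvfderiv (𝓡 2) f y (coordField v y)) x := by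
  have h := ContMDiffAt.mfderiv_const (m := 1) (n := ∞) hf (by norm_cast)
  have hc : ContMDiffAt (𝓡 2) 𝓘(ℝ, Plane) 1 (fun _ : M => (show Plane from v)) x :=
    contMDiffAt_const
  have h2 := (h.clm_apply hc).mdifferentiableAt one_ne_zero
  refine h2.congr_of_eventuallyEq ?_
  filter_upwards [(trivializationAt Plane (TangentSpace (𝓡 2)) x).open_baseSet.mem_nhds
    (mem_baseSet_trivializationAt Plane (TangentSpace (𝓡 2)) x)] with y hy
  have hv : ((trivializationAt Plane (TangentSpace (𝓡 2)) x) ⟨x, v⟩).2 = v := by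
    rw [TangentBundle.trivializationAt_apply]
    exact tangentCoordChange_self (I := 𝓡 2) (x := x) (z := x) (v := v) (mem_extChartAt_source x)
  simp only [inTangentCoordinates, ContinuousLinearMap.inCoordinates, mvfderiv, coordField,
    extend, hv]
  rw [TangentBundle.continuousLinearMapAt_model_space]
  change mfderiv (𝓡 2) 𝓘(ℝ, ℝ) f y _ = mfderiv (𝓡 2) 𝓘(ℝ, ℝ) f y
    (Trivialization.symmL ℝ (trivializationAt Plane (TangentSpace (𝓡 2)) x) y v)
  exact congrArg (mfderiv (𝓡 2) 𝓘(ℝ, ℝ) f y) (Trivialization.symmL_apply (R := ℝ)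
    (trivializationAt Plane (TangentSpace (𝓡 2)) x) hy (show Plane from v)).symm

theorem hessian_zero (cov : Connection M) (x : M) (u v : TangentSpace (𝓡 2) x) :
    hessian cov 0 x u v = 0 := by
  have h0 : (fun y : M => mvfderiv (𝓡 2) (0 : M → ℝ) y (coordField v y)) = 0 := by
    funext y; simp
  rw [hessian, h0]
  simp

theorem hessian_add (cov : Connection M) {f g : M → ℝ} {U : Set M} (hU : IsOpen U)
    (hf : ContMDiffOn (𝓡 2) 𝓘(ℝ, ℝ) ∞ f U) (hg : ContMDiffOn (𝓡 2) 𝓘(ℝ, ℝ) ∞ g U) {x : M}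
    (hx : x ∈ U) (u v : TangentSpace (𝓡 2) x) :
    hessian cov (f + g) x u v = hessian cov f x u v + hessian cov g x u v := by
  have hf' : ∀ y ∈ U, ContMDiffAt (𝓡 2) 𝓘(ℝ, ℝ) ∞ f y := fun y hy =>
    hf.contMDiffAt (hU.mem_nhds hy)
  have hg' : ∀ y ∈ U, ContMDiffAt (𝓡 2) 𝓘(ℝ, ℝ) ∞ g y := fun y hy =>
    hg.contMDiffAt (hU.mem_nhds hy)
  have hd : ∀ y ∈ U, mvfderiv (𝓡 2) (f + g) y = mvfderiv (𝓡 2) f y + mvfderiv (𝓡 2) g y :=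
    fun y hy => mvfderiv_add ((hf' y hy).mdifferentiableAt (by simp))
      ((hg' y hy).mdifferentiableAt (by simp))
  have he : (fun y => mvfderiv (𝓡 2) (f + g) y (coordField v y)) =ᶠ[𝓝 x]
      (fun y => mvfderiv (𝓡 2) f y (coordField v y)) +
        (fun y => mvfderiv (𝓡 2) g y (coordField v y)) := by
    filter_upwards [hU.mem_nhds hx] with y hy
    simp [hd y hy]
  have hm : mvfderiv (𝓡 2) (fun y => mvfderiv (𝓡 2) (f + g) y (coordField v y)) x =
      mvfderiv (𝓡 2) ((fun y => mvfderiv (𝓡 2) f y (coordField v y)) +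
        (fun y => mvfderiv (𝓡 2) g y (coordField v y))) x := by
    ext w
    simp only [mvfderiv, ContinuousLinearMap.comp_apply]
    erw [he.mfderiv_eq]
    rfl
  rw [hessian, hessian, hessian, hm, hd x hx,
    mvfderiv_add (mdifferentiableAt_deriv_coordField (hf' x hx) v)
      (mdifferentiableAt_deriv_coordField (hg' x hx) v)]
  simp only [add_apply]
  ring

theorem hessian_smul (cov : Connection M) (c : ℝ) {f : M → ℝ} {U : Set M} (hU : IsOpen U)
    (hf : ContMDiffOn (𝓡 2) 𝓘(ℝ, ℝ) ∞ f U) {x : M} (hx : x ∈ U)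
    (u v : TangentSpace (𝓡 2) x) :
    hessian cov (c • f) x u v = c * hessian cov f x u v := by
  have hf' : ∀ y ∈ U, ContMDiffAt (𝓡 2) 𝓘(ℝ, ℝ) ∞ f y := fun y hy =>
    hf.contMDiffAt (hU.mem_nhds hy)
  have key : ∀ (g : M → ℝ) (y : M), MDifferentiableAt (𝓡 2) 𝓘(ℝ, ℝ) g y →
      mvfderiv (𝓡 2) (c • g) y = c • mvfderiv (𝓡 2) g y := by
    intro g y hg
    have := mvfderiv_smul (I := 𝓡 2) (a := fun _ : M => c) (x := y) mdifferentiableAt_const hg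
    ext w
    have h2 := congrArg (fun L => L w) this
    rw [mvfderiv_const] at h2
    exact h2.trans (by simp)
  have hd : ∀ y ∈ U, mvfderiv (𝓡 2) (c • f) y = c • mvfderiv (𝓡 2) f y :=
    fun y hy => key f y ((hf' y hy).mdifferentiableAt (by simp))
  have he : (fun y => mvfderiv (𝓡 2) (c • f) y (coordField v y)) =ᶠ[𝓝 x]
      c • (fun y => mvfderiv (𝓡 2) f y (coordField v y)) := by
    filter_upwards [hU.mem_nhds hx] with y hy
    simp [hd y hy]
  have hm : mvfderiv (𝓡 2) (fun y => mvfderiv (𝓡 2) (c • f) y (coordField v y)) x =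
      mvfderiv (𝓡 2) (c • (fun y => mvfderiv (𝓡 2) f y (coordField v y))) x := by
    ext w
    simp only [mvfderiv, ContinuousLinearMap.comp_apply]
    erw [he.mfderiv_eq]
    rfl
  rw [hessian, hessian, hm, hd x hx, key _ x (mdifferentiableAt_deriv_coordField (hf' x hx) v)]
  simp only [smul_apply, smul_eq_mul]
  ring

/-- The eigenspace `E(μ, ∇)` of smooth functions on all of `M` that solve the affine
quasi-Einstein equation. -/
def eigenspace (cov : Connection M) (μ : ℝ) : Submodule ℝ C^∞⟮𝓡 2, M; 𝓘(ℝ, ℝ), ℝ⟯ where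
  carrier := {f | ∀ x, QuasiEinsteinAt cov μ f x}
  zero_mem' := by
    intro x u v
    simp [hessian_zero]
  add_mem' := by
    intro f g hf hg x u v
    have h := hessian_add cov isOpen_univ f.contMDiff.contMDiffOn g.contMDiff.contMDiffOn
      (mem_univ x) u v
    rw [ContMDiffMap.coe_add, h, hf x u v, hg x u v, Pi.add_apply]
    ring
  smul_mem' := by
    intro c f hf x u v
    have h := hessian_smul cov c isOpen_univ f.contMDiff.contMDiffOn (mem_univ x) u v
    rw [ContMDiffMap.coe_smul, h, hf x u v, Pi.smul_apply, smul_eq_mul]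
    ring

/-- The space `E(P, μ, ∇)` of germs at `P` of smooth solutions, defined near `P`, of the affine
quasi-Einstein equation. -/
def germEigenspace (cov : Connection M) (P : M) (μ : ℝ) :
    Submodule ℝ (Germ (𝓝 P) ℝ) where
  carrier := {g | ∃ (f : M → ℝ) (U : Set M), (f : Germ (𝓝 P) ℝ) = g ∧ IsOpen U ∧ P ∈ U ∧
    ContMDiffOn (𝓡 2) 𝓘(ℝ, ℝ) ∞ f U ∧ ∀ x ∈ U, QuasiEinsteinAt cov μ f x}
  zero_mem' := ⟨0, univ, rfl, isOpen_univ, mem_univ P, contMDiffOn_const, fun x _ u v => by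
    simp [hessian_zero]⟩
  add_mem' := by
    rintro _ _ ⟨f, U, rfl, hU, hPU, hf, hfe⟩ ⟨g, V, rfl, hV, hPV, hg, hge⟩
    have hf' := hf.mono (inter_subset_left (s := U) (t := V))
    have hg' := hg.mono (inter_subset_right (s := U) (t := V))
    refine ⟨f + g, U ∩ V, rfl, hU.inter hV, ⟨hPU, hPV⟩, hf'.add hg', fun x hx u v => ?_⟩
    rw [hessian_add cov (hU.inter hV) hf' hg' hx, hfe x hx.1 u v, hge x hx.2 u v, Pi.add_apply]
    ring
  smul_mem' := by
    rintro c _ ⟨f, U, rfl, hU, hPU, hf, hfe⟩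
    refine ⟨c • f, U, rfl, hU, hPU, ?_, fun x hx u v => ?_⟩
    · exact (contMDiffOn_const : ContMDiffOn (𝓡 2) 𝓘(ℝ, ℝ) ∞ (fun _ : M => c) U).smul hf
    rw [hessian_smul cov c hU hf hx, hfe x hx u v, Pi.smul_apply, smul_eq_mul]
    ring

/-- A family of covectors `θ` is a smooth 1-form on `U`. -/
def IsSmoothFormOn (θ : (x : M) → TangentSpace (𝓡 2) x →L[ℝ] ℝ) (U : Set M) : Prop :=
  ContMDiffOn (𝓡 2) ((𝓡 2).prod 𝓘(ℝ, Plane →L[ℝ] ℝ)) ∞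
    (fun x => TotalSpace.mk' (Plane →L[ℝ] ℝ)
      (E := fun x : M => TangentSpace (𝓡 2) x →L[ℝ] Bundle.Trivial M ℝ x) x (θ x)) U

/-- The exterior derivative `dθ(u, v) = U (θ V) - V (θ U) - θ [U, V]` at the point `x`, where `U`
and `V` are vector fields extending `u` and `v`. -/
def extDerivAt (θ : (x : M) → TangentSpace (𝓡 2) x →L[ℝ] ℝ) (x : M)
    (u v : TangentSpace (𝓡 2) x) : ℝ :=
  mvfderiv (𝓡 2) (fun y => θ y (coordField v y)) x u
    - mvfderiv (𝓡 2) (fun y => θ y (coordField u y)) x v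
    - θ x (VectorField.mlieBracket (𝓡 2) (coordField u) (coordField v) x)

/-- On `U`, the connections `cov` and `cov'` are strongly projectively equivalent: there is a
smooth closed 1-form `θ` on `U` with `∇_X Y = ∇'_X Y + θ(X) Y + θ(Y) X` on `U`. -/
def StronglyProjectivelyEquivalentOn (cov cov' : Connection M) (U : Set M) : Prop :=
  ∃ θ : (x : M) → TangentSpace (𝓡 2) x →L[ℝ] ℝ,
    IsSmoothFormOn θ U ∧ (∀ x ∈ U, ∀ u v, extDerivAt θ x u v = 0) ∧
      ∀ Y : (y : M) → TangentSpace (𝓡 2) y, ∀ x ∈ U,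
        MDifferentiableAt (𝓡 2) (𝓡 2).tangent (fun y => (⟨y, Y y⟩ : TangentBundle (𝓡 2) M)) x →
          ∀ u : TangentSpace (𝓡 2) x, cov Y x u = cov' Y x u + θ x u • Y x + θ x (Y x) • u

/-- The restriction of the connection to the open set `U` is a smooth torsion free connection
with vanishing curvature.  (Nothing is required outside of `U`.) -/
def IsFlatOn (cov : Connection M) (U : Set M) : Prop :=
  ContMDiffCovariantDerivativeOn (I := 𝓡 2) Plane ∞ cov.toFun U ∧
    (∀ x ∈ U, cov.torsion x = 0) ∧ ∀ x ∈ U, ∀ u v w, curvatureAt cov x u v w = 0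

/-- On the open set `U`, the connection is strongly projectively equivalent to a flat one. -/
def IsStronglyProjectivelyFlatOn (cov : Connection M) (U : Set M) : Prop :=
  ∃ cov' : Connection M, IsFlatOn cov' U ∧ StronglyProjectivelyEquivalentOn cov cov' U

/-- The connection is strongly projectively flat on a neighbourhood of `P`. -/
def IsStronglyProjectivelyFlatNear (cov : Connection M) (P : M) : Prop :=
  ∃ U : Set M, IsOpen U ∧ P ∈ U ∧ IsStronglyProjectivelyFlatOn cov U

/-- Strong projective flatness, a local property: every point has a neighbourhood on which the
connection is strongly projectively equivalent to a flat connection. -/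
def IsStronglyProjectivelyFlat (cov : Connection M) : Prop :=
  ∀ P : M, IsStronglyProjectivelyFlatNear cov P

end

end AffineSurface

end

/-!
In a chart, the pair `J = (f, df)` turns the affine quasi-Einstein equation `∇² f = μ f ρ_s` into a
linear total differential equation `dJ = A · J` with values in the three-dimensional space of
1-jets (`isPfaffSol_jet`, `IsPfaffSol.jet`).  Hence a germ of solutions at `P` is determined by its
jet at `P`, and the dimension of the space of germs is that of the subspace `solValues` of the jets
that are attained (`rank_germEigenspace`).  By the Frobenius theorem (`exists_isPfaffSol`) all jets
are attained if the curvature of `d - A` vanishes near `P`, and conversely this curvature kills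
every attained jet.  As the curvature of a surface is determined by its Ricci tensor
(`christCurv_eq_ricci`), the curvature of `d - A` is (`pfaffCurv_quasiForm`)
`df(u) (ρ + μ ρ_s)(w, z) - df(w) (ρ + μ ρ_s)(u, z) + μ f C(u, w, z)`,
where `C` is the antisymmetrized covariant derivative of `ρ_s`.  The local results follow:

* For `μ = -1` only the antisymmetric part of `ρ` occurs in the coefficients of `df`.  If the space
  of germs has dimension at least two, there is at each nearby point a solution with `f = 0` and
  `df ≠ 0`.  It forces `ρ` to be symmetric, and then `C = 0`, as otherwise all solutions would
  vanish on an open set (`eventually_ricciCodazzi`).  Hence the system is integrable and the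
  dimension is three (`solValues_eq_top_of_two_le_finrank`).
* If `∇` is strongly projectively equivalent to a flat connection by `θ = dg`, then the functions
  `exp g * h`, with `h` affine for the flat connection, solve the equation with `μ = -1`
  (`solValues_eq_top_of_projective`).  Conversely, given a three-dimensional space of germs, take a
  solution `f` that is positive near `P`; the projective change by `θ = d log f` is flat
  (`christCurv_eq_zero_of_solution`).
* If `μ ≠ -1` and `ρ` is symmetric, nondegenerate and Codazzi, then integrability gives `df = 0`
  (`snd_eq_zero_of_mem_solValues`), so that `f` is constant, and zero if `μ ≠ 0`.
* If `μ ≠ -1` and all jets are attained, then `ρ + μ ρ_s = 0`, and so `ρ = 0`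
  (`christRicci_eq_zero_of_solValues_eq_top`); the connection is then flat itself.

Globally, a solution on a connected surface is determined by its germ at a point
(`toGerm_injective`), which gives the upper bounds for the dimension.  If all jets are attained at
all points, the germs of solutions form a covering space, which is trivial if the surface is simply
connected; all germs then extend to global solutions (`exists_global_of_system`,
`rank_eigenspace_eq_three`).
-/


open Bundle FiberBundle Set Filter
open scoped Manifold ContDiff Topology

noncomputable section

/-! ### Linear Pfaffian systems and the Frobenius theorem -/

section

namespace AffineSurface

section Pfaffian

variable {E V : Type*} [NormedAddCommGroup E] [NormedSpace ℝ E]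
  [NormedAddCommGroup V] [NormedSpace ℝ V]

/-- `J` solves the total differential equation `dJ = A · J` at every point of `s`. -/
def IsPfaffSol (A : E → E →L[ℝ] V →L[ℝ] V) (J : E → V) (s : Set E) : Prop :=
  ∀ x ∈ s, HasFDerivAt J ((A x).flip (J x)) x

/-- The curvature of the connection `d - A`, i.e. the integrability obstruction of the total
differential equation `dJ = A · J`. -/
def pfaffCurv (A : E → E →L[ℝ] V →L[ℝ] V) (x u w : E) : V →L[ℝ] V :=
  fderiv ℝ A x u w - fderiv ℝ A x w u + (A x w ∘L A x u - A x u ∘L A x w)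

theorem IsPfaffSol.mono {A : E → E →L[ℝ] V →L[ℝ] V} {J : E → V} {s t : Set E}
    (h : IsPfaffSol A J s) (hts : t ⊆ s) : IsPfaffSol A J t :=
  fun x hx => h x (hts hx)

theorem IsPfaffSol.contDiffOn [FiniteDimensional ℝ E] {A : E → E →L[ℝ] V →L[ℝ] V} {J : E → V}
    {s : Set E}
    (hs : IsOpen s) (hA : ContDiffOn ℝ ∞ A s) (h : IsPfaffSol A J s) : ContDiffOn ℝ ∞ J s := by
  rw [contDiffOn_infty]
  intro n
  induction n with
  | zero =>
    exact contDiffOn_zero.2 fun x hx => (h x hx).continuousAt.continuousWithinAt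
  | succ n ih =>
    have key : ContDiffOn ℝ n (fun x => (A x).flip (J x)) s := by
      have hA' : ContDiffOn ℝ n A s := hA.of_le (by exact_mod_cast le_top)
      rw [contDiffOn_clm_apply]
      exact fun w => (hA'.clm_apply contDiffOn_const).clm_apply ih
    push_cast
    rw [contDiffOn_succ_iff_fderiv_of_isOpen hs]
    refine ⟨fun x hx => (h x hx).differentiableAt.differentiableWithinAt, by simp, ?_⟩
    exact key.congr fun x hx => (h x hx).fderiv

set_option synthInstance.maxHeartbeats 200000 in
/-- A solution satisfies the integrability condition, by symmetry of its second derivative. -/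
theorem IsPfaffSol.pfaffCurv_apply_eq_zero [FiniteDimensional ℝ E] {A : E → E →L[ℝ] V →L[ℝ] V}
    {J : E → V} {s : Set E}
    (hs : IsOpen s) (hA : ContDiffOn ℝ ∞ A s) (h : IsPfaffSol A J s) {x : E} (hx : x ∈ s)
    (u w : E) : pfaffCurv A x u w (J x) = 0 := by
  have hJ := (h.contDiffOn hs hA).contDiffAt (hs.mem_nhds hx)
  have hsym : IsSymmSndFDerivAt ℝ J x :=
    hJ.isSymmSndFDerivAt (by
      rw [minSmoothness_of_isRCLikeNormedField]
      exact (WithTop.coe_le_coe.2 le_top : ((2 : ℕ∞) : WithTop ℕ∞) ≤ ∞))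
  have hAx : HasFDerivAt A (fderiv ℝ A x) x :=
    ((hA.contDiffAt (hs.mem_nhds hx)).differentiableAt (by simp)).hasFDerivAt
  have hd2 : DifferentiableAt ℝ (fderiv ℝ J) x :=
    (hJ.fderiv_right (m := 1) (by norm_cast)).differentiableAt (by simp)
  have key : ∀ a b : E, fderiv ℝ (fderiv ℝ J) x a b =
      fderiv ℝ A x a b (J x) + A x b (A x a (J x)) := by
    intro a b
    have he : (fun y => fderiv ℝ J y b) =ᶠ[𝓝 x] fun y => A y b (J y) := by
      filter_upwards [hs.mem_nhds hx] with y hy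
      rw [(h y hy).fderiv]; rfl
    have h1 := (hd2.hasFDerivAt.clm_apply (hasFDerivAt_const b x)).congr_of_eventuallyEq he.symm
    have h2 := (hAx.clm_apply (hasFDerivAt_const b x)).clm_apply (h x hx)
    have h3 := congrArg (fun L => L a) (h1.unique h2)
    simp only [add_apply, ContinuousLinearMap.comp_apply, ContinuousLinearMap.flip_apply,
      zero_apply, map_zero, zero_add] at h3
    rw [h3]; abel
  have h2 := hsym u w
  rw [key, key] at h2
  simp only [pfaffCurv, add_apply, sub_apply, ContinuousLinearMap.comp_apply]
  rw [← sub_eq_zero] at h2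
  rw [← h2]
  abel

/-- Solutions on a convex open set are determined by their value at one point. -/
theorem IsPfaffSol.eq_zero_of_convex {A : E → E →L[ℝ] V →L[ℝ] V} {J : E → V} {s : Set E}
    (hc : Convex ℝ s) (hA : ContinuousOn A s) (h : IsPfaffSol A J s) {p : E}
    (hp : p ∈ s) (h0 : J p = 0) : ∀ x ∈ s, J x = 0 := by
  intro x hx
  set γ : ℝ → E := fun t => p + t • (x - p)
  have hγ : ∀ t ∈ Icc (0 : ℝ) 1, γ t ∈ s := fun t ht => hc.add_smul_sub_mem hp hx ht
  have hγd : ∀ t, HasDerivAt γ (x - p) t := fun t => by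
    have := ((hasDerivAt_id t).smul_const (x - p)).const_add p
    rwa [one_smul] at this
  have hγc : Continuous γ := by fun_prop
  have hd : ∀ t ∈ Icc (0 : ℝ) 1, HasDerivAt (J ∘ γ) (A (γ t) (x - p) (J (γ t))) t := fun t ht => by
    simpa using (h _ (hγ t ht)).comp_hasDerivAt t (hγd t)
  obtain ⟨K, hK⟩ : ∃ K, ∀ t ∈ Icc (0 : ℝ) 1, ‖A (γ t) (x - p)‖ ≤ K := by
    refine isCompact_Icc.exists_bound_of_continuousOn ?_
    exact (hA.comp hγc.continuousOn hγ).clm_apply continuousOn_const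
  have := eq_zero_of_abs_deriv_le_mul_abs_self_of_eq_zero_right (f := J ∘ γ)
    (f' := fun t => A (γ t) (x - p) (J (γ t))) (K := K) (a := 0) (b := 1)
    (fun t ht => (hd t ht).continuousAt.continuousWithinAt)
    (fun t ht => (hd t (Ico_subset_Icc_self ht)).hasDerivWithinAt) (by simp [γ, h0])
    (fun t ht => ((A (γ t) (x - p)).le_opNorm _).trans
      (mul_le_mul_of_nonneg_right (hK t (Ico_subset_Icc_self ht)) (norm_nonneg _)))
    1 (right_mem_Icc.2 zero_le_one)
  simpa [γ] using this

theorem hasDerivWithinAt_comp_of_hasFDerivAt {A : E → V} {A' : E →L[ℝ] V} {q : ℝ → E} {v : E}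
    {t : ℝ} {s : Set ℝ} (hA : HasFDerivAt A A' (q t)) (hq : HasDerivAt q v t) :
    HasDerivWithinAt (fun t => A (q t)) (A' v) s t :=
  (hA.comp_hasDerivAt t hq).hasDerivWithinAt

/-- Uniform Lipschitz and second order Taylor bounds of a smooth function near a point. -/
theorem exists_ball_taylor_bounds {A : E → V} {s : Set E} (hs : IsOpen s)
    (hA : ContDiffOn ℝ ∞ A s) {p : E} (hp : p ∈ s) :
    ∃ r > 0, ∃ L0 > 0, ∃ L1 ≥ 0, ∃ L2 ≥ 0, Metric.ball p r ⊆ s ∧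
      (∀ x ∈ Metric.ball p r, ‖A x‖ ≤ L0) ∧
      (∀ x ∈ Metric.ball p r, ∀ y ∈ Metric.ball p r, ‖A x - A y‖ ≤ L1 * ‖x - y‖) ∧
      ∀ q ∈ Metric.ball p r, ∀ h : E, q + h ∈ Metric.ball p r →
        ‖A (q + h) - A q - fderiv ℝ A q h‖ ≤ L2 * ‖h‖ * ‖h‖ := by
  have hAp : ContDiffAt ℝ ∞ A p := hA.contDiffAt (hs.mem_nhds hp)
  obtain ⟨L1, t1, ht1, hL1⟩ := (hAp.of_le (m := 1) (by norm_cast)).exists_lipschitzOnWith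
  obtain ⟨L2, t2, ht2, hL2⟩ :=
    (hAp.fderiv_right (m := 1) (by norm_cast)).exists_lipschitzOnWith
  obtain ⟨r, hr, hball⟩ := Metric.mem_nhds_iff.1 (inter_mem (inter_mem ht1 ht2) (inter_mem
    (hAp.continuousAt.norm (gt_mem_nhds (lt_add_one ‖A p‖))) (hs.mem_nhds hp)))
  refine ⟨r, hr, ‖A p‖ + 1, by positivity, L1, L1.2, L2, L2.2, fun x hx => (hball hx).2.2,
    fun x hx => le_of_lt (hball hx).2.1,
    fun x hx y hy => hL1.norm_sub_le (hball hx).1.1 (hball hy).1.1, fun q hq h hqh => ?_⟩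
  have hcv : Convex ℝ (Metric.ball p r ∩ Metric.closedBall q ‖h‖) :=
    (convex_ball p r).inter (convex_closedBall q _)
  have := hcv.norm_image_sub_le_of_norm_hasFDerivWithin_le' (f := A) (f' := fderiv ℝ A)
    (φ := fderiv ℝ A q) (C := L2 * ‖h‖) (x := q) (y := q + h)
    (fun z hz => ((hA.contDiffAt (hs.mem_nhds (hball hz.1).2.2)).differentiableAt
      (by simp)).hasFDerivAt.hasFDerivWithinAt)
    (fun z hz => (hL2.norm_sub_le (hball hz.1).1.2 (hball hq).1.2).trans (by
      have := mem_closedBall_iff_norm.1 hz.2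
      gcongr))
    ⟨hq, by simp⟩ ⟨hqh, by simp⟩
  simpa using this

set_option synthInstance.maxHeartbeats 200000 in
set_option maxHeartbeats 1000000 in
/-- **Frobenius theorem** for linear total differential equations: if the integrability condition
holds, every initial value is attained by a solution on a ball that does not depend on the value.
The solution is obtained by integrating along the rays from `p`. That it is differentiable is
checked by comparing the solution along the ray to `x + w` with the approximate solution
`(1 + A(q)(t w)) y`, where `y` is the solution along the ray to `x` and `q = p + t (x - p)`:
by integrability the error is of order `‖w‖ ^ 2`. -/
theorem exists_isPfaffSol [CompleteSpace V] {A : E → E →L[ℝ] V →L[ℝ] V} {s : Set E}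
    (hs : IsOpen s) (hA : ContDiffOn ℝ ∞ A s) (hK : ∀ x ∈ s, ∀ u w, pfaffCurv A x u w = 0)
    {p : E} (hp : p ∈ s) :
    ∃ r > 0, Metric.ball p r ⊆ s ∧
      ∀ v : V, ∃ J : E → V, J p = v ∧ IsPfaffSol A J (Metric.ball p r) := by
  obtain ⟨r₀, hr₀, L0, hL0pos, L1, hL1pos, L2, hL2pos, hball, hL0, hL1, hL2⟩ :=
    exists_ball_taylor_bounds hs hA hp
  -- On a ball of this radius the equation along the rays has Lipschitz constant at most `1 / 2`, so
  -- that the Picard-Lindelöf theorem applies on the whole unit interval.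
  set r := min r₀ (min 1 (1 / (2 * L0)))
  have hr : 0 < r := by positivity
  have hr1 : r ≤ 1 := (min_le_right _ _).trans (min_le_left _ _)
  have hrL : L0 * r ≤ 1 / 2 := by
    have : r ≤ 1 / (2 * L0) := (min_le_right _ _).trans (min_le_right _ _)
    calc L0 * r ≤ L0 * (1 / (2 * L0)) := by gcongr
      _ = 1 / 2 := by field_simp
  have hsub : Metric.ball p r ⊆ Metric.ball p r₀ := Metric.ball_subset_ball (min_le_left _ _)
  have hbs : ∀ x ∈ Metric.ball p r, x ∈ s := fun x hx => hball (hsub hx)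
  have hb0 : ∀ x ∈ Metric.ball p r, ‖A x‖ ≤ L0 := fun x hx => hL0 x (hsub hx)
  have hb1 : ∀ x ∈ Metric.ball p r, ∀ y ∈ Metric.ball p r, ‖A x - A y‖ ≤ L1 * ‖x - y‖ :=
    fun x hx y hy => hL1 x (hsub hx) y (hsub hy)
  have hbA : ∀ x ∈ Metric.ball p r, HasFDerivAt A (fderiv ℝ A x) x := fun x hx =>
    ((hA.contDiffAt (hs.mem_nhds (hbs x hx))).differentiableAt (by simp)).hasFDerivAt
  have hTaylor : ∀ q ∈ Metric.ball p r, ∀ h : E, q + h ∈ Metric.ball p r →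
      ‖A (q + h) - A q - fderiv ℝ A q h‖ ≤ L2 * ‖h‖ * ‖h‖ :=
    fun q hq h hqh => hL2 q (hsub hq) h (hsub hqh)
  refine ⟨r, hr, hbs, fun v => ?_⟩
  have hray : ∀ x ∈ Metric.ball p r, ∀ t ∈ Icc (0 : ℝ) 1, p + t • (x - p) ∈ Metric.ball p r :=
    fun x hx t ht => (convex_ball p r).add_smul_sub_mem (Metric.mem_ball_self hr) hx ht
  have hxp : ∀ x ∈ Metric.ball p r, ‖x - p‖ ≤ r := fun x hx => (mem_ball_iff_norm.1 hx).le
  have hAx : ∀ x ∈ Metric.ball p r, ∀ t ∈ Icc (0 : ℝ) 1,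
      ‖A (p + t • (x - p)) (x - p)‖ ≤ 1 / 2 := fun x hx t ht =>
    ((A _).le_opNorm _).trans <| (mul_le_mul (hb0 _ (hray x hx t ht)) (hxp x hx)
      (norm_nonneg _) hL0pos.le).trans hrL
  have hAc : ContinuousOn A (Metric.ball p r) := hA.continuousOn.mono hbs
  have hode : ∀ x ∈ Metric.ball p r, ∃ y : ℝ → V, y 0 = v ∧ ∀ t ∈ Icc (0 : ℝ) 1,
      HasDerivWithinAt y (A (p + t • (x - p)) (x - p) (y t)) (Icc 0 1) t := by
    intro x hx
    have hpl : IsPicardLindelof (fun t y => A (p + t • (x - p)) (x - p) y)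
        (tmin := 0) (tmax := 1) ⟨0, by simp⟩ v (‖v‖₊ + 1) 0 (‖v‖₊ + 1 / 2) (1 / 2) := by
      refine ⟨fun t ht => ?_, fun y _ => ?_, fun t ht y hy => ?_, ?_⟩
      · refine (LipschitzWith.of_dist_le_mul fun a b => ?_).lipschitzOnWith
        rw [dist_eq_norm, dist_eq_norm, ← map_sub]
        exact ((A _ _).le_opNorm _).trans (by
          have := hAx x hx t ht
          push_cast
          gcongr)
      · refine ContinuousOn.clm_apply (ContinuousOn.clm_apply ?_ continuousOn_const)
          continuousOn_const
        exact hAc.comp (Continuous.continuousOn (by fun_prop)) (hray x hx)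
      · have h1 : ‖y‖ ≤ 2 * ‖v‖ + 1 := by
          have := mem_closedBall_iff_norm.1 hy
          have h3 := norm_le_norm_add_norm_sub' y v
          push_cast at this
          linarith
        refine ((A _ _).le_opNorm _).trans ?_
        refine (mul_le_mul (hAx x hx t ht) h1 (norm_nonneg _) (by norm_num)).trans ?_
        push_cast
        linarith
      · push_cast
        norm_num
    exact hpl.exists_eq_forall_mem_Icc_hasDerivWithinAt₀
  choose! y hy0 hy using hode
  refine ⟨fun x => y x 1, ?_, ?_⟩
  · have hp' := Metric.mem_ball_self hr (x := p)
    have hc : ContinuousOn (y p) (Icc 0 1) := fun t ht => (hy p hp' t ht).continuousWithinAt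
    have := constant_of_has_deriv_right_zero hc (fun t ht => by
      have := (hy p hp' t (Ico_subset_Icc_self ht)).mono_of_mem_nhdsWithin
        (Icc_mem_nhdsGE_of_mem ht)
      simpa using this) 1 (by simp)
    exact this.trans (hy0 p hp')
  intro x hx
  have hyc : ContinuousOn (y x) (Icc 0 1) := fun t ht => (hy x hx t ht).continuousWithinAt
  obtain ⟨B, hB⟩ := isCompact_Icc.exists_bound_of_continuousOn hyc
  have hBpos : 0 ≤ B := (norm_nonneg _).trans (hB 0 (by simp))
  set C : ℝ := (L2 + L1 + (L1 + L0) * L0) * B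
  have hmain : ∀ z ∈ Metric.ball p r,
      ‖y z 1 - y x 1 - A x (z - x) (y x 1)‖ ≤
        gronwallBound 0 (1 / 2) 1 1 * (C * (‖z - x‖ * ‖z - x‖)) := by
    intro z hz
    set w := z - x with hw
    set q : ℝ → E := fun t => p + t • (x - p) with hq
    have hqw : ∀ t, q t + t • w = p + t • (z - p) := fun t => by
      simp only [hq, hw]; module
    have hqd : ∀ t, HasDerivAt q (x - p) t := fun t => by
      have := ((hasDerivAt_id t).smul_const (x - p)).const_add p
      rwa [one_smul] at this
    have hzp : z - p = (x - p) + w := by rw [hw]; abel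
    -- the approximate solution along the ray to `z`
    set g : ℝ → V := fun t => y x t + A (q t) (t • w) (y x t) with hg
    set g' : ℝ → V := fun t => A (q t) (x - p) (y x t) + (fderiv ℝ A (q t) (x - p) (t • w)
      (y x t) + A (q t) w (y x t) + A (q t) (t • w) (A (q t) (x - p) (y x t))) with hg'
    have hgd : ∀ t ∈ Icc (0 : ℝ) 1, HasDerivWithinAt g (g' t) (Icc 0 1) t := by
      intro t ht
      have h1 : HasDerivWithinAt (fun t => A (q t)) (fderiv ℝ A (q t) (x - p)) (Icc 0 1) t :=
        hasDerivWithinAt_comp_of_hasFDerivAt (V := E →L[ℝ] V →L[ℝ] V)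
          (hbA (q t) (hray x hx t ht)) (hqd t)
      have h2 : HasDerivWithinAt (fun t : ℝ => t • w) w (Icc 0 1) t := by
        simpa using ((hasDerivWithinAt_id t (Icc (0 : ℝ) 1)).smul_const w)
      have h3 := (hy x hx t ht).add ((h1.clm_apply h2).clm_apply (hy x hx t ht))
      refine h3.congr_deriv ?_
      simp only [hg', add_apply]
      rfl
    have herr : ∀ t ∈ Icc (0 : ℝ) 1,
        ‖g' t - A (p + t • (z - p)) (z - p) (g t)‖ ≤ C * (‖w‖ * ‖w‖) := by
      intro t ht
      have hqt := hray x hx t ht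
      have hqzt := hray z hz t ht
      rw [← hqw] at hqzt ⊢
      -- Integrability cancels the terms of first order in `w`.
      have hK' := congrArg (fun L => L (y x t)) (hK _ (hbs _ hqt) (x - p) (t • w))
      simp only [pfaffCurv, add_apply, sub_apply, ContinuousLinearMap.comp_apply,
        zero_apply] at hK'
      have hid : g' t - A (q t + t • w) (z - p) (g t) =
          -((A (q t + t • w) - A (q t) - fderiv ℝ A (q t) (t • w)) (x - p) (y x t)
            + (A (q t + t • w) - A (q t)) w (y x t)
            + ((A (q t + t • w) - A (q t)) (x - p) + A (q t + t • w) w)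
              (A (q t) (t • w) (y x t))) := by
        rw [← sub_eq_zero, ← hK', hzp]
        simp only [hg, hg', map_add, add_apply, sub_apply]
        abel
      rw [hid, norm_neg]
      have ht1 : ‖t • w‖ ≤ ‖w‖ := by
        rw [norm_smul, Real.norm_of_nonneg ht.1]
        exact mul_le_of_le_one_left (norm_nonneg _) ht.2
      have hyB := hB t ht
      have hx1 : ‖x - p‖ ≤ 1 := (hxp x hx).trans hr1
      have e1 : ‖A (q t + t • w) - A (q t) - fderiv ℝ A (q t) (t • w)‖ ≤ L2 * ‖w‖ * ‖w‖ :=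
        (hTaylor _ hqt _ hqzt).trans (by gcongr)
      have e2 : ‖A (q t + t • w) - A (q t)‖ ≤ L1 * ‖w‖ := by
        refine (hb1 _ hqzt _ hqt).trans ?_
        rw [add_sub_cancel_left]
        gcongr
      have e3 := hb0 _ hqt
      have e4 := hb0 _ hqzt
      calc _ ≤ ‖A (q t + t • w) - A (q t) - fderiv ℝ A (q t) (t • w)‖ * ‖x - p‖ * ‖y x t‖
            + ‖A (q t + t • w) - A (q t)‖ * ‖w‖ * ‖y x t‖
            + (‖A (q t + t • w) - A (q t)‖ * ‖x - p‖ + ‖A (q t + t • w)‖ * ‖w‖)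
              * (‖A (q t)‖ * ‖t • w‖ * ‖y x t‖) := by
            refine (norm_add₃_le).trans ?_
            gcongr
            · exact (ContinuousLinearMap.le_opNorm₂ _ _ _)
            · exact (ContinuousLinearMap.le_opNorm₂ _ _ _)
            · refine (ContinuousLinearMap.le_opNorm _ _).trans ?_
              gcongr
              · refine (norm_add_le _ _).trans ?_
                gcongr
                · exact ContinuousLinearMap.le_opNorm _ _
                · exact ContinuousLinearMap.le_opNorm _ _
              · exact (ContinuousLinearMap.le_opNorm₂ _ _ _)
        _ ≤ (L2 * ‖w‖ * ‖w‖) * 1 * B + (L1 * ‖w‖) * ‖w‖ * B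
            + ((L1 * ‖w‖) * 1 + L0 * ‖w‖) * (L0 * ‖w‖ * B) := by gcongr
        _ = C * (‖w‖ * ‖w‖) := by simp only [C]; ring
    have hgr := dist_le_of_approx_trajectories_ODE_of_mem (K := 1 / 2) (a := 0) (b := 1)
      (v := fun t => A (p + t • (z - p)) (z - p)) (s := fun _ => univ)
      (f := y z) (g := g) (f' := fun t => A (p + t • (z - p)) (z - p) (y z t)) (g' := g')
      (εf := 0) (εg := C * (‖w‖ * ‖w‖)) (δ := 0)
      (fun t ht => (LipschitzWith.of_dist_le_mul fun a b => by
        rw [dist_eq_norm, dist_eq_norm, ← map_sub]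
        exact ((A _ _).le_opNorm _).trans (by
          have := hAx z hz t (Ico_subset_Icc_self ht)
          push_cast
          gcongr)).lipschitzOnWith)
      (fun t ht => (hy z hz t ht).continuousWithinAt)
      (fun t ht => (hy z hz t (Ico_subset_Icc_self ht)).mono_of_mem_nhdsWithin
        (Icc_mem_nhdsGE_of_mem ht))
      (fun t _ => by simp) (fun t _ => mem_univ _)
      (fun t ht => (hgd t ht).continuousWithinAt)
      (fun t ht => (hgd t (Ico_subset_Icc_self ht)).mono_of_mem_nhdsWithin
        (Icc_mem_nhdsGE_of_mem ht))
      (fun t ht => by rw [dist_eq_norm]; exact herr t (Ico_subset_Icc_self ht))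
      (fun t _ => mem_univ _)
      (by simp [hg, hy0 z hz, hy0 x hx]) 1 (by simp)
    rw [dist_eq_norm] at hgr
    have hq1 : q 1 = x := by simp [hq]
    have hg1 : y z 1 - g 1 = y z 1 - y x 1 - A x w (y x 1) := by
      simp only [hg, hq1, one_smul]; abel
    rw [hg1] at hgr
    refine hgr.trans (le_of_eq ?_)
    norm_num [gronwallBound]
    ring
  have hO : (fun z => y z 1 - y x 1 - A x (z - x) (y x 1)) =O[𝓝 x] fun z => ‖z - x‖ ^ 2 := by
    refine Asymptotics.IsBigO.of_bound (gronwallBound 0 (1 / 2) 1 1 * C) ?_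
    filter_upwards [Metric.isOpen_ball.mem_nhds hx] with z hz
    refine (hmain z hz).trans (le_of_eq ?_)
    rw [norm_pow, norm_norm]; ring
  have h0 : HasFDerivAt _ (0 : E →L[ℝ] V) x := hO.hasFDerivAt one_lt_two
  have h1 : HasFDerivAt (fun z => (A x).flip (y x 1) (z - x)) ((A x).flip (y x 1)) x := by
    exact ((A x).flip (y x 1)).hasFDerivAt.comp x ((hasFDerivAt_id x).sub_const x)
  have h2 := (h0.add h1).add_const (y x 1)
  rw [zero_add] at h2
  change HasFDerivAt (fun x => y x 1) ((A x).flip (y x 1)) x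
  refine h2.congr_of_eventuallyEq (Eventually.of_forall fun z => ?_)
  simp

end Pfaffian
end AffineSurface

end

/-! ### Values of local solutions of a Pfaffian system -/

section

namespace AffineSurface

section SolValues

variable {E V : Type*} [NormedAddCommGroup E] [NormedSpace ℝ E]
  [NormedAddCommGroup V] [NormedSpace ℝ V]

/-- The values at `p` of the solutions of `dJ = A · J` defined near `p`. -/
def solValues (A : E → E →L[ℝ] V →L[ℝ] V) (p : E) : Submodule ℝ V where
  carrier := {j | ∃ (J : E → V) (s : Set E), IsOpen s ∧ p ∈ s ∧ IsPfaffSol A J s ∧ J p = j}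
  zero_mem' := ⟨fun _ => 0, univ, isOpen_univ, mem_univ p, fun x _ => by
    simpa using hasFDerivAt_const (0 : V) x, rfl⟩
  add_mem' := by
    rintro _ _ ⟨J, s, hs, hp, hJ, rfl⟩ ⟨J', s', hs', hp', hJ', rfl⟩
    refine ⟨J + J', s ∩ s', hs.inter hs', ⟨hp, hp'⟩, fun x hx => ?_, rfl⟩
    simpa using (hJ x hx.1).add (hJ' x hx.2)
  smul_mem' := by
    rintro c _ ⟨J, s, hs, hp, hJ, rfl⟩
    refine ⟨c • J, s, hs, hp, fun x hx => ?_, rfl⟩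
    simpa using (hJ x hx).const_smul c

theorem IsPfaffSol.mem_solValues {A : E → E →L[ℝ] V →L[ℝ] V} {J : E → V} {s : Set E}
    (h : IsPfaffSol A J s) (hs : IsOpen s) {p : E} (hp : p ∈ s) : J p ∈ solValues A p :=
  ⟨J, s, hs, hp, h, rfl⟩

theorem IsPfaffSol.sum_smul {A : E → E →L[ℝ] V →L[ℝ] V} {ι : Type*} [Fintype ι]
    {J : ι → E → V} {s : Set E} (h : ∀ i, IsPfaffSol A (J i) s) (c : ι → ℝ) :
    IsPfaffSol A (fun x => ∑ i, c i • J i x) s := by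
  intro x hx
  have := HasFDerivAt.fun_sum (u := Finset.univ) fun i _ => (h i x hx).const_smul (c i)
  simpa using this

theorem pfaffCurv_apply_eq_zero_of_mem_solValues [FiniteDimensional ℝ E]
    {A : E → E →L[ℝ] V →L[ℝ] V} {s : Set E} (hs : IsOpen s) (hA : ContDiffOn ℝ ∞ A s) {p : E}
    (hp : p ∈ s) {j : V} (hj : j ∈ solValues A p) (u w : E) : pfaffCurv A p u w j = 0 := by
  obtain ⟨J, t, ht, hpt, hJ, rfl⟩ := hj
  exact (hJ.mono inter_subset_left).pfaffCurv_apply_eq_zero (ht.inter hs)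
    (hA.mono inter_subset_right) ⟨hpt, hp⟩ u w

theorem solValues_eq_top [CompleteSpace V] {A : E → E →L[ℝ] V →L[ℝ] V} {s : Set E}
    (hs : IsOpen s) (hA : ContDiffOn ℝ ∞ A s) {p : E} (hp : p ∈ s)
    (hK : ∀ᶠ x in 𝓝 p, ∀ u w, pfaffCurv A x u w = 0) : solValues A p = ⊤ := by
  obtain ⟨t, htK, ht, hpt⟩ := eventually_nhds_iff.1 hK
  obtain ⟨r, hr, -, h⟩ := exists_isPfaffSol (ht.inter hs) (hA.mono inter_subset_right)
    (fun x hx => htK x hx.1) ⟨hpt, hp⟩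
  refine eq_top_iff.2 fun v _ => ?_
  obtain ⟨J, rfl, hJ⟩ := h v
  exact hJ.mem_solValues Metric.isOpen_ball (Metric.mem_ball_self hr)

/-- Linearly independent solutions keep independent values near a point, because a solution
that vanishes at a point vanishes near it. -/
theorem eventually_finrank_solValues_le [FiniteDimensional ℝ V] {A : E → E →L[ℝ] V →L[ℝ] V}
    {s : Set E} (hs : IsOpen s) (hA : ContDiffOn ℝ ∞ A s) {p : E} (hp : p ∈ s) :
    ∀ᶠ q in 𝓝 p, Module.finrank ℝ (solValues A p) ≤ Module.finrank ℝ (solValues A q) := by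
  let b := Module.finBasis ℝ (solValues A p)
  choose J t ht hpt hJ hJp using fun i => (b i).2
  obtain ⟨r, hr, hball⟩ := Metric.mem_nhds_iff.1
    (inter_mem (Filter.iInter_mem.2 fun i => (ht i).mem_nhds (hpt i)) (hs.mem_nhds hp))
  filter_upwards [Metric.ball_mem_nhds p hr] with q hq
  have hJb : ∀ i, IsPfaffSol A (J i) (Metric.ball p r) := fun i =>
    (hJ i).mono fun x hx => mem_iInter.1 (hball hx).1 i
  let L : (Fin (Module.finrank ℝ (solValues A p)) → ℝ) →ₗ[ℝ] solValues A q :=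
    { toFun := fun c => ⟨∑ i, c i • J i q,
        (IsPfaffSol.sum_smul hJb c).mem_solValues Metric.isOpen_ball hq⟩
      map_add' := fun c c' => Subtype.ext (by simp [add_smul, Finset.sum_add_distrib])
      map_smul' := fun a c => Subtype.ext (by simp [mul_smul, Finset.smul_sum]) }
  have hL : Function.Injective L := by
    rw [← LinearMap.ker_eq_bot, LinearMap.ker_eq_bot']
    intro c hc
    have h0 := (IsPfaffSol.sum_smul hJb c).eq_zero_of_convex (convex_ball p r)
      (hA.continuousOn.mono fun x hx => (hball hx).2) hq (congrArg Subtype.val hc)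
      p (Metric.mem_ball_self hr)
    simp only [hJp] at h0
    have h1 : ∑ i, c i • b i = 0 := Subtype.ext (by simpa using h0)
    exact funext fun i => (Fintype.linearIndependent_iff.1 b.linearIndependent) c h1 i
  simpa using LinearMap.finrank_le_finrank_of_injective hL

end SolValues

end AffineSurface

end

/-! ### The quasi-Einstein equation of a connection of the plane -/

section

set_option maxSynthPendingDepth 3

namespace AffineSurface

section Planar

/-- The `i`-th vector of the standard basis of the plane. -/
abbrev stdVec (i : Fin 2) : Plane := EuclideanSpace.single i (1 : ℝ)

/-- The space of 1-jets of functions at a point of the plane: the value and the differential. -/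
abbrev Jet : Type := ℝ × (Plane →L[ℝ] ℝ)

theorem plane_eq (u : Plane) : u = u 0 • stdVec 0 + u 1 • stdVec 1 := by
  ext i; fin_cases i <;> simp

/-- The curvature `R(u, v) w` at `p` of the connection of the plane whose Christoffel tensor is
`Γ`, that is, `∇_u w = D_u w + Γ(u, w)`. -/
def christCurv (Γ : Plane → Plane →L[ℝ] Plane →L[ℝ] Plane) (p u v w : Plane) : Plane :=
  fderiv ℝ Γ p u v w - fderiv ℝ Γ p v u w + (Γ p u (Γ p v w) - Γ p v (Γ p u w))

/-- The Ricci tensor `ρ(v, w) = Tr (z ↦ R(z, v) w)` of a connection of the plane. -/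
def christRicci (Γ : Plane → Plane →L[ℝ] Plane →L[ℝ] Plane) (p v w : Plane) : ℝ :=
  ∑ i : Fin 2, christCurv Γ p (stdVec i) v w i

/-- The symmetric part of the Ricci tensor of a connection of the plane. -/
def christRicciSym (Γ : Plane → Plane →L[ℝ] Plane →L[ℝ] Plane) (p v w : Plane) : ℝ :=
  (1 / 2) * (christRicci Γ p v w + christRicci Γ p w v)

variable {Γ : Plane → Plane →L[ℝ] Plane →L[ℝ] Plane} {p : Plane}

theorem christCurv_eq_smul (u v w : Plane) :
    christCurv Γ p u v w = (u 0 * v 1 - u 1 * v 0) • christCurv Γ p (stdVec 0) (stdVec 1) w := by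
  conv_lhs => rw [plane_eq u, plane_eq v]
  simp only [christCurv, map_add, map_smul, add_apply, smul_apply]
  module

theorem christCurv_add_right (u v w w' : Plane) :
    christCurv Γ p u v (w + w') = christCurv Γ p u v w + christCurv Γ p u v w' := by
  simp only [christCurv, map_add]; abel

theorem christCurv_smul_right (c : ℝ) (u v w : Plane) :
    christCurv Γ p u v (c • w) = c • christCurv Γ p u v w := by
  simp only [christCurv, map_smul]; module

theorem christRicci_eq (v w : Plane) : christRicci Γ p v w =
    v 1 * christCurv Γ p (stdVec 0) (stdVec 1) w 0 -
      v 0 * christCurv Γ p (stdVec 0) (stdVec 1) w 1 := by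
  rw [christRicci, Fin.sum_univ_two, christCurv_eq_smul, christCurv_eq_smul (stdVec 1)]
  simp
  ring

/-- In dimension two the curvature is determined by the Ricci tensor. -/
theorem christCurv_eq_ricci (u v w : Plane) : christCurv Γ p u v w =
    christRicci Γ p v w • u - christRicci Γ p u w • v := by
  rw [christCurv_eq_smul, christRicci_eq, christRicci_eq]
  ext i
  fin_cases i <;> simp <;> ring

theorem christRicci_add_left (v v' w : Plane) :
    christRicci Γ p (v + v') w = christRicci Γ p v w + christRicci Γ p v' w := by
  simp only [christRicci_eq, PiLp.add_apply]; ring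

theorem christRicci_smul_left (c : ℝ) (v w : Plane) :
    christRicci Γ p (c • v) w = c * christRicci Γ p v w := by
  simp only [christRicci_eq, PiLp.smul_apply, smul_eq_mul]; ring

theorem christRicci_add_right (v w w' : Plane) :
    christRicci Γ p v (w + w') = christRicci Γ p v w + christRicci Γ p v w' := by
  simp only [christRicci_eq, christCurv_add_right, PiLp.add_apply]; ring

theorem christRicci_smul_right (c : ℝ) (v w : Plane) :
    christRicci Γ p v (c • w) = c * christRicci Γ p v w := by
  simp only [christRicci_eq, christCurv_smul_right, PiLp.smul_apply, smul_eq_mul]; ring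

theorem christRicci_expand (v w : Plane) : christRicci Γ p v w =
    v 0 * (w 0 * christRicci Γ p (stdVec 0) (stdVec 0) +
      w 1 * christRicci Γ p (stdVec 0) (stdVec 1)) +
    v 1 * (w 0 * christRicci Γ p (stdVec 1) (stdVec 0) +
      w 1 * christRicci Γ p (stdVec 1) (stdVec 1)) := by
  conv_lhs => rw [plane_eq v, plane_eq w]
  simp only [christRicci_add_left, christRicci_smul_left, christRicci_add_right,
    christRicci_smul_right]
  ring

variable (Γ p) in
/-- The symmetric part of the Ricci tensor as a continuous bilinear map. -/
def christRicciSymL : Plane →L[ℝ] Plane →L[ℝ] ℝ :=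
  (LinearMap.mk₂ ℝ (christRicciSym Γ p)
    (fun v v' w => by
      simp only [christRicciSym, christRicci_add_left, christRicci_add_right]; ring)
    (fun c v w => by
      simp only [christRicciSym, christRicci_smul_left, christRicci_smul_right, smul_eq_mul]; ring)
    (fun v w w' => by
      simp only [christRicciSym, christRicci_add_left, christRicci_add_right]; ring)
    (fun c v w => by
      simp only [christRicciSym, christRicci_smul_left, christRicci_smul_right, smul_eq_mul];
      ring)).toContinuousBilinearMap

@[simp]
theorem christRicciSymL_apply (v w : Plane) :
    christRicciSymL Γ p v w = christRicciSym Γ p v w := rfl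

theorem christRicciSym_comm (v w : Plane) :
    christRicciSym Γ p v w = christRicciSym Γ p w v := by
  simp only [christRicciSym]; ring

/-- The affine quasi-Einstein equation `∇² F = μ F ρ_s` at the point `p` of the plane. -/
def IsPlanarQE (Γ : Plane → Plane →L[ℝ] Plane →L[ℝ] Plane) (μ : ℝ) (F : Plane → ℝ)
    (p : Plane) : Prop :=
  ∀ u v : Plane, fderiv ℝ (fderiv ℝ F) p u v - fderiv ℝ F p (Γ p u v) =
    μ * F p * christRicciSym Γ p u v

/-- The coefficients of the total differential equation for the 1-jet `(f, df)` that is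
equivalent to the affine quasi-Einstein equation. -/
def quasiForm (Γ : Plane → Plane →L[ℝ] Plane →L[ℝ] Plane) (μ : ℝ) (p : Plane) :
    Plane →L[ℝ] Jet →L[ℝ] Jet :=
  (LinearMap.mk₂ ℝ
    (fun (w : Plane) (j : Jet) => ((j.2 w, j.2 ∘L Γ p w + (μ * j.1) • christRicciSymL Γ p w) : Jet))
    (fun w w' j => by
      ext z <;> simp
      ring)
    (fun c w j => by
      ext z <;> simp
      ring)
    (fun w j j' => by
      ext z <;> simp
      ring)
    (fun c w j => by
      ext z <;> simp
      ring)).toContinuousBilinearMap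

theorem quasiForm_apply (μ : ℝ) (w : Plane) (j : Jet) :
    quasiForm Γ μ p w j = (j.2 w, j.2 ∘L Γ p w + (μ * j.1) • christRicciSymL Γ p w) := rfl

section Smooth

variable {s : Set Plane}

theorem contDiffOn_christCurv (hs : IsOpen s) (hΓ : ContDiffOn ℝ ∞ Γ s) (u v w : Plane) :
    ContDiffOn ℝ ∞ (fun q => christCurv Γ q u v w) s := by
  have h1 : ContDiffOn ℝ ∞ (fderiv ℝ Γ) s := hΓ.fderiv_of_isOpen (m := ∞) hs (by norm_cast)
  have h2 : ∀ u v : Plane, ContDiffOn ℝ ∞ (fun q => Γ q u v) s := fun u v =>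
    (hΓ.clm_apply contDiffOn_const).clm_apply contDiffOn_const
  have h3 : ∀ u v w : Plane, ContDiffOn ℝ ∞ (fun q => fderiv ℝ Γ q u v w) s := fun u v w =>
    ((h1.clm_apply contDiffOn_const).clm_apply contDiffOn_const).clm_apply contDiffOn_const
  have h4 : ∀ u v w : Plane, ContDiffOn ℝ ∞ (fun q => Γ q u (Γ q v w)) s := fun u v w =>
    (hΓ.clm_apply contDiffOn_const).clm_apply (h2 v w)
  exact ((h3 u v w).sub (h3 v u w)).add ((h4 u v w).sub (h4 v u w))

theorem contDiffOn_christRicci (hs : IsOpen s) (hΓ : ContDiffOn ℝ ∞ Γ s) (v w : Plane) :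
    ContDiffOn ℝ ∞ (fun q => christRicci Γ q v w) s :=
  ContDiffOn.sum fun i _ =>
    (contDiffOn_piLp_apply 2 (i := i)).comp (contDiffOn_christCurv hs hΓ (stdVec i) v w)
      (mapsTo_univ _ _)

theorem contDiffOn_christRicciSym (hs : IsOpen s) (hΓ : ContDiffOn ℝ ∞ Γ s) (v w : Plane) :
    ContDiffOn ℝ ∞ (fun q => christRicciSym Γ q v w) s :=
  contDiffOn_const.mul ((contDiffOn_christRicci hs hΓ v w).add (contDiffOn_christRicci hs hΓ w v))

theorem contDiffOn_quasiForm (hs : IsOpen s) (hΓ : ContDiffOn ℝ ∞ Γ s) (μ : ℝ) :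
    ContDiffOn ℝ ∞ (quasiForm Γ μ) s := by
  rw [contDiffOn_clm_apply]
  intro w
  rw [contDiffOn_clm_apply]
  intro j
  simp only [quasiForm_apply]
  refine contDiffOn_const.prodMk ?_
  rw [contDiffOn_clm_apply]
  intro z
  simp only [add_apply, ContinuousLinearMap.comp_apply, smul_apply, christRicciSymL_apply,
    smul_eq_mul]
  refine ContDiffOn.add ?_ ?_
  · exact j.2.contDiff.comp_contDiffOn
      ((hΓ.clm_apply contDiffOn_const).clm_apply contDiffOn_const)
  · exact contDiffOn_const.mul (contDiffOn_christRicciSym hs hΓ w z)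

/-- Jets of solutions of the quasi-Einstein equation solve the total differential equation. -/
theorem isPfaffSol_jet (hs : IsOpen s) {μ : ℝ} {F : Plane → ℝ} (hF : ContDiffOn ℝ ∞ F s)
    (hq : ∀ x ∈ s, IsPlanarQE Γ μ F x) :
    IsPfaffSol (quasiForm Γ μ) (fun x => ((F x, fderiv ℝ F x) : Jet)) s := by
  intro x hx
  have h1 := ((hF.contDiffAt (hs.mem_nhds hx)).differentiableAt (by simp)).hasFDerivAt
  have h2 := (((hF.fderiv_of_isOpen (m := ∞) hs (by norm_cast)).contDiffAt
    (hs.mem_nhds hx)).differentiableAt (by simp)).hasFDerivAt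
  refine (h1.prodMk h2).congr_fderiv ?_
  ext u
  · simp [quasiForm_apply]
  · rename_i v
    have := hq x hx u v
    simp only [quasiForm_apply, ContinuousLinearMap.flip_apply, ContinuousLinearMap.prod_apply,
      add_apply, smul_apply, ContinuousLinearMap.comp_apply, christRicciSymL_apply, smul_eq_mul]
    linarith

/-- Solutions of the total differential equation are jets of solutions of the quasi-Einstein
equation. -/
theorem IsPfaffSol.jet {μ : ℝ} {J : Plane → Jet} (hs : IsOpen s) (hΓ : ContDiffOn ℝ ∞ Γ s)
    (hJ : IsPfaffSol (quasiForm Γ μ) J s) :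
    ContDiffOn ℝ ∞ (fun x => (J x).1) s ∧ (∀ x ∈ s, fderiv ℝ (fun x => (J x).1) x = (J x).2) ∧
      ∀ x ∈ s, IsPlanarQE Γ μ (fun x => (J x).1) x := by
  have h1 : ∀ x ∈ s, fderiv ℝ (fun x => (J x).1) x = (J x).2 := fun x hx => by
    rw [(hJ x hx).fst.fderiv]
    ext u
    simp [quasiForm_apply]
  refine ⟨contDiff_fst.comp_contDiffOn (hJ.contDiffOn hs (contDiffOn_quasiForm hs hΓ μ)), h1,
    fun x hx u v => ?_⟩
  have h2 : fderiv ℝ (fun x => (J x).1) =ᶠ[𝓝 x] fun x => (J x).2 := by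
    filter_upwards [hs.mem_nhds hx] with y hy using h1 y hy
  rw [h1 x hx, h2.fderiv_eq, (hJ x hx).snd.fderiv]
  simp [quasiForm_apply]

end Smooth

end Planar

end AffineSurface

end

/-! ### Integrability of the quasi-Einstein equation in the plane -/

section

set_option maxSynthPendingDepth 3

namespace AffineSurface

section PlanarIntegrability

variable {Γ : Plane → Plane →L[ℝ] Plane →L[ℝ] Plane} {s : Set Plane} {p : Plane} {μ : ℝ}

/-- The antisymmetrized covariant derivative `(∇_u ρ_s)(w, z) - (∇_w ρ_s)(u, z)` of the
symmetrized Ricci tensor of a torsion free connection of the plane. -/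
def christCodazzi (Γ : Plane → Plane →L[ℝ] Plane →L[ℝ] Plane) (p u w z : Plane) : ℝ :=
  fderiv ℝ (fun q => christRicciSym Γ q w z) p u - fderiv ℝ (fun q => christRicciSym Γ q u z) p w
    + (christRicciSym Γ p u (Γ p w z) - christRicciSym Γ p w (Γ p u z))

theorem fderiv_quasiForm (hs : IsOpen s) (hΓ : ContDiffOn ℝ ∞ Γ s) (hp : p ∈ s) (u w : Plane)
    (j : Jet) (z : Plane) :
    (fderiv ℝ (quasiForm Γ μ) p u w j).1 = 0 ∧
    (fderiv ℝ (quasiForm Γ μ) p u w j).2 z = j.2 (fderiv ℝ Γ p u w z) +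
      μ * j.1 * fderiv ℝ (fun q => christRicciSym Γ q w z) p u := by
  have hA : HasFDerivAt (quasiForm Γ μ) (fderiv ℝ (quasiForm Γ μ) p) p :=
    (((contDiffOn_quasiForm hs hΓ μ).contDiffAt (hs.mem_nhds hp)).differentiableAt
      (by simp)).hasFDerivAt
  have hG : HasFDerivAt Γ (fderiv ℝ Γ p) p :=
    ((hΓ.contDiffAt (hs.mem_nhds hp)).differentiableAt (by simp)).hasFDerivAt
  have hR : HasFDerivAt (fun q => christRicciSym Γ q w z)
      (fderiv ℝ (fun q => christRicciSym Γ q w z) p) p :=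
    (((contDiffOn_christRicciSym hs hΓ w z).contDiffAt (hs.mem_nhds hp)).differentiableAt
      (by simp)).hasFDerivAt
  have hAj : HasFDerivAt (fun q => quasiForm Γ μ q w j) _ p :=
    (hA.clm_apply (hasFDerivAt_const w p)).clm_apply (hasFDerivAt_const j p)
  constructor
  · have h1 := hAj.fst
    simp only [quasiForm_apply] at h1
    have h2 := congrArg (fun L => L u) (h1.unique (hasFDerivAt_const (j.2 w) p))
    simpa using h2
  · have h1 := hAj.snd.clm_apply (hasFDerivAt_const z p)
    simp only [quasiForm_apply, add_apply, smul_apply, ContinuousLinearMap.comp_apply,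
      christRicciSymL_apply, smul_eq_mul] at h1
    have h3 : HasFDerivAt (fun q => j.2 (Γ q w z) + μ * j.1 * christRicciSym Γ q w z) _ p :=
      (j.2.hasFDerivAt.comp p ((hG.clm_apply (hasFDerivAt_const w p)).clm_apply
        (hasFDerivAt_const z p))).add (hR.const_mul (μ * j.1))
    have h2 := congrArg (fun L => L u) (h1.unique h3)
    simpa using h2

/-- The integrability condition of the quasi-Einstein equation. The Ricci tensor enters through the
curvature, which it determines in dimension two. -/
theorem pfaffCurv_quasiForm (hs : IsOpen s) (hΓ : ContDiffOn ℝ ∞ Γ s)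
    (hsym : ∀ x ∈ s, ∀ u v, Γ x u v = Γ x v u) (hp : p ∈ s) (u w : Plane) (j : Jet) (z : Plane) :
    (pfaffCurv (quasiForm Γ μ) p u w j).1 = 0 ∧
    (pfaffCurv (quasiForm Γ μ) p u w j).2 z =
      j.2 u * (christRicci Γ p w z + μ * christRicciSym Γ p w z)
      - j.2 w * (christRicci Γ p u z + μ * christRicciSym Γ p u z)
      + μ * j.1 * christCodazzi Γ p u w z := by
  obtain ⟨h1, h2⟩ := fderiv_quasiForm (μ := μ) hs hΓ hp u w j z
  obtain ⟨h3, h4⟩ := fderiv_quasiForm (μ := μ) hs hΓ hp w u j z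
  have hc := congrArg j.2 (christCurv_eq_ricci (Γ := Γ) (p := p) u w z)
  simp only [christCurv, map_add, map_sub, map_smul, smul_eq_mul] at hc
  constructor
  · simp only [pfaffCurv, add_apply, sub_apply, ContinuousLinearMap.comp_apply, Prod.fst_add,
      Prod.fst_sub, h1, h3, quasiForm_apply, smul_apply, christRicciSymL_apply]
    rw [hsym p hp u w, christRicciSym_comm u w]
    ring
  · simp only [pfaffCurv, add_apply, sub_apply, ContinuousLinearMap.comp_apply, Prod.snd_add,
      Prod.snd_sub, h2, h4, quasiForm_apply, smul_apply, christRicciSymL_apply, christCodazzi,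
      smul_eq_mul]
    linear_combination hc

/-- The Ricci tensor is symmetric and satisfies the Codazzi equation at the point `p`. This is
the integrability condition of the quasi-Einstein equation with `μ = -1`. -/
def RicciCodazzi (Γ : Plane → Plane →L[ℝ] Plane →L[ℝ] Plane) (p : Plane) : Prop :=
  (∀ v w, christRicci Γ p v w = christRicci Γ p w v) ∧ ∀ u w z, christCodazzi Γ p u w z = 0

theorem christRicciSym_eq (h : ∀ v w, christRicci Γ p v w = christRicci Γ p w v) (v w : Plane) :
    christRicciSym Γ p v w = christRicci Γ p v w := by
  rw [christRicciSym, h w v]; ring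

theorem christRicci_comm_of_basis
    (h : christRicci Γ p (stdVec 0) (stdVec 1) = christRicci Γ p (stdVec 1) (stdVec 0))
    (v w : Plane) : christRicci Γ p v w = christRicci Γ p w v := by
  rw [christRicci_expand v w, christRicci_expand w v, h]; ring

theorem pfaffCurv_eq_zero_of_ricciCodazzi (hs : IsOpen s) (hΓ : ContDiffOn ℝ ∞ Γ s)
    (hsym : ∀ x ∈ s, ∀ u v, Γ x u v = Γ x v u) (hp : p ∈ s) (h : RicciCodazzi Γ p)
    (u w : Plane) : pfaffCurv (quasiForm Γ (-1)) p u w = 0 := by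
  refine ContinuousLinearMap.ext fun j => Prod.ext ?_ (ContinuousLinearMap.ext fun z => ?_)
  · exact (pfaffCurv_quasiForm hs hΓ hsym hp u w j 0).1
  · rw [(pfaffCurv_quasiForm hs hΓ hsym hp u w j z).2, h.2, christRicciSym_eq h.1,
      christRicciSym_eq h.1]
    simp

theorem integrability_of_mem_solValues (hs : IsOpen s) (hΓ : ContDiffOn ℝ ∞ Γ s)
    (hsym : ∀ x ∈ s, ∀ u v, Γ x u v = Γ x v u) (hp : p ∈ s) {j : Jet}
    (hj : j ∈ solValues (quasiForm Γ μ) p) (u w z : Plane) :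
    j.2 u * (christRicci Γ p w z + μ * christRicciSym Γ p w z)
      - j.2 w * (christRicci Γ p u z + μ * christRicciSym Γ p u z)
      + μ * j.1 * christCodazzi Γ p u w z = 0 := by
  rw [← (pfaffCurv_quasiForm hs hΓ hsym hp u w j z).2,
    pfaffCurv_apply_eq_zero_of_mem_solValues hs (contDiffOn_quasiForm hs hΓ μ) hp hj]
  rfl

theorem christCodazzi_eq_zero_of_basis (hs : IsOpen s) (hΓ : ContDiffOn ℝ ∞ Γ s)
    (hsym : ∀ x ∈ s, ∀ u v, Γ x u v = Γ x v u) (hp : p ∈ s)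
    (h : ∀ z, christCodazzi Γ p (stdVec 0) (stdVec 1) z = 0) (u w z : Plane) :
    christCodazzi Γ p u w z = 0 := by
  -- The Codazzi tensor is the part of the integrability condition that multiplies `f`, and is
  -- therefore bilinear and antisymmetric in `u` and `w`.
  have key : ∀ u w, christCodazzi Γ p u w z = (pfaffCurv (quasiForm Γ 1) p u w (1, 0)).2 z :=
    fun u w => by
      rw [(pfaffCurv_quasiForm hs hΓ hsym hp u w (1, 0) z).2]; simp
  have h2 : ∀ u w, pfaffCurv (quasiForm Γ 1) p u w =
      (u 0 * w 1 - u 1 * w 0) • pfaffCurv (quasiForm Γ 1) p (stdVec 0) (stdVec 1) := by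
    intro u w
    conv_lhs => rw [plane_eq u, plane_eq w]
    simp only [pfaffCurv, map_add, map_smul, add_apply, smul_apply, ContinuousLinearMap.add_comp,
      ContinuousLinearMap.comp_add, ContinuousLinearMap.smul_comp, ContinuousLinearMap.comp_smul]
    module
  have h3 := h z
  rw [key] at h3
  rw [key, h2, smul_apply]
  change (_ : ℝ) * (pfaffCurv (quasiForm Γ 1) p (stdVec 0) (stdVec 1) (1, 0)).2 z = 0
  rw [h3, mul_zero]

theorem continuousOn_christCodazzi (hs : IsOpen s) (hΓ : ContDiffOn ℝ ∞ Γ s) (u w z : Plane) :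
    ContinuousOn (fun q => christCodazzi Γ q u w z) s := by
  have h1 : ∀ u w z, ContinuousOn (fun p => fderiv ℝ (fun q => christRicciSym Γ q w z) p u) s :=
    fun u w z => ((contDiffOn_christRicciSym hs hΓ w z).continuousOn_fderiv_of_isOpen hs
      (by simp)).clm_apply continuousOn_const
  have h2 : ∀ u w z, ContinuousOn (fun p => christRicciSym Γ p u (Γ p w z)) s := fun u w z => by
    have hc := (((contDiffOn_quasiForm hs hΓ 1).clm_apply contDiffOn_const).clm_apply
      contDiffOn_const).continuousOn (f := fun q => quasiForm Γ 1 q u ((1, 0) : Jet))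
    have hz : ContinuousOn (fun q => Γ q w z) s :=
      ((hΓ.clm_apply contDiffOn_const).clm_apply contDiffOn_const).continuousOn
    have := hc.snd.clm_apply hz
    simpa [quasiForm_apply] using this
  exact ((h1 u w z).sub (h1 w u z)).add ((h2 u w z).sub (h2 w u z))

/-- If the quasi-Einstein equation with `μ = -1` has two independent solutions near every point,
then the Ricci tensor is symmetric (a solution with value `0` and nonzero differential exists)
and satisfies the Codazzi equation (otherwise all solutions would vanish on an open set). -/
theorem eventually_ricciCodazzi (hs : IsOpen s) (hΓ : ContDiffOn ℝ ∞ Γ s)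
    (hsym : ∀ x ∈ s, ∀ u v, Γ x u v = Γ x v u) (hp : p ∈ s)
    (h2 : 2 ≤ Module.finrank ℝ (solValues (quasiForm Γ (-1)) p)) :
    ∀ᶠ q in 𝓝 p, RicciCodazzi Γ q := by
  have hrank : ∀ᶠ q in 𝓝 p, q ∈ s ∧ 2 ≤ Module.finrank ℝ (solValues (quasiForm Γ (-1)) q) := by
    filter_upwards [eventually_finrank_solValues_le hs (contDiffOn_quasiForm hs hΓ (-1)) hp,
      hs.mem_nhds hp] with q hq hqs using ⟨hqs, h2.trans hq⟩
  have hex : ∀ q, 2 ≤ Module.finrank ℝ (solValues (quasiForm Γ (-1)) q) →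
      ∃ j ∈ solValues (quasiForm Γ (-1)) q, j.1 = 0 ∧ j.2 ≠ 0 := by
    intro q hq
    let f : solValues (quasiForm Γ (-1)) q →ₗ[ℝ] ℝ :=
      (LinearMap.fst ℝ ℝ (Plane →L[ℝ] ℝ)) ∘ₗ Submodule.subtype _
    have hker : LinearMap.ker f ≠ ⊥ := LinearMap.ker_ne_bot_of_finrank_lt (by
      rw [Module.finrank_self]; omega)
    obtain ⟨j, hj, hj0⟩ := Submodule.exists_mem_ne_zero_of_ne_bot hker
    refine ⟨j.1, j.2, hj, fun h0 => hj0 ?_⟩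
    exact Subtype.ext (Prod.ext hj h0)
  have hrs : ∀ q ∈ s, 2 ≤ Module.finrank ℝ (solValues (quasiForm Γ (-1)) q) →
      ∀ v w, christRicci Γ q v w = christRicci Γ q w v := by
    intro q hq hq2
    obtain ⟨j, hj, hj1, hj2⟩ := hex q hq2
    refine christRicci_comm_of_basis ?_
    have e0 := integrability_of_mem_solValues hs hΓ hsym hq hj (stdVec 0) (stdVec 1) (stdVec 0)
    have e1 := integrability_of_mem_solValues hs hΓ hsym hq hj (stdVec 0) (stdVec 1) (stdVec 1)
    simp only [hj1, christRicciSym, mul_zero, zero_mul, add_zero] at e0 e1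
    by_contra hne
    have hne' := sub_ne_zero.2 hne
    apply hj2
    have a0 : j.2 (stdVec 0) = 0 := by
      refine (mul_eq_zero.1 (?_ : j.2 (stdVec 0) * (christRicci Γ q (stdVec 0) (stdVec 1) -
        christRicci Γ q (stdVec 1) (stdVec 0)) = 0)).resolve_right hne'
      linear_combination -2 * e0
    have a1 : j.2 (stdVec 1) = 0 := by
      refine (mul_eq_zero.1 (?_ : j.2 (stdVec 1) * (christRicci Γ q (stdVec 0) (stdVec 1) -
        christRicci Γ q (stdVec 1) (stdVec 0)) = 0)).resolve_right hne'
      linear_combination -2 * e1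
    refine ContinuousLinearMap.ext fun u => ?_
    rw [plane_eq u, map_add, map_smul, map_smul, a0, a1]
    simp
  filter_upwards [hrank.eventually_nhds] with q hq
  have hqs := hq.self_of_nhds
  refine ⟨hrs q hqs.1 hqs.2, ?_⟩
  refine christCodazzi_eq_zero_of_basis hs hΓ hsym hqs.1 fun z => ?_
  by_contra hC
  -- For symmetric Ricci tensor the integrability condition reads `f C = 0`, so that `f` vanishes on
  -- the open set where `C ≠ 0`, contrary to `df ≠ 0` at `q`.
  obtain ⟨_, ⟨J, t, ht, hqt, hJ, rfl⟩, hj1, hj2⟩ := hex q hqs.2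
  apply hj2
  have hC' := ((continuousOn_christCodazzi hs hΓ (stdVec 0) (stdVec 1) z).continuousAt
    (hs.mem_nhds hqs.1)).eventually_ne hC
  have h0 : (fun x => (J x).1) =ᶠ[𝓝 q] fun _ => 0 := by
    filter_upwards [hC', hq, ht.mem_nhds hqt] with x hx1 hx2 hx3
    have e := integrability_of_mem_solValues hs hΓ hsym hx2.1 (hJ.mem_solValues ht hx3)
      (stdVec 0) (stdVec 1) z
    rw [christRicciSym_eq (hrs x hx2.1 hx2.2), christRicciSym_eq (hrs x hx2.1 hx2.2)] at e
    have e' : (J x).1 * christCodazzi Γ x (stdVec 0) (stdVec 1) z = 0 := by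
      linear_combination -e
    exact (mul_eq_zero.1 e').resolve_right hx1
  have hd : fderiv ℝ (fun x => (J x).1) q = (J q).2 := by
    rw [(hJ q hqt).fst.fderiv]
    ext u
    simp [quasiForm_apply]
  rw [← hd, h0.fderiv_eq]
  simp

/-- Dimension two is impossible for `μ = -1`: two independent solutions force integrability. -/
theorem solValues_eq_top_of_two_le_finrank (hs : IsOpen s) (hΓ : ContDiffOn ℝ ∞ Γ s)
    (hsym : ∀ x ∈ s, ∀ u v, Γ x u v = Γ x v u) (hp : p ∈ s)
    (h2 : 2 ≤ Module.finrank ℝ (solValues (quasiForm Γ (-1)) p)) :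
    solValues (quasiForm Γ (-1)) p = ⊤ := by
  refine solValues_eq_top hs (contDiffOn_quasiForm hs hΓ (-1)) hp ?_
  filter_upwards [eventually_ricciCodazzi hs hΓ hsym hp h2, hs.mem_nhds hp] with q hq hqs
  exact pfaffCurv_eq_zero_of_ricciCodazzi hs hΓ hsym hqs hq

theorem finrank_jet : Module.finrank ℝ Jet = 3 := by
  rw [Module.finrank_prod, Module.finrank_self,
    ← (LinearMap.toContinuousLinearMap (𝕜 := ℝ) (E := Plane) (F' := ℝ)).finrank_eq,
    Module.finrank_linearMap, Module.finrank_self, finrank_euclideanSpace]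
  simp

/-- Where the Ricci tensor is symmetric, Codazzi and nondegenerate, the solutions with `μ ≠ -1`
have vanishing differential. -/
theorem snd_eq_zero_of_mem_solValues (hs : IsOpen s) (hΓ : ContDiffOn ℝ ∞ Γ s)
    (hsym : ∀ x ∈ s, ∀ u v, Γ x u v = Γ x v u) (hp : p ∈ s) (hμ : μ ≠ -1)
    (hRC : RicciCodazzi Γ p)
    (hdet : christRicci Γ p (stdVec 0) (stdVec 0) * christRicci Γ p (stdVec 1) (stdVec 1) -
      christRicci Γ p (stdVec 0) (stdVec 1) * christRicci Γ p (stdVec 1) (stdVec 0) ≠ 0)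
    {j : Jet} (hj : j ∈ solValues (quasiForm Γ μ) p) : j.2 = 0 := by
  have hμ' : 1 + μ ≠ 0 := fun h => hμ (by linarith)
  have e0 := integrability_of_mem_solValues hs hΓ hsym hp hj (stdVec 0) (stdVec 1) (stdVec 0)
  have e1 := integrability_of_mem_solValues hs hΓ hsym hp hj (stdVec 0) (stdVec 1) (stdVec 1)
  simp only [hRC.2, christRicciSym_eq hRC.1] at e0 e1
  have f0 : (1 + μ) * (christRicci Γ p (stdVec 0) (stdVec 0) *
      christRicci Γ p (stdVec 1) (stdVec 1) - christRicci Γ p (stdVec 0) (stdVec 1) *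
      christRicci Γ p (stdVec 1) (stdVec 0)) ≠ 0 := mul_ne_zero hμ' hdet
  have a0 : j.2 (stdVec 0) = 0 := by
    refine (mul_eq_zero.1 ?_).resolve_right f0
    linear_combination christRicci Γ p (stdVec 0) (stdVec 0) * e1 -
      christRicci Γ p (stdVec 0) (stdVec 1) * e0
  have a1 : j.2 (stdVec 1) = 0 := by
    refine (mul_eq_zero.1 ?_).resolve_right f0
    linear_combination christRicci Γ p (stdVec 1) (stdVec 0) * e1 -
      christRicci Γ p (stdVec 1) (stdVec 1) * e0
  refine ContinuousLinearMap.ext fun u => ?_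
  rw [plane_eq u, map_add, map_smul, map_smul, a0, a1]
  simp

theorem eventually_ricci_det_ne_zero (hs : IsOpen s) (hΓ : ContDiffOn ℝ ∞ Γ s) (hp : p ∈ s)
    (hdet : christRicci Γ p (stdVec 0) (stdVec 0) * christRicci Γ p (stdVec 1) (stdVec 1) -
      christRicci Γ p (stdVec 0) (stdVec 1) * christRicci Γ p (stdVec 1) (stdVec 0) ≠ 0) :
    ∀ᶠ q in 𝓝 p, christRicci Γ q (stdVec 0) (stdVec 0) * christRicci Γ q (stdVec 1) (stdVec 1) -
      christRicci Γ q (stdVec 0) (stdVec 1) * christRicci Γ q (stdVec 1) (stdVec 0) ≠ 0 := by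
  have h : ∀ v w, ContinuousAt (fun q => christRicci Γ q v w) p := fun v w =>
    (contDiffOn_christRicci hs hΓ v w).continuousOn.continuousAt (hs.mem_nhds hp)
  exact (((h _ _).mul (h _ _)).sub ((h _ _).mul (h _ _))).eventually_ne hdet

/-- The differential of a solution vanishes, so that its second derivative does, and the equation
reduces to `μ f ρ_s = 0`. -/
theorem solValues_eq_bot_of_det_ne_zero (hs : IsOpen s) (hΓ : ContDiffOn ℝ ∞ Γ s)
    (hsym : ∀ x ∈ s, ∀ u v, Γ x u v = Γ x v u) (hp : p ∈ s) (hμ : μ ≠ -1) (hμ0 : μ ≠ 0)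
    (hRC : ∀ᶠ q in 𝓝 p, RicciCodazzi Γ q)
    (hdet : christRicci Γ p (stdVec 0) (stdVec 0) * christRicci Γ p (stdVec 1) (stdVec 1) -
      christRicci Γ p (stdVec 0) (stdVec 1) * christRicci Γ p (stdVec 1) (stdVec 0) ≠ 0) :
    solValues (quasiForm Γ μ) p = ⊥ := by
  rw [eq_bot_iff]
  rintro _ ⟨J, t, ht, hpt, hJ, rfl⟩
  have h0 : (fun x => (J x).2) =ᶠ[𝓝 p] fun _ => 0 := by
    filter_upwards [hRC, eventually_ricci_det_ne_zero hs hΓ hp hdet, hs.mem_nhds hp,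
      ht.mem_nhds hpt] with x h1 h2 h3 h4
    exact snd_eq_zero_of_mem_solValues hs hΓ hsym h3 hμ h1 h2 (hJ.mem_solValues ht h4)
  have hz : (J p).2 = 0 := h0.self_of_nhds
  have hd := (hJ p hpt).snd.fderiv
  rw [h0.fderiv_eq] at hd
  have key : ∀ v w, (J p).1 * christRicci Γ p v w = 0 := by
    intro v w
    have := congrArg (fun L => L v w) hd
    simp [quasiForm_apply, hz, christRicciSym_eq hRC.self_of_nhds.1, hμ0] at this
    simpa using this
  refine Prod.ext ?_ hz
  by_contra hne
  have hr : ∀ v w, christRicci Γ p v w = 0 := fun v w =>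
    (mul_eq_zero.1 (key v w)).resolve_left hne
  exact hdet (by simp [hr])

theorem finrank_solValues_zero_of_det_ne_zero (hs : IsOpen s) (hΓ : ContDiffOn ℝ ∞ Γ s)
    (hsym : ∀ x ∈ s, ∀ u v, Γ x u v = Γ x v u) (hp : p ∈ s)
    (hRC : RicciCodazzi Γ p)
    (hdet : christRicci Γ p (stdVec 0) (stdVec 0) * christRicci Γ p (stdVec 1) (stdVec 1) -
      christRicci Γ p (stdVec 0) (stdVec 1) * christRicci Γ p (stdVec 1) (stdVec 0) ≠ 0) :
    Module.finrank ℝ (solValues (quasiForm Γ 0) p) = 1 := by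
  have : solValues (quasiForm Γ 0) p = Submodule.span ℝ {((1, 0) : Jet)} := by
    refine le_antisymm (fun j hj => ?_) ?_
    · have hj2 := snd_eq_zero_of_mem_solValues hs hΓ hsym hp (by norm_num) hRC hdet hj
      rw [Submodule.mem_span_singleton]
      exact ⟨j.1, Prod.ext (by simp) (by simp [hj2])⟩
    · rw [Submodule.span_singleton_le_iff_mem]
      refine ⟨fun _ => (1, 0), univ, isOpen_univ, mem_univ p, fun x _ => ?_, rfl⟩
      refine (hasFDerivAt_const _ x).congr_fderiv ?_
      ext <;> simp [quasiForm_apply]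
  rw [this]
  exact finrank_span_singleton (fun h => one_ne_zero (congrArg Prod.fst h))

/-- If all 1-jets at a point extend to solutions with `μ ≠ -1`, the Ricci tensor vanishes there. -/
theorem christRicci_eq_zero_of_solValues_eq_top (hs : IsOpen s) (hΓ : ContDiffOn ℝ ∞ Γ s)
    (hsym : ∀ x ∈ s, ∀ u v, Γ x u v = Γ x v u) (hp : p ∈ s) (hμ : μ ≠ -1)
    (htop : solValues (quasiForm Γ μ) p = ⊤) (v w : Plane) : christRicci Γ p v w = 0 := by
  have hmem : ∀ j : Jet, j ∈ solValues (quasiForm Γ μ) p := fun j => htop ▸ Submodule.mem_top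
  -- Jets with value `0` and differential a coordinate form isolate the components of `ρ + μ ρ_s`.
  have hz : ∀ v w, christRicci Γ p v w + μ * christRicciSym Γ p v w = 0 := by
    have e0 : ∀ z, christRicci Γ p (stdVec 1) z + μ * christRicciSym Γ p (stdVec 1) z = 0 :=
      fun z => by
        have := integrability_of_mem_solValues hs hΓ hsym hp
          (hmem (0, EuclideanSpace.proj 0)) (stdVec 0) (stdVec 1) z
        simpa using this
    have e1 : ∀ z, christRicci Γ p (stdVec 0) z + μ * christRicciSym Γ p (stdVec 0) z = 0 :=
      fun z => by
        have := integrability_of_mem_solValues hs hΓ hsym hp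
          (hmem (0, EuclideanSpace.proj 1)) (stdVec 1) (stdVec 0) z
        simpa using this
    intro v w
    rw [plane_eq v]
    simp only [christRicciSym, christRicci_add_left, christRicci_smul_left, christRicci_add_right,
      christRicci_smul_right] at e0 e1 ⊢
    linear_combination v 0 * e1 w + v 1 * e0 w
  have h1 := hz v w
  have h2 := hz w v
  simp only [christRicciSym] at h1 h2
  have h3 : (1 + μ) * christRicci Γ p v w = 0 := by
    linear_combination (1 + μ / 2) * h1 - μ / 2 * h2
  exact (mul_eq_zero.1 h3).resolve_left fun h => hμ (by linarith)

end PlanarIntegrability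

end AffineSurface

end

/-! ### Projective changes of connections of the plane -/

section

set_option maxSynthPendingDepth 3

namespace AffineSurface

section PlanarProjective

variable {Γ Γ' : Plane → Plane →L[ℝ] Plane →L[ℝ] Plane} {θ : Plane → Plane →L[ℝ] ℝ}
  {s : Set Plane} {p : Plane}

/-- The tensor `∇'θ - θ ⊗ θ` that measures how the curvature of the connection `∇'` with
Christoffel tensor `Γ'` changes under the projective change by the 1-form `θ`. -/
def projSchouten (Γ' : Plane → Plane →L[ℝ] Plane →L[ℝ] Plane) (θ : Plane → Plane →L[ℝ] ℝ)
    (p u v : Plane) : ℝ :=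
  fderiv ℝ θ p u v - θ p (Γ' p u v) - θ p u * θ p v

/-- The curvature under a projective change by a closed 1-form. -/
theorem christCurv_projective (hΓ' : DifferentiableAt ℝ Γ' p) (hθ : DifferentiableAt ℝ θ p)
    (hsym : ∀ u v, Γ' p u v = Γ' p v u)
    (hclosed : ∀ u v, fderiv ℝ θ p u v = fderiv ℝ θ p v u)
    (hrel : ∀ᶠ q in 𝓝 p, ∀ u v, Γ q u v = Γ' q u v + θ q u • v + θ q v • u)
    (hΓ : DifferentiableAt ℝ Γ p)
    (u v w : Plane) : christCurv Γ p u v w = christCurv Γ' p u v w +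
      projSchouten Γ' θ p u w • v - projSchouten Γ' θ p v w • u := by
  have hd : ∀ u v w, fderiv ℝ Γ p u v w =
      fderiv ℝ Γ' p u v w + fderiv ℝ θ p u v • w + fderiv ℝ θ p u w • v := by
    intro u v w
    have h1 := (hΓ.hasFDerivAt.clm_apply (hasFDerivAt_const v p)).clm_apply
      (hasFDerivAt_const w p)
    have h2 := ((hΓ'.hasFDerivAt.clm_apply (hasFDerivAt_const v p)).clm_apply
      (hasFDerivAt_const w p)).add ((hθ.hasFDerivAt.clm_apply (hasFDerivAt_const v p)).smul_const w)
      |>.add ((hθ.hasFDerivAt.clm_apply (hasFDerivAt_const w p)).smul_const v)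
    have he : (fun q => Γ q v w) =ᶠ[𝓝 p]
        ((fun q => Γ' q v w) + (fun q => θ q v • w)) + fun q => θ q w • v := by
      filter_upwards [hrel] with q hq using hq v w
    have h3 := congrArg (fun L => L u) (h1.unique (h2.congr_of_eventuallyEq he))
    simpa using h3
  have hr := hrel.self_of_nhds
  simp only [christCurv, hd, hr, map_add, map_smul, projSchouten, smul_eq_mul]
  rw [hclosed v u, hsym v u]
  module

theorem christRicci_projective (hΓ' : DifferentiableAt ℝ Γ' p) (hθ : DifferentiableAt ℝ θ p)
    (hsym : ∀ u v, Γ' p u v = Γ' p v u)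
    (hclosed : ∀ u v, fderiv ℝ θ p u v = fderiv ℝ θ p v u)
    (hrel : ∀ᶠ q in 𝓝 p, ∀ u v, Γ q u v = Γ' q u v + θ q u • v + θ q v • u)
    (hΓ : DifferentiableAt ℝ Γ p) (v w : Plane) :
    christRicci Γ p v w = christRicci Γ' p v w - projSchouten Γ' θ p v w := by
  rw [christRicci_eq, christRicci_eq,
    christCurv_projective hΓ' hθ hsym hclosed hrel hΓ (stdVec 0) (stdVec 1) w]
  have h1 : projSchouten Γ' θ p v w = v 0 * projSchouten Γ' θ p (stdVec 0) w +
      v 1 * projSchouten Γ' θ p (stdVec 1) w := by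
    conv_lhs => rw [plane_eq v]
    simp only [projSchouten, map_add, map_smul, add_apply, smul_apply, smul_eq_mul]
    ring
  rw [h1]
  simp
  ring

/-- A connection strongly projectively equivalent to a flat one, with `θ = dg`, has the solutions
`exp g * h` with `μ = -1`, where `h` is an affine function of the flat connection. -/
theorem solValues_eq_top_of_projective (hs : IsOpen s) (hΓ : ContDiffOn ℝ ∞ Γ s)
    (hΓ' : ContDiffOn ℝ ∞ Γ' s)
    (hθ : ContDiffOn ℝ ∞ θ s) (hsym : ∀ x ∈ s, ∀ u v, Γ' x u v = Γ' x v u)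
    (hclosed : ∀ x ∈ s, ∀ u v, fderiv ℝ θ x u v = fderiv ℝ θ x v u)
    (hrel : ∀ x ∈ s, ∀ u v, Γ x u v = Γ' x u v + θ x u • v + θ x v • u)
    (hflat : ∀ x ∈ s, ∀ u v w, christCurv Γ' x u v w = 0) (hp : p ∈ s) :
    solValues (quasiForm Γ (-1)) p = ⊤ := by
  have hric' : ∀ x ∈ s, ∀ v w, christRicci Γ' x v w = 0 := fun x hx v w => by
    simp [christRicci, hflat x hx]
  have hD : ∀ {F : Plane → Plane →L[ℝ] Plane →L[ℝ] Plane}, ContDiffOn ℝ ∞ F s →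
      ∀ x ∈ s, DifferentiableAt ℝ F x := fun hF x hx =>
    (hF.contDiffAt (hs.mem_nhds hx)).differentiableAt (by simp)
  have hθd : ∀ x ∈ s, DifferentiableAt ℝ θ x := fun x hx =>
    (hθ.contDiffAt (hs.mem_nhds hx)).differentiableAt (by simp)
  have hS : ∀ x ∈ s, ∀ v w, christRicci Γ x v w = - projSchouten Γ' θ x v w := fun x hx v w => by
    rw [christRicci_projective (hD hΓ' x hx) (hθd x hx) (hsym x hx) (hclosed x hx)
      (by filter_upwards [hs.mem_nhds hx] with q hq using hrel q hq) (hD hΓ x hx), hric' x hx]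
    ring
  have hSsym : ∀ x ∈ s, ∀ v w, christRicciSym Γ x v w = - projSchouten Γ' θ x v w :=
    fun x hx v w => by
      rw [christRicciSym_eq, hS x hx]
      intro v w
      rw [hS x hx, hS x hx, projSchouten, projSchouten, hclosed x hx v w, hsym x hx v w]
      ring
  obtain ⟨r, hr, hball⟩ := Metric.mem_nhds_iff.1 (hs.mem_nhds hp)
  obtain ⟨g, hg⟩ := (convex_ball p r).exists_forall_hasFDerivAt_of_fderiv_symmetric
    Metric.isOpen_ball (fun x hx => (hθd x (hball hx)).differentiableWithinAt)
    (fun x hx u v => hclosed x (hball hx) u v)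
  have hgs : ContDiffOn ℝ ∞ g (Metric.ball p r) := by
    rw [contDiffOn_infty_iff_fderiv_of_isOpen Metric.isOpen_ball]
    exact ⟨fun x hx => (hg x hx).differentiableAt.differentiableWithinAt,
      (hθ.mono hball).congr fun x hx => (hg x hx).fderiv⟩
  -- For a flat connection the equation `∇² h = 0` is integrable.
  have htop : solValues (quasiForm Γ' 0) p = ⊤ := by
    refine solValues_eq_top hs (contDiffOn_quasiForm hs hΓ' 0) hp ?_
    filter_upwards [hs.mem_nhds hp] with x hx u w
    refine ContinuousLinearMap.ext fun j => Prod.ext ?_ (ContinuousLinearMap.ext fun z => ?_)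
    · exact (pfaffCurv_quasiForm hs hΓ' hsym hx u w j 0).1
    · rw [(pfaffCurv_quasiForm hs hΓ' hsym hx u w j z).2, hric' x hx, hric' x hx]
      simp
  refine eq_top_iff.2 fun j _ => ?_
  -- This is the jet of `exp (-g) * f` when `f` has the jet `j`.
  have hj : ((Real.exp (-g p) * j.1, Real.exp (-g p) • (j.2 - j.1 • θ p)) : Jet) ∈
      solValues (quasiForm Γ' 0) p := htop ▸ Submodule.mem_top
  obtain ⟨J, t, ht, hpt, hJ, hJp⟩ := hj
  have hO : IsOpen (t ∩ Metric.ball p r) := ht.inter Metric.isOpen_ball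
  obtain ⟨hJ1, hJ2, hJ3⟩ := (hJ.mono inter_subset_left).jet hO
    (hΓ'.mono fun x (hx : x ∈ t ∩ Metric.ball p r) => hball hx.2)
  set h : Plane → ℝ := fun x => (J x).1 with hh
  have hpO : p ∈ t ∩ Metric.ball p r := ⟨hpt, Metric.mem_ball_self hr⟩
  have hd1 : ∀ x ∈ t ∩ Metric.ball p r, fderiv ℝ (fun y => Real.exp (g y) * h y) x =
      Real.exp (g x) • (fderiv ℝ h x + h x • θ x) := by
    intro x hx
    have hhx : HasFDerivAt h (fderiv ℝ h x) x :=
      ((hJ1.contDiffAt (hO.mem_nhds hx)).differentiableAt (by simp)).hasFDerivAt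
    have hm : HasFDerivAt (fun y => Real.exp (g y) * h y) _ x := (hg x hx.2).exp.mul hhx
    rw [hm.fderiv]
    ext u; simp; ring
  have hF : ContDiffOn ℝ ∞ (fun y => Real.exp (g y) * h y) (t ∩ Metric.ball p r) :=
    ((hgs.mono inter_subset_right).exp).mul hJ1
  have hQ : ∀ x ∈ t ∩ Metric.ball p r, IsPlanarQE Γ (-1) (fun y => Real.exp (g y) * h y) x := by
    intro x hx u v
    have hhx : HasFDerivAt h (fderiv ℝ h x) x :=
      ((hJ1.contDiffAt (hO.mem_nhds hx)).differentiableAt (by simp)).hasFDerivAt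
    have hh2 : HasFDerivAt (fderiv ℝ h) (fderiv ℝ (fderiv ℝ h) x) x :=
      (((hJ1.contDiffAt (hO.mem_nhds hx)).fderiv_right (m := 1) (by norm_cast)).differentiableAt
        (by simp)).hasFDerivAt
    have he : fderiv ℝ (fun y => Real.exp (g y) * h y) =ᶠ[𝓝 x]
        fun x => Real.exp (g x) • (fderiv ℝ h x + h x • θ x) := by
      filter_upwards [hO.mem_nhds hx] with y hy using hd1 y hy
    have h2 : HasFDerivAt (fun x => Real.exp (g x) • (fderiv ℝ h x + h x • θ x)) _ x :=
      (hg x hx.2).exp.smul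
      (hh2.add (hhx.smul (hθd x (hball hx.2)).hasFDerivAt))
    have e1 := hJ3 x hx u v
    rw [hd1 x hx, he.fderiv_eq, h2.fderiv, hSsym x (hball hx.2)]
    simp only [hrel x (hball hx.2), projSchouten, map_add, map_smul, add_apply, smul_apply,
      smul_eq_mul, ContinuousLinearMap.smulRight_apply, zero_mul] at e1 ⊢
    linear_combination Real.exp (g x) * e1
  have hmem := (isPfaffSol_jet hO hF hQ).mem_solValues hO hpO
  convert hmem using 1
  have e1 : (J p).1 = Real.exp (-g p) * j.1 := by rw [hJp]
  have e2 : fderiv ℝ h p = Real.exp (-g p) • (j.2 - j.1 • θ p) := by rw [hJ2 p hpO, hJp]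
  have e3 : Real.exp (g p) * Real.exp (-g p) = 1 := by rw [← Real.exp_add]; simp
  refine Prod.ext ?_ ?_
  · simp only [hh, e1]
    linear_combination (-j.1) * e3
  · rw [hd1 p hpO, e2]
    ext u
    simp only [hh, e1, smul_apply, add_apply, sub_apply, smul_eq_mul]
    linear_combination (-j.2 u) * e3

/-- A positive solution `F` with `μ = -1` makes the connection with Christoffel tensor
`Γ - θ ⊗ 1 - 1 ⊗ θ`, `θ = d log F`, flat, provided the Ricci tensor is symmetric. -/
theorem christCurv_eq_zero_of_solution {F : Plane → ℝ} (hΓ : DifferentiableAt ℝ Γ p)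
    (hΓ' : DifferentiableAt ℝ Γ' p) (hF : ContDiffAt ℝ ∞ F p) (hpos : 0 < F p)
    (hQ : IsPlanarQE Γ (-1) F p) (hsym : ∀ u v, Γ p u v = Γ p v u)
    (hric : ∀ v w, christRicci Γ p v w = christRicci Γ p w v)
    (hθ : θ =ᶠ[𝓝 p] fun q => (F q)⁻¹ • fderiv ℝ F q)
    (hrel : ∀ᶠ q in 𝓝 p, ∀ u v, Γ q u v = Γ' q u v + θ q u • v + θ q v • u) (u v w : Plane) :
    christCurv Γ' p u v w = 0 := by
  have hne := hpos.ne'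
  have h1 : HasFDerivAt F (fderiv ℝ F p) p := (hF.differentiableAt (by simp)).hasFDerivAt
  have h2 : HasFDerivAt (fderiv ℝ F) (fderiv ℝ (fderiv ℝ F) p) p :=
    ((hF.fderiv_right (m := 1) (by norm_cast)).differentiableAt (by simp)).hasFDerivAt
  have h3 := (((hasDerivAt_inv hne).comp_hasFDerivAt p h1).smul h2).congr_of_eventuallyEq hθ
  have hr := hrel.self_of_nhds
  have hsym' : ∀ u v, Γ' p u v = Γ' p v u := fun u v => by
    have a := hr u v
    have b := hr v u
    rw [hsym u v] at a
    rw [a] at b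
    have : Γ' p u v + (θ p u • v + θ p v • u) = Γ' p v u + (θ p u • v + θ p v • u) := by
      rw [← add_assoc, b]; abel
    exact add_right_cancel this
  have hdθ : ∀ u v, fderiv ℝ θ p u v = (F p)⁻¹ * fderiv ℝ (fderiv ℝ F) p u v -
      θ p u * θ p v := by
    intro u v
    rw [h3.fderiv, hθ.self_of_nhds]
    simp
    field_simp
    ring
  have hS2 : ∀ u v, fderiv ℝ (fderiv ℝ F) p u v = fderiv ℝ (fderiv ℝ F) p v u :=
    fun u v => (hF.isSymmSndFDerivAt (by
      rw [minSmoothness_of_isRCLikeNormedField]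
      exact (WithTop.coe_le_coe.2 le_top : ((2 : ℕ∞) : WithTop ℕ∞) ≤ ∞))) u v
  have hclosed : ∀ u v, fderiv ℝ θ p u v = fderiv ℝ θ p v u := fun u v => by
    rw [hdθ, hdθ, hS2 u v]; ring
  -- The equation for `F` says that the change of the Ricci tensor cancels it.
  have hSch : ∀ u v, projSchouten Γ' θ p u v = -christRicci Γ p u v := by
    intro u v
    have q := hQ u v
    rw [christRicciSym_eq hric, hr] at q
    have e : θ p = (F p)⁻¹ • fderiv ℝ F p := hθ.self_of_nhds
    rw [projSchouten, hdθ, e]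
    rw [e] at q
    simp only [map_add, map_smul, smul_apply, smul_eq_mul] at q ⊢
    field_simp at q ⊢
    linear_combination q
  have hc := christCurv_projective hΓ' h3.differentiableAt hsym' hclosed hrel hΓ u v w
  rw [christCurv_eq_ricci u v w, hSch, hSch] at hc
  have : christCurv Γ' p u v w = (christRicci Γ p v w • u - christRicci Γ p u w • v) -
    (-christRicci Γ p u w • v) + (-christRicci Γ p v w • u) := by
    rw [hc]; abel
  rw [this]
  module

end PlanarProjective

end AffineSurface

end

/-! ### Coordinates on a surface -/

section

set_option maxSynthPendingDepth 3

namespace AffineSurface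

variable {M : Type*} [TopologicalSpace M] [ChartedSpace Plane M]

section Charts

variable {F : Type*} [NormedAddCommGroup F] [NormedSpace ℝ F] {P x : M}

theorem extChartAt_symm_tendsto (hx : x ∈ (chartAt Plane P).source) :
    Tendsto (extChartAt (𝓡 2) P).symm (𝓝 (extChartAt (𝓡 2) P x)) (𝓝 x) := by
  have h := continuousAt_extChartAt_symm' (I := 𝓡 2) (x := P) (x' := x)
    (by rwa [extChartAt_source])
  rwa [ContinuousAt, (extChartAt (𝓡 2) P).left_inv (by rwa [extChartAt_source])] at h

theorem extChartAt_tendsto (hx : x ∈ (chartAt Plane P).source) :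
    Tendsto (extChartAt (𝓡 2) P) (𝓝 x) (𝓝 (extChartAt (𝓡 2) P x)) :=
  continuousAt_extChartAt' (I := 𝓡 2) (by rwa [extChartAt_source])

theorem extChartAt_left_inv (hx : x ∈ (chartAt Plane P).source) :
    (extChartAt (𝓡 2) P).symm (extChartAt (𝓡 2) P x) = x :=
  (extChartAt (𝓡 2) P).left_inv (by rwa [extChartAt_source])

theorem eventually_mem_source (hx : x ∈ (chartAt Plane P).source) :
    ∀ᶠ y in 𝓝 x, y ∈ (chartAt Plane P).source :=
  (chartAt Plane P).open_source.mem_nhds hx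

/-- The image in the preferred chart at `P` of the part of `U` that lies in its domain. -/
def chartDomain (P : M) (U : Set M) : Set Plane :=
  (extChartAt (𝓡 2) P).target ∩ (extChartAt (𝓡 2) P).symm ⁻¹' U

theorem isOpen_chartDomain {U : Set M} (hU : IsOpen U) : IsOpen (chartDomain P U) :=
  (continuousOn_extChartAt_symm P).isOpen_inter_preimage (isOpen_extChartAt_target P) hU

theorem mem_chartDomain_iff {U : Set M} {p : Plane} : p ∈ chartDomain P U ↔
    ∃ x ∈ (chartAt Plane P).source, x ∈ U ∧ extChartAt (𝓡 2) P x = p := by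
  constructor
  · rintro ⟨h1, h2⟩
    refine ⟨_, ?_, h2, (extChartAt (𝓡 2) P).right_inv h1⟩
    rw [← extChartAt_source (𝓡 2)]
    exact (extChartAt (𝓡 2) P).map_target h1
  · rintro ⟨x, hx, hU, rfl⟩
    refine ⟨(extChartAt (𝓡 2) P).map_source (by rwa [extChartAt_source]), ?_⟩
    rwa [mem_preimage, extChartAt_left_inv hx]

theorem eventually_chart (hx : x ∈ (chartAt Plane P).source) {p : M → Prop} (h : ∀ᶠ y in 𝓝 x, p y) :
    ∀ᶠ q in 𝓝 (extChartAt (𝓡 2) P x), ∃ y ∈ (chartAt Plane P).source,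
      p y ∧ extChartAt (𝓡 2) P y = q := by
  filter_upwards [(extChartAt_symm_tendsto hx).eventually (h.and (eventually_mem_source hx)),
    (isOpen_extChartAt_target (I := 𝓡 2) P).mem_nhds
      ((extChartAt (𝓡 2) P).map_source (by rwa [extChartAt_source]))] with q hq hqt
  exact ⟨_, hq.2, hq.1, (extChartAt (𝓡 2) P).right_inv hqt⟩

theorem mem_chartDomain_univ (P : M) : extChartAt (𝓡 2) P P ∈ chartDomain P univ :=
  mem_chartDomain_iff.2 ⟨P, mem_chart_source _ P, mem_univ _, rfl⟩

variable [IsManifold (𝓡 2) ∞ M]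

theorem contMDiffAt_iff_contDiffAt_chart {g : M → F} (hx : x ∈ (chartAt Plane P).source) :
    ContMDiffAt (𝓡 2) 𝓘(ℝ, F) ∞ g x ↔
      ContDiffAt ℝ ∞ (g ∘ (extChartAt (𝓡 2) P).symm) (extChartAt (𝓡 2) P x) := by
  rw [contMDiffAt_iff_source_of_mem_source (x := P) hx, ModelWithCorners.range_eq_univ,
    contMDiffWithinAt_univ, contMDiffAt_iff_contDiffAt]

theorem mdifferentiableAt_iff_chart {g : M → F} (hx : x ∈ (chartAt Plane P).source) :
    MDifferentiableAt (𝓡 2) 𝓘(ℝ, F) g x ↔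
      DifferentiableAt ℝ (g ∘ (extChartAt (𝓡 2) P).symm) (extChartAt (𝓡 2) P x) := by
  rw [mdifferentiableAt_iff_source_of_mem_source (x' := x) (x := P) hx,
    ModelWithCorners.range_eq_univ,
    mdifferentiableWithinAt_univ, mdifferentiableAt_iff_differentiableAt]

/-- The coordinates of a tangent vector with respect to the coordinate vector fields of the
preferred chart at `P`. -/
def chartVec (P x : M) : TangentSpace (𝓡 2) x →L[ℝ] Plane :=
  (trivializationAt Plane (TangentSpace (𝓡 2)) P).continuousLinearMapAt ℝ x

/-- The vector field on the domain of the preferred chart at `P` with constant coordinates `v`. -/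
def frame (P : M) (v : Plane) (x : M) : TangentSpace (𝓡 2) x :=
  (trivializationAt Plane (TangentSpace (𝓡 2)) P).symmL ℝ x v

theorem chartVec_frame (hx : x ∈ (chartAt Plane P).source) (v : Plane) :
    chartVec P x (frame P v x) = v :=
  Trivialization.continuousLinearMapAt_symmL (R := ℝ)
    (trivializationAt Plane (TangentSpace (𝓡 2)) P) hx v

theorem frame_chartVec (hx : x ∈ (chartAt Plane P).source) (u : TangentSpace (𝓡 2) x) :
    frame P (chartVec P x u) x = u :=
  Trivialization.symmL_continuousLinearMapAt (R := ℝ)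
    (trivializationAt Plane (TangentSpace (𝓡 2)) P) hx u

theorem trivializationAt_snd (hx : x ∈ (chartAt Plane P).source) (u : TangentSpace (𝓡 2) x) :
    (trivializationAt Plane (TangentSpace (𝓡 2)) P ⟨x, u⟩).2 = chartVec P x u :=
  (congrFun ((trivializationAt Plane (TangentSpace (𝓡 2)) P).coe_linearMapAt_of_mem (R := ℝ)
    hx) u).symm

theorem chartVec_eq_mfderiv (hx : x ∈ (chartAt Plane P).source) :
    chartVec P x = mfderiv (𝓡 2) 𝓘(ℝ, Plane) (extChartAt (𝓡 2) P) x :=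
  TangentBundle.continuousLinearMapAt_trivializationAt hx

theorem chartVec_self (v : TangentSpace (𝓡 2) P) : chartVec P P v = v := by
  rw [chartVec_eq_mfderiv (mem_chart_source _ P), mfderiv_extChartAt_self]
  rfl

theorem mvfderiv_eq_fderiv_chart {g : M → F} (hx : x ∈ (chartAt Plane P).source)
    (hg : MDifferentiableAt (𝓡 2) 𝓘(ℝ, F) g x) (u : TangentSpace (𝓡 2) x) :
    mvfderiv (𝓡 2) g x u = fderiv ℝ (g ∘ (extChartAt (𝓡 2) P).symm) (extChartAt (𝓡 2) P x)
      (chartVec P x u) := by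
  have hφ : MDifferentiableAt (𝓡 2) 𝓘(ℝ, Plane) (extChartAt (𝓡 2) P) x :=
    mdifferentiableAt_extChartAt hx
  have hG := ((mdifferentiableAt_iff_chart hx).1 hg)
  have he : g =ᶠ[𝓝 x] (g ∘ (extChartAt (𝓡 2) P).symm) ∘ extChartAt (𝓡 2) P := by
    filter_upwards [eventually_mem_source hx] with y hy
    simp only [Function.comp_apply, extChartAt_left_inv hy]
  have h := mfderiv_comp x hG.mdifferentiableAt hφ
  rw [← chartVec_eq_mfderiv hx, mfderiv_eq_fderiv] at h
  have h2 : mfderiv (𝓡 2) 𝓘(ℝ, F) g x = _ := he.mfderiv_eq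
  change mfderiv (𝓡 2) 𝓘(ℝ, F) g x u = _
  rw [h2]
  exact congrArg (fun L => L u) h

theorem contMDiffAt_field_iff {Y : (y : M) → TangentSpace (𝓡 2) y}
    (hx : x ∈ (chartAt Plane P).source) :
    ContMDiffAt (𝓡 2) (𝓡 2).tangent ∞ (fun y => (⟨y, Y y⟩ : TangentBundle (𝓡 2) M)) x ↔
      ContMDiffAt (𝓡 2) 𝓘(ℝ, Plane) ∞ (fun y => chartVec P y (Y y)) x := by
  refine ((trivializationAt Plane (TangentSpace (𝓡 2)) P).contMDiffAt_section_iff hx).trans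
    (Filter.EventuallyEq.contMDiffAt_iff ?_)
  filter_upwards [eventually_mem_source hx] with y hy
  exact trivializationAt_snd hy _

theorem mdifferentiableAt_field_iff {Y : (y : M) → TangentSpace (𝓡 2) y}
    (hx : x ∈ (chartAt Plane P).source) :
    MDifferentiableAt (𝓡 2) (𝓡 2).tangent (fun y => (⟨y, Y y⟩ : TangentBundle (𝓡 2) M)) x ↔
      MDifferentiableAt (𝓡 2) 𝓘(ℝ, Plane) (fun y => chartVec P y (Y y)) x := by
  refine ((trivializationAt Plane (TangentSpace (𝓡 2)) P).mdifferentiableAt_section_iff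
    (IB := 𝓡 2) Y hx).trans (Filter.EventuallyEq.mdifferentiableAt_iff ?_)
  filter_upwards [eventually_mem_source hx] with y hy
  exact trivializationAt_snd hy _

theorem contMDiffAt_frame (hx : x ∈ (chartAt Plane P).source) (v : Plane) :
    ContMDiffAt (𝓡 2) (𝓡 2).tangent ∞ (fun y => (⟨y, frame P v y⟩ : TangentBundle (𝓡 2) M)) x := by
  rw [contMDiffAt_field_iff hx]
  refine (contMDiffAt_const (c := v)).congr_of_eventuallyEq ?_
  filter_upwards [eventually_mem_source hx] with y hy
  exact chartVec_frame hy v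

theorem coordField_eq_frame (v : TangentSpace (𝓡 2) x) :
    ∀ᶠ y in 𝓝 x, coordField v y = frame x (show Plane from v) y := by
  filter_upwards [eventually_mem_source (mem_chart_source Plane x)] with y hy
  have hv : ((trivializationAt Plane (TangentSpace (𝓡 2)) x) ⟨x, v⟩).2 = v := by
    rw [trivializationAt_snd (mem_chart_source _ x), chartVec_self]
  simp only [coordField, extend, hv]
  exact (Trivialization.symmL_apply (R := ℝ)
    (trivializationAt Plane (TangentSpace (𝓡 2)) x) hy (show Plane from v)).symm

theorem coordField_self (v : TangentSpace (𝓡 2) x) : coordField v x = v := by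
  rw [(coordField_eq_frame v).self_of_nhds]
  nth_rewrite 1 [← chartVec_self v]
  exact frame_chartVec (mem_chart_source _ x) v

/-- A constant vector field of the plane. -/
def constField (w : Plane) (p : Plane) : TangentSpace 𝓘(ℝ, Plane) p := w

theorem mdifferentiableAt_constField (w p : Plane) :
    MDifferentiableAt 𝓘(ℝ, Plane) 𝓘(ℝ, Plane).tangent
      (fun y => (⟨y, constField w y⟩ : TangentBundle 𝓘(ℝ, Plane) Plane)) p := by
  refine ContMDiffAt.mdifferentiableAt (n := 1) ?_ one_ne_zero
  rw [contMDiffAt_vectorSpace_iff_contDiffAt]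
  exact contDiffAt_const

theorem mlieBracket_constField (u v p : Plane) :
    VectorField.mlieBracket 𝓘(ℝ, Plane) (constField u) (constField v) p = 0 := by
  rw [← VectorField.mlieBracketWithin_univ, VectorField.mlieBracketWithin_eq_lieBracketWithin]
  change VectorField.lieBracketWithin ℝ (fun _ : Plane => u) (fun _ : Plane => v) univ p = 0
  simp [VectorField.lieBracketWithin]

/-- Coordinate vector fields commute. -/
theorem mlieBracket_frame (hx : x ∈ (chartAt Plane P).source) (u v : Plane) :
    VectorField.mlieBracket (𝓡 2) (frame P u) (frame P v) x = 0 := by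
  have key : ∀ w : Plane, ∀ y ∈ (chartAt Plane P).source, frame P w y =
      VectorField.mpullback (𝓡 2) 𝓘(ℝ, Plane) (extChartAt (𝓡 2) P) (constField w) y := by
    intro w y hy
    have hi := isInvertible_mfderiv_extChartAt (I := 𝓡 2) (x := P) (y := y)
      (by rwa [extChartAt_source])
    obtain ⟨L, hL⟩ := hi
    rw [VectorField.mpullback_apply, ← hL, ContinuousLinearMap.inverse_equiv]
    apply L.injective
    have h1 := chartVec_frame hy w
    rw [chartVec_eq_mfderiv hy, ← hL] at h1
    exact h1.trans (L.apply_symm_apply _).symm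
  have h1 : ∀ w, frame P w =ᶠ[𝓝 x]
      VectorField.mpullback (𝓡 2) 𝓘(ℝ, Plane) (extChartAt (𝓡 2) P) (constField w) := by
    intro w
    filter_upwards [eventually_mem_source hx] with y hy using key w y hy
  have h2 : minSmoothness ℝ 2 ≤ ∞ := by
    rw [minSmoothness_of_isRCLikeNormedField]
    exact (WithTop.coe_le_coe.2 le_top : ((2 : ℕ∞) : WithTop ℕ∞) ≤ ∞)
  have : IsManifold (𝓡 2) (minSmoothness ℝ 2) M := .of_le h2
  rw [Filter.EventuallyEq.mlieBracket_vectorField_eq (h1 u) (h1 v),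
    ← VectorField.mpullback_mlieBracket (n := ∞) (mdifferentiableAt_constField u _)
      (mdifferentiableAt_constField v _) (contMDiffAt_extChartAt' hx) h2,
    VectorField.mpullback_apply, mlieBracket_constField, map_zero]

end Charts

end AffineSurface

end

/-! ### Connections in coordinates -/

section

set_option maxSynthPendingDepth 3

namespace AffineSurface

variable {M : Type*} [TopologicalSpace M] [ChartedSpace Plane M] [IsManifold (𝓡 2) ∞ M]

section Connections

variable {cov : Connection M} {P x : M}

/-- The representation of a vector field in the preferred chart at `P`. -/
def chartRep (P : M) (Y : (y : M) → TangentSpace (𝓡 2) y) (p : Plane) : Plane :=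
  chartVec P ((extChartAt (𝓡 2) P).symm p) (Y ((extChartAt (𝓡 2) P).symm p))

/-- The Christoffel tensor of a connection in the preferred chart at `P`. -/
def chartChrist (cov : Connection M) (P : M) (p : Plane) : Plane →L[ℝ] Plane →L[ℝ] Plane :=
  ∑ i : Fin 2, ∑ j : Fin 2,
    (EuclideanSpace.proj j : Plane →L[ℝ] ℝ).smulRight
      ((EuclideanSpace.proj i : Plane →L[ℝ] ℝ).smulRight
        (chartRep P (fun y => cov (frame P (stdVec i)) y (frame P (stdVec j) y)) p))

theorem chartRep_apply (hx : x ∈ (chartAt Plane P).source) (Y : (y : M) → TangentSpace (𝓡 2) y) :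
    chartRep P Y (extChartAt (𝓡 2) P x) = chartVec P x (Y x) := by
  rw [chartRep, extChartAt_left_inv hx]

theorem frame_add (u v : Plane) : frame P (u + v) x = frame P u x + frame P v x := map_add _ _ _

theorem frame_smul (c : ℝ) (v : Plane) : frame P (c • v) x = c • frame P v x := map_smul _ _ _

theorem contDiffAt_chartRep {Y : (y : M) → TangentSpace (𝓡 2) y}
    (hx : x ∈ (chartAt Plane P).source)
    (hY : ContMDiffAt (𝓡 2) (𝓡 2).tangent ∞ (fun y => (⟨y, Y y⟩ : TangentBundle (𝓡 2) M)) x) :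
    ContDiffAt ℝ ∞ (chartRep P Y) (extChartAt (𝓡 2) P x) :=
  (contMDiffAt_iff_contDiffAt_chart hx).1 ((contMDiffAt_field_iff hx).1 hY)

theorem cov_congr {Y Z : (y : M) → TangentSpace (𝓡 2) y}
    (hY : MDifferentiableAt (𝓡 2) (𝓡 2).tangent (fun y => (⟨y, Y y⟩ : TangentBundle (𝓡 2) M)) x)
    (h : ∀ᶠ y in 𝓝 x, Y y = Z y) : cov Y x = cov Z x := by
  refine cov.isCovariantDerivativeOnUniv.congr_of_eventuallyEq hY ?_ univ_mem h
  refine hY.congr_of_eventuallyEq ?_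
  filter_upwards [h] with y hy
  rw [hy]

/-- The vector field is smooth on a neighbourhood of `x`. -/
def SmoothFieldNear (Y : (y : M) → TangentSpace (𝓡 2) y) (x : M) : Prop :=
  ∀ᶠ y in 𝓝 x, ContMDiffAt (𝓡 2) (𝓡 2).tangent ∞
    (fun y => (⟨y, Y y⟩ : TangentBundle (𝓡 2) M)) y

theorem smoothFieldNear_frame (hx : x ∈ (chartAt Plane P).source) (v : Plane) :
    SmoothFieldNear (frame P v) x := by
  filter_upwards [eventually_mem_source hx] with y hy using contMDiffAt_frame hy v

theorem smoothFieldNear_coordField (v : TangentSpace (𝓡 2) x) :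
    SmoothFieldNear (coordField v) x := by
  filter_upwards [(coordField_eq_frame v).eventually_nhds,
    eventually_mem_source (mem_chart_source Plane x)] with y hy hys
  refine (contMDiffAt_frame hys (show Plane from v)).congr_of_eventuallyEq ?_
  filter_upwards [hy] with z hz
  rw [hz]

theorem SmoothFieldNear.mdifferentiableAt {Y : (y : M) → TangentSpace (𝓡 2) y}
    (hY : SmoothFieldNear Y x) :
    MDifferentiableAt (𝓡 2) (𝓡 2).tangent (fun y => (⟨y, Y y⟩ : TangentBundle (𝓡 2) M)) x :=
  hY.self_of_nhds.mdifferentiableAt (by simp)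

/-- The local formula `∇_u Y = D_u Y + Γ(u, Y)`. -/
theorem chartVec_cov (hx : x ∈ (chartAt Plane P).source) {Y : (y : M) → TangentSpace (𝓡 2) y}
    (hY : MDifferentiableAt (𝓡 2) (𝓡 2).tangent (fun y => (⟨y, Y y⟩ : TangentBundle (𝓡 2) M)) x)
    (u : TangentSpace (𝓡 2) x) :
    chartVec P x (cov Y x u) =
      fderiv ℝ (chartRep P Y) (extChartAt (𝓡 2) P x) (chartVec P x u) +
        chartChrist cov P (extChartAt (𝓡 2) P x) (chartVec P x u) (chartVec P x (Y x)) := by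
  have hY' := (mdifferentiableAt_field_iff hx).1 hY
  -- the coordinates of `Y` with respect to the coordinate vector fields
  let g : Fin 2 → M → ℝ := fun i y => chartVec P y (Y y) i
  have hg : ∀ i, MDifferentiableAt (𝓡 2) 𝓘(ℝ, ℝ) (g i) x := fun i =>
    ((EuclideanSpace.proj i : Plane →L[ℝ] ℝ).mdifferentiableAt (x := chartVec P x (Y x))).comp x hY'
  have hf : ∀ i, MDifferentiableAt (𝓡 2) (𝓡 2).tangent
      (fun y => (⟨y, frame P (stdVec i) y⟩ : TangentBundle (𝓡 2) M)) x := fun i =>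
    (contMDiffAt_frame hx (stdVec i)).mdifferentiableAt (by simp)
  have hgf : ∀ i, MDifferentiableAt (𝓡 2) (𝓡 2).tangent
      (fun y => (⟨y, (g i • frame P (stdVec i)) y⟩ : TangentBundle (𝓡 2) M)) x := fun i =>
    (hg i).smul_section (hf i)
  have he : ∀ᶠ y in 𝓝 x, Y y = (g 0 • frame P (stdVec 0) + g 1 • frame P (stdVec 1)) y := by
    filter_upwards [eventually_mem_source hx] with y hy
    conv_lhs => rw [← frame_chartVec hy (Y y), plane_eq (chartVec P y (Y y)), frame_add,
      frame_smul, frame_smul]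
    rfl
  have hc := cov.isCovariantDerivativeOnUniv
  have hD : ∀ i, mvfderiv (𝓡 2) (g i) x u =
      fderiv ℝ (chartRep P Y) (extChartAt (𝓡 2) P x) (chartVec P x u) i := by
    intro i
    rw [mvfderiv_eq_fderiv_chart hx (hg i)]
    have h1 := ((EuclideanSpace.proj i : Plane →L[ℝ] ℝ).hasFDerivAt.comp _
      ((mdifferentiableAt_iff_chart hx).1 hY').hasFDerivAt).fderiv
    exact congrArg (fun L => L (chartVec P x u)) h1
  have hu : ∀ i, chartVec P x (cov (frame P (stdVec i)) x u) =
      chartVec P x u 0 • chartRep P (fun y => cov (frame P (stdVec i)) y (frame P (stdVec 0) y))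
        (extChartAt (𝓡 2) P x) +
      chartVec P x u 1 • chartRep P (fun y => cov (frame P (stdVec i)) y (frame P (stdVec 1) y))
        (extChartAt (𝓡 2) P x) := by
    intro i
    rw [chartRep_apply hx, chartRep_apply hx]
    conv_lhs => rw [← frame_chartVec hx u, plane_eq (chartVec P x u), frame_add, frame_smul,
      frame_smul]
    simp only [map_add, map_smul]
  rw [cov_congr hY he, hc.add (hgf 0) (hgf 1), hc.leibniz (hf 0) (hg 0), hc.leibniz (hf 1) (hg 1)]
  have hp : ∀ i (w : Plane), (EuclideanSpace.proj i : Plane →L[ℝ] ℝ) w = w i := fun _ _ => rfl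
  have h3 := plane_eq (fderiv ℝ (chartRep P Y) (extChartAt (𝓡 2) P x) (chartVec P x u))
  simp only [add_apply, smul_apply, ContinuousLinearMap.smulRight_apply, map_add, map_smul,
    chartVec_frame hx, hu, chartChrist, Fin.sum_univ_two, hp, g]
  erw [hD 0, hD 1]
  conv_rhs => rw [h3]
  module

variable {U : Set M}

/-- Smoothness of the connection concerns vector fields smooth on all of `U`; a bump function
extends it to vector fields that are smooth near a point only. -/
theorem contMDiffAt_cov [T2Space M] (hU : IsOpen U)
    (hcov : ContMDiffCovariantDerivativeOn (I := 𝓡 2) Plane ∞ cov.toFun U) (hx : x ∈ U)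
    {Y : (y : M) → TangentSpace (𝓡 2) y}
    (hY : SmoothFieldNear Y x) :
    ContMDiffAt (𝓡 2) ((𝓡 2).prod 𝓘(ℝ, Plane →L[ℝ] Plane)) ∞
      (fun y => TotalSpace.mk' (Plane →L[ℝ] Plane)
        (E := fun y : M => TangentSpace (𝓡 2) y →L[ℝ] TangentSpace (𝓡 2) y) y (cov Y y)) x := by
  obtain ⟨W, hYW, hW, hxW⟩ := eventually_nhds_iff.1 hY
  obtain ⟨b, -, hb⟩ := (SmoothBumpFunction.nhds_basis_tsupport (I := 𝓡 2) x).mem_iff.1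
    (hW.mem_nhds hxW)
  have hs : ContMDiff (𝓡 2) (𝓡 2).tangent ∞
      (fun y => (⟨y, ((b : M → ℝ) • Y) y⟩ : TangentBundle (𝓡 2) M)) :=
    ContMDiffOn.smul_section_of_tsupport b.contMDiff.contMDiffOn hW hb
      (fun y hy => (hYW y hy).contMDiffWithinAt)
  have h := (hcov.contMDiff (σ := (b : M → ℝ) • Y) hs.contMDiffOn).contMDiffAt (hU.mem_nhds hx)
  refine h.congr_of_eventuallyEq ?_
  filter_upwards [b.eventuallyEq_one.eventually_nhds, hW.mem_nhds hxW] with y hy hyW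
  rw [cov_congr (Z := (b : M → ℝ) • Y) ((hYW y hyW).mdifferentiableAt (by simp))]
  filter_upwards [hy] with z hz
  simp [hz]

theorem contMDiffAt_cov_apply [T2Space M] (hU : IsOpen U)
    (hcov : ContMDiffCovariantDerivativeOn (I := 𝓡 2) Plane ∞ cov.toFun U) (hx : x ∈ U)
    {X Y : (y : M) → TangentSpace (𝓡 2) y} (hX : ContMDiffAt (𝓡 2) (𝓡 2).tangent ∞
      (fun y => (⟨y, X y⟩ : TangentBundle (𝓡 2) M)) x) (hY : SmoothFieldNear Y x) :
    ContMDiffAt (𝓡 2) (𝓡 2).tangent ∞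
      (fun y => (⟨y, cov Y y (X y)⟩ : TangentBundle (𝓡 2) M)) x :=
  (contMDiffAt_cov hU hcov hx hY).clm_bundle_apply (v := X) hX

theorem contDiffOn_chartChrist [T2Space M] (hU : IsOpen U)
    (hcov : ContMDiffCovariantDerivativeOn (I := 𝓡 2) Plane ∞ cov.toFun U) :
    ContDiffOn ℝ ∞ (chartChrist cov P) (chartDomain P U) := by
  intro p hp
  obtain ⟨x, hx, hxU, rfl⟩ := mem_chartDomain_iff.1 hp
  refine ContDiffAt.contDiffWithinAt ?_
  refine ContDiffAt.sum fun i _ => ContDiffAt.sum fun j _ => ?_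
  have h := contDiffAt_chartRep hx (contMDiffAt_cov_apply hU hcov hxU
    (contMDiffAt_frame hx (stdVec j)) (smoothFieldNear_frame hx (stdVec i)))
  have h1 := ((ContinuousLinearMap.smulRightL ℝ Plane Plane
    (EuclideanSpace.proj i : Plane →L[ℝ] ℝ)).contDiff.contDiffAt).comp _ h
  exact ((ContinuousLinearMap.smulRightL ℝ Plane (Plane →L[ℝ] Plane)
    (EuclideanSpace.proj j : Plane →L[ℝ] ℝ)).contDiff.contDiffAt).comp _ h1

theorem chartRep_frame (hx : x ∈ (chartAt Plane P).source) (v : Plane) :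
    chartRep P (frame P v) =ᶠ[𝓝 (extChartAt (𝓡 2) P x)] fun _ => v := by
  filter_upwards [(extChartAt_symm_tendsto hx).eventually (eventually_mem_source hx)] with p hp
  exact chartVec_frame hp v

theorem chartChrist_symm (hx : x ∈ (chartAt Plane P).source) (htor : cov.torsion x = 0)
    (u v : Plane) : chartChrist cov P (extChartAt (𝓡 2) P x) u v =
      chartChrist cov P (extChartAt (𝓡 2) P x) v u := by
  have hf : ∀ w, MDifferentiableAt (𝓡 2) (𝓡 2).tangent
      (fun y => (⟨y, frame P w y⟩ : TangentBundle (𝓡 2) M)) x := fun w =>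
    (contMDiffAt_frame hx w).mdifferentiableAt (by simp)
  have h := cov.torsion_apply (hf u) (hf v)
  rw [htor, mlieBracket_frame hx] at h
  have h2 : ∀ a b, chartVec P x (cov (frame P a) x (frame P b x)) =
      chartChrist cov P (extChartAt (𝓡 2) P x) b a := by
    intro a b
    rw [chartVec_cov hx (hf a), chartVec_frame hx, chartVec_frame hx,
      (chartRep_frame hx a).fderiv_eq]
    simp
  have h3 := congrArg (chartVec P x) h
  simp only [map_sub, h2, map_zero, zero_apply, sub_zero] at h3
  exact (sub_eq_zero.1 h3.symm)

/-- In a chart, the Lie bracket is `∇_X Y - ∇_Y X` for any torsion free connection. -/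
theorem chartVec_mlieBracket (hx : x ∈ (chartAt Plane P).source) (htor : cov.torsion x = 0)
    {X Y : (y : M) → TangentSpace (𝓡 2) y}
    (hX : MDifferentiableAt (𝓡 2) (𝓡 2).tangent (fun y => (⟨y, X y⟩ : TangentBundle (𝓡 2) M)) x)
    (hY : MDifferentiableAt (𝓡 2) (𝓡 2).tangent (fun y => (⟨y, Y y⟩ : TangentBundle (𝓡 2) M)) x) :
    chartVec P x (VectorField.mlieBracket (𝓡 2) X Y x) =
      fderiv ℝ (chartRep P Y) (extChartAt (𝓡 2) P x) (chartVec P x (X x)) -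
        fderiv ℝ (chartRep P X) (extChartAt (𝓡 2) P x) (chartVec P x (Y x)) := by
  have h := cov.torsion_apply hX hY
  rw [htor] at h
  have h3 := congrArg (chartVec P x) h
  simp only [map_sub, chartVec_cov hx hX, chartVec_cov hx hY, map_zero, zero_apply,
    chartChrist_symm hx htor (chartVec P x (Y x))] at h3
  rw [← sub_eq_zero, ← neg_eq_zero.2 h3.symm]
  abel

end Connections

end AffineSurface

end

/-! ### Curvature, Hessian and exterior derivative in coordinates -/

section

set_option maxSynthPendingDepth 3

namespace AffineSurface

variable {M : Type*} [TopologicalSpace M] [ChartedSpace Plane M] [IsManifold (𝓡 2) ∞ M]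

section Tensors

variable {cov : Connection M} {P x : M} {U : Set M}

theorem chartRep_cov_apply (hx : x ∈ (chartAt Plane P).source)
    {X Y : (y : M) → TangentSpace (𝓡 2) y} (hY : SmoothFieldNear Y x) :
    chartRep P (fun y => cov Y y (X y)) =ᶠ[𝓝 (extChartAt (𝓡 2) P x)] fun q =>
      fderiv ℝ (chartRep P Y) q (chartRep P X q) +
        chartChrist cov P q (chartRep P X q) (chartRep P Y q) := by
  filter_upwards [eventually_chart hx (hY.eventually_nhds)] with q hq
  obtain ⟨y, hys, hy, rfl⟩ := hq
  have hy' : SmoothFieldNear Y y := hy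
  rw [chartRep_apply hys, chartRep_apply hys, chartRep_apply hys,
    chartVec_cov hys hy'.mdifferentiableAt]

/-- In the chart, the curvature is given by the Christoffel tensor. -/
theorem chartVec_curvature [T2Space M] (hU : IsOpen U)
    (hcov : ContMDiffCovariantDerivativeOn (I := 𝓡 2) Plane ∞ cov.toFun U) (hxU : x ∈ U)
    (htor : cov.torsion x = 0) (hx : x ∈ (chartAt Plane P).source)
    {X Y Z : (y : M) → TangentSpace (𝓡 2) y} (hX : SmoothFieldNear X x) (hY : SmoothFieldNear Y x)
    (hZ : SmoothFieldNear Z x) :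
    chartVec P x (curvature cov X Y Z x) = christCurv (chartChrist cov P) (extChartAt (𝓡 2) P x)
      (chartVec P x (X x)) (chartVec P x (Y x)) (chartVec P x (Z x)) := by
  have hd : ∀ {V : (y : M) → TangentSpace (𝓡 2) y}, SmoothFieldNear V x →
      DifferentiableAt ℝ (chartRep P V) (extChartAt (𝓡 2) P x) := fun hV =>
    (contDiffAt_chartRep hx hV.self_of_nhds).differentiableAt (by simp)
  have hZ2 : DifferentiableAt ℝ (fderiv ℝ (chartRep P Z)) (extChartAt (𝓡 2) P x) :=
    ((contDiffAt_chartRep hx hZ.self_of_nhds).fderiv_right (m := 1) (by norm_cast)).differentiableAt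
      (by simp)
  have hsym : fderiv ℝ (fderiv ℝ (chartRep P Z)) (extChartAt (𝓡 2) P x) (chartVec P x (X x))
      (chartVec P x (Y x)) = fderiv ℝ (fderiv ℝ (chartRep P Z)) (extChartAt (𝓡 2) P x)
      (chartVec P x (Y x)) (chartVec P x (X x)) :=
    ((contDiffAt_chartRep hx hZ.self_of_nhds).isSymmSndFDerivAt (by
      rw [minSmoothness_of_isRCLikeNormedField]
      exact (WithTop.coe_le_coe.2 le_top : ((2 : ℕ∞) : WithTop ℕ∞) ≤ ∞))).eq _ _
  have hΓ : DifferentiableAt ℝ (chartChrist cov P) (extChartAt (𝓡 2) P x) :=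
    ((contDiffOn_chartChrist hU hcov).contDiffAt ((isOpen_chartDomain hU).mem_nhds
      (mem_chartDomain_iff.2 ⟨x, hx, hxU, rfl⟩))).differentiableAt (by simp)
  -- the second covariant derivative `∇_W ∇_V Z` in the chart
  have key : ∀ {V W : (y : M) → TangentSpace (𝓡 2) y}, SmoothFieldNear V x → SmoothFieldNear W x →
      chartVec P x (cov (fun y => cov Z y (V y)) x (W x)) =
      fderiv ℝ (fderiv ℝ (chartRep P Z)) (extChartAt (𝓡 2) P x) (chartVec P x (W x))
        (chartVec P x (V x)) +
      fderiv ℝ (chartRep P Z) (extChartAt (𝓡 2) P x)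
        (fderiv ℝ (chartRep P V) (extChartAt (𝓡 2) P x) (chartVec P x (W x))) +
      (fderiv ℝ (chartChrist cov P) (extChartAt (𝓡 2) P x) (chartVec P x (W x)) (chartVec P x (V x))
          (chartVec P x (Z x)) +
        chartChrist cov P (extChartAt (𝓡 2) P x)
          (fderiv ℝ (chartRep P V) (extChartAt (𝓡 2) P x) (chartVec P x (W x)))
          (chartVec P x (Z x)) +
        chartChrist cov P (extChartAt (𝓡 2) P x) (chartVec P x (V x))
          (fderiv ℝ (chartRep P Z) (extChartAt (𝓡 2) P x) (chartVec P x (W x)))) +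
      chartChrist cov P (extChartAt (𝓡 2) P x) (chartVec P x (W x))
        (fderiv ℝ (chartRep P Z) (extChartAt (𝓡 2) P x) (chartVec P x (V x)) +
          chartChrist cov P (extChartAt (𝓡 2) P x) (chartVec P x (V x)) (chartVec P x (Z x))) := by
    intro V W hV hW
    have hm := (contMDiffAt_cov_apply hU hcov hxU hV.self_of_nhds hZ).mdifferentiableAt (by simp)
    rw [chartVec_cov hx hm, chartVec_cov hx hZ.mdifferentiableAt,
      (chartRep_cov_apply hx hZ).fderiv_eq]
    have h1 := ((hZ2.hasFDerivAt.clm_apply (hd hV).hasFDerivAt).add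
      ((hΓ.hasFDerivAt.clm_apply (hd hV).hasFDerivAt).clm_apply (hd hZ).hasFDerivAt))
    have h2 := congrArg (fun L => L (chartVec P x (W x))) h1.fderiv
    congr 1
    refine h2.trans ?_
    simp only [add_apply, ContinuousLinearMap.comp_apply, ContinuousLinearMap.flip_apply,
      chartRep_apply hx]
    abel
  rw [curvature, map_sub, map_sub, key hY hX, key hX hY, chartVec_cov hx hZ.mdifferentiableAt,
    chartVec_mlieBracket hx htor hX.mdifferentiableAt hY.mdifferentiableAt, hsym, christCurv]
  simp only [map_sub, map_add, sub_apply]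
  abel

theorem chartVec_curvatureAt [T2Space M] (hU : IsOpen U)
    (hcov : ContMDiffCovariantDerivativeOn (I := 𝓡 2) Plane ∞ cov.toFun U) (hxU : x ∈ U)
    (htor : cov.torsion x = 0) (hx : x ∈ (chartAt Plane P).source) (u v w : TangentSpace (𝓡 2) x) :
    chartVec P x (curvatureAt cov x u v w) =
      christCurv (chartChrist cov P) (extChartAt (𝓡 2) P x)
        (chartVec P x u) (chartVec P x v) (chartVec P x w) := by
  have h := chartVec_curvature hU hcov hxU htor hx (smoothFieldNear_coordField u)
    (smoothFieldNear_coordField v) (smoothFieldNear_coordField w)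
  rwa [coordField_self, coordField_self, coordField_self] at h

theorem chartVec_injective (hx : x ∈ (chartAt Plane P).source) :
    Function.Injective (chartVec P x) := fun u v h => by
  rw [← frame_chartVec hx u, h, frame_chartVec hx v]

/-- The Ricci tensor may be computed in any chart, although its definition takes the trace in the
basis of the preferred chart at `x`. -/
theorem ricci_eq_christRicci [T2Space M] (hU : IsOpen U)
    (hcov : ContMDiffCovariantDerivativeOn (I := 𝓡 2) Plane ∞ cov.toFun U) (hxU : x ∈ U)
    (htor : cov.torsion x = 0) (hx : x ∈ (chartAt Plane P).source) (v w : TangentSpace (𝓡 2) x) :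
    ricci cov x v w = christRicci (chartChrist cov P) (extChartAt (𝓡 2) P x)
        (chartVec P x v) (chartVec P x w) := by
  have h : ∀ z : TangentSpace (𝓡 2) x, curvatureAt cov x z v w =
      christRicci (chartChrist cov P) (extChartAt (𝓡 2) P x) (chartVec P x v) (chartVec P x w) • z -
      christRicci (chartChrist cov P) (extChartAt (𝓡 2) P x) (chartVec P x z) (chartVec P x w) • v
      := by
    intro z
    apply chartVec_injective hx
    rw [chartVec_curvatureAt hU hcov hxU htor hx, christCurv_eq_ricci, map_sub, map_smul, map_smul]
  have hv : v = (show Plane from v) 0 • coordVec x 0 + (show Plane from v) 1 • coordVec x 1 :=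
    plane_eq (show Plane from v)
  have hr : christRicci (chartChrist cov P) (extChartAt (𝓡 2) P x) (chartVec P x v)
      (chartVec P x w) = (show Plane from v) 0 * christRicci (chartChrist cov P)
        (extChartAt (𝓡 2) P x) (chartVec P x (coordVec x 0)) (chartVec P x w) +
      (show Plane from v) 1 * christRicci (chartChrist cov P)
        (extChartAt (𝓡 2) P x) (chartVec P x (coordVec x 1)) (chartVec P x w) := by
    conv_lhs => rw [hv]
    rw [map_add, map_smul, map_smul, christRicci_add_left, christRicci_smul_left,
      christRicci_smul_left]
  have h0 : ∀ (z : TangentSpace (𝓡 2) x) (a b : ℝ) (i : Fin 2),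
      (show Plane from (a • z - b • v)) i = a * (show Plane from z) i - b * (show Plane from v) i :=
    fun z a b i => rfl
  rw [ricci, Fin.sum_univ_two, h, h, h0, h0]
  have e0 : (show Plane from coordVec x 0) 0 = 1 := by
    change (EuclideanSpace.single (0 : Fin 2) (1 : ℝ) : Plane) 0 = 1
    simp
  have e1 : (show Plane from coordVec x 1) 1 = 1 := by
    change (EuclideanSpace.single (1 : Fin 2) (1 : ℝ) : Plane) 1 = 1
    simp
  rw [e0, e1]
  linarith [hr]

theorem ricciSym_eq_christRicciSym [T2Space M] (hU : IsOpen U)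
    (hcov : ContMDiffCovariantDerivativeOn (I := 𝓡 2) Plane ∞ cov.toFun U) (hxU : x ∈ U)
    (htor : cov.torsion x = 0) (hx : x ∈ (chartAt Plane P).source) (v w : TangentSpace (𝓡 2) x) :
    ricciSym cov x v w = christRicciSym (chartChrist cov P) (extChartAt (𝓡 2) P x)
        (chartVec P x v) (chartVec P x w) := by
  rw [ricciSym, ricci_eq_christRicci hU hcov hxU htor hx, ricci_eq_christRicci hU hcov hxU htor hx,
    christRicciSym]

/-- A covector field in the preferred chart at `P`. -/
def chartForm (P : M) (θ : (y : M) → TangentSpace (𝓡 2) y →L[ℝ] ℝ) (p : Plane) : Plane →L[ℝ] ℝ :=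
  (θ ((extChartAt (𝓡 2) P).symm p)).comp ((trivializationAt Plane (TangentSpace (𝓡 2)) P).symmL ℝ
    ((extChartAt (𝓡 2) P).symm p))

theorem chartForm_apply (hx : x ∈ (chartAt Plane P).source)
    (θ : (y : M) → TangentSpace (𝓡 2) y →L[ℝ] ℝ) (u : TangentSpace (𝓡 2) x) :
    chartForm P θ (extChartAt (𝓡 2) P x) (chartVec P x u) = θ x u := by
  have h : ∀ v, chartForm P θ (extChartAt (𝓡 2) P x) v = θ x (frame P v x) := by
    intro v
    rw [chartForm, extChartAt_left_inv hx]; rfl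
  rw [h, frame_chartVec hx]

/-- The derivative of the contraction of a form with a vector field. -/
theorem mvfderiv_form_apply (hx : x ∈ (chartAt Plane P).source)
    {θ : (y : M) → TangentSpace (𝓡 2) y →L[ℝ] ℝ}
    (hθ : DifferentiableAt ℝ (chartForm P θ) (extChartAt (𝓡 2) P x))
    {V : (y : M) → TangentSpace (𝓡 2) y} (hV : SmoothFieldNear V x) (u : TangentSpace (𝓡 2) x) :
    mvfderiv (𝓡 2) (fun y => θ y (V y)) x u =
      fderiv ℝ (chartForm P θ) (extChartAt (𝓡 2) P x) (chartVec P x u) (chartVec P x (V x)) +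
      chartForm P θ (extChartAt (𝓡 2) P x)
        (fderiv ℝ (chartRep P V) (extChartAt (𝓡 2) P x) (chartVec P x u)) := by
  have he : (fun y => θ y (V y)) ∘ (extChartAt (𝓡 2) P).symm =ᶠ[𝓝 (extChartAt (𝓡 2) P x)]
      fun q => chartForm P θ q (chartRep P V q) := by
    filter_upwards [eventually_chart hx (p := fun _ => True)
      (Eventually.of_forall fun _ => trivial)] with q hq
    obtain ⟨y, hys, -, rfl⟩ := hq
    rw [chartRep_apply hys, chartForm_apply hys, Function.comp_apply, extChartAt_left_inv hys]
  have hd : HasFDerivAt (fun q => chartForm P θ q (chartRep P V q)) _ (extChartAt (𝓡 2) P x) :=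
    hθ.hasFDerivAt.clm_apply
      ((contDiffAt_chartRep hx hV.self_of_nhds).differentiableAt (by simp)).hasFDerivAt
  rw [mvfderiv_eq_fderiv_chart hx ((mdifferentiableAt_iff_chart hx).2
    (hd.congr_of_eventuallyEq he).differentiableAt), he.fderiv_eq]
  refine (congrArg (fun L => L (chartVec P x u)) hd.fderiv).trans ?_
  simp only [add_apply, ContinuousLinearMap.comp_apply, ContinuousLinearMap.flip_apply,
    chartRep_apply hx]
  abel

theorem extDerivAt_eq_chart (htor : cov.torsion x = 0) (hx : x ∈ (chartAt Plane P).source)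
    {θ : (y : M) → TangentSpace (𝓡 2) y →L[ℝ] ℝ}
    (hθ : DifferentiableAt ℝ (chartForm P θ) (extChartAt (𝓡 2) P x)) (u v : TangentSpace (𝓡 2) x) :
    extDerivAt θ x u v =
      fderiv ℝ (chartForm P θ) (extChartAt (𝓡 2) P x) (chartVec P x u) (chartVec P x v) -
      fderiv ℝ (chartForm P θ) (extChartAt (𝓡 2) P x) (chartVec P x v) (chartVec P x u) := by
  rw [extDerivAt, mvfderiv_form_apply hx hθ (smoothFieldNear_coordField v),
    mvfderiv_form_apply hx hθ (smoothFieldNear_coordField u), ← chartForm_apply hx θ,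
    chartVec_mlieBracket hx htor (smoothFieldNear_coordField u).mdifferentiableAt
      (smoothFieldNear_coordField v).mdifferentiableAt, map_sub, coordField_self, coordField_self]
  ring

/-- The differential of a function in the chart. -/
theorem chartForm_mvfderiv (hx : x ∈ (chartAt Plane P).source) {f : M → ℝ}
    (hf : ∀ᶠ y in 𝓝 x, MDifferentiableAt (𝓡 2) 𝓘(ℝ, ℝ) f y) :
    chartForm P (mvfderiv (𝓡 2) f) =ᶠ[𝓝 (extChartAt (𝓡 2) P x)]
      fderiv ℝ (f ∘ (extChartAt (𝓡 2) P).symm) := by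
  filter_upwards [eventually_chart hx hf] with q hq
  obtain ⟨y, hys, hy, rfl⟩ := hq
  ext v
  rw [← chartVec_frame hys v, chartForm_apply hys, mvfderiv_eq_fderiv_chart hys hy]

theorem hessian_eq_chart (hx : x ∈ (chartAt Plane P).source) {f : M → ℝ}
    (hf : ∀ᶠ y in 𝓝 x, ContMDiffAt (𝓡 2) 𝓘(ℝ, ℝ) ∞ f y) (u v : TangentSpace (𝓡 2) x) :
    hessian cov f x u v =
      fderiv ℝ (fderiv ℝ (f ∘ (extChartAt (𝓡 2) P).symm)) (extChartAt (𝓡 2) P x)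
        (chartVec P x u) (chartVec P x v) -
      fderiv ℝ (f ∘ (extChartAt (𝓡 2) P).symm) (extChartAt (𝓡 2) P x)
        (chartChrist cov P (extChartAt (𝓡 2) P x) (chartVec P x u) (chartVec P x v)) := by
  have hm : ∀ᶠ y in 𝓝 x, MDifferentiableAt (𝓡 2) 𝓘(ℝ, ℝ) f y :=
    hf.mono fun y hy => hy.mdifferentiableAt (by simp)
  have he := chartForm_mvfderiv hx hm
  have hF := (contMDiffAt_iff_contDiffAt_chart hx).1 hf.self_of_nhds
  have hθ : DifferentiableAt ℝ (chartForm P (mvfderiv (𝓡 2) f)) (extChartAt (𝓡 2) P x) :=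
    ((hF.fderiv_right (m := 1) (by norm_cast)).differentiableAt
      (by simp)).congr_of_eventuallyEq he
  rw [hessian, mvfderiv_form_apply hx hθ (smoothFieldNear_coordField v), he.fderiv_eq,
    he.self_of_nhds, mvfderiv_eq_fderiv_chart hx hm.self_of_nhds,
    chartVec_cov hx (smoothFieldNear_coordField v).mdifferentiableAt, map_add, coordField_self]
  ring

theorem quasiEinsteinAt_iff [T2Space M] (hU : IsOpen U)
    (hcov : ContMDiffCovariantDerivativeOn (I := 𝓡 2) Plane ∞ cov.toFun U) (hxU : x ∈ U)
    (htor : cov.torsion x = 0) (hx : x ∈ (chartAt Plane P).source) {μ : ℝ} {f : M → ℝ}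
    (hf : ∀ᶠ y in 𝓝 x, ContMDiffAt (𝓡 2) 𝓘(ℝ, ℝ) ∞ f y) :
    QuasiEinsteinAt cov μ f x ↔ IsPlanarQE (chartChrist cov P) μ (f ∘ (extChartAt (𝓡 2) P).symm)
      (extChartAt (𝓡 2) P x) := by
  have hfx : (f ∘ (extChartAt (𝓡 2) P).symm) (extChartAt (𝓡 2) P x) = f x := by
    rw [Function.comp_apply, extChartAt_left_inv hx]
  constructor
  · intro h u v
    have h1 := h (frame P u x) (frame P v x)
    rwa [hessian_eq_chart hx hf, ricciSym_eq_christRicciSym hU hcov hxU htor hx,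
      chartVec_frame hx, chartVec_frame hx, ← hfx] at h1
  · intro h u v
    rw [hessian_eq_chart hx hf, ricciSym_eq_christRicciSym hU hcov hxU htor hx, ← hfx]
    exact h _ _

end Tensors

end AffineSurface

end

/-! ### Smooth forms and projective changes of connections -/

section

set_option maxSynthPendingDepth 3

namespace AffineSurface

variable {M : Type*} [TopologicalSpace M] [ChartedSpace Plane M]

/-- The bilinear map `(Y, u) ↦ -θ(u) Y - θ(Y) u`. -/
def negSymProd (t : Plane →L[ℝ] ℝ) : Plane →L[ℝ] Plane →L[ℝ] Plane :=
  -(ContinuousLinearMap.smulRightL ℝ Plane Plane t +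
    t.smulRight (ContinuousLinearMap.id ℝ Plane))

/-- The endomorphism-valued form `Y ↦ (u ↦ -θ(u) Y - θ(Y) u)`. -/
def projForm (θ : (y : M) → TangentSpace (𝓡 2) y →L[ℝ] ℝ) (x : M) :
    TangentSpace (𝓡 2) x →L[ℝ] TangentSpace (𝓡 2) x →L[ℝ] TangentSpace (𝓡 2) x :=
  negSymProd (θ x)

theorem projForm_apply (θ : (y : M) → TangentSpace (𝓡 2) y →L[ℝ] ℝ) (x : M)
    (Y u : TangentSpace (𝓡 2) x) : projForm θ x Y u = -(θ x u • Y + θ x Y • u) := rfl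

variable [IsManifold (𝓡 2) ∞ M]

section Forms

variable {cov cov' : Connection M} {P x : M} {U : Set M}

theorem contDiffAt_of_apply_stdVec {E F : Type*} [NormedAddCommGroup E] [NormedSpace ℝ E]
    [NormedAddCommGroup F] [NormedSpace ℝ F] {L : E → Plane →L[ℝ] F} {p : E}
    (h : ∀ i, ContDiffAt ℝ ∞ (fun q => L q (stdVec i)) p) : ContDiffAt ℝ ∞ L p := by
  have he : L = fun q => ∑ i : Fin 2,
      (EuclideanSpace.proj i : Plane →L[ℝ] ℝ).smulRight (L q (stdVec i)) := by
    funext q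
    ext v
    conv_lhs => rw [plane_eq v]
    simp only [map_add, map_smul, Fin.sum_univ_two, add_apply,
      ContinuousLinearMap.smulRight_apply]
    rfl
  rw [he]
  exact ContDiffAt.sum fun i _ => ((ContinuousLinearMap.smulRightL ℝ Plane F
    (EuclideanSpace.proj i : Plane →L[ℝ] ℝ)).contDiff.contDiffAt).comp _ (h i)

/-- A field of endomorphisms is smooth if it maps coordinate vector fields to smooth fields. -/
theorem contMDiffAt_endomorphism {Φ : (y : M) → TangentSpace (𝓡 2) y →L[ℝ] TangentSpace (𝓡 2) y}
    (h : ∀ v, ContMDiffAt (𝓡 2) (𝓡 2).tangent ∞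
      (fun y => (⟨y, Φ y (frame x v y)⟩ : TangentBundle (𝓡 2) M)) x) :
    ContMDiffAt (𝓡 2) ((𝓡 2).prod 𝓘(ℝ, Plane →L[ℝ] Plane)) ∞
      (fun y => TotalSpace.mk' (Plane →L[ℝ] Plane)
        (E := fun y : M => TangentSpace (𝓡 2) y →L[ℝ] TangentSpace (𝓡 2) y) y (Φ y)) x := by
  have hx := mem_chart_source Plane x
  rw [contMDiffAt_hom_bundle]
  refine ⟨contMDiffAt_id, ?_⟩
  rw [contMDiffAt_iff_contDiffAt_chart hx]
  refine contDiffAt_of_apply_stdVec fun i => ?_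
  exact contDiffAt_chartRep hx (h (stdVec i))

/-- A covector field is smooth at a point if it is so in the preferred chart. -/
theorem contMDiffAt_form {θ : (y : M) → TangentSpace (𝓡 2) y →L[ℝ] ℝ}
    (h : ∀ v, ContMDiffAt (𝓡 2) 𝓘(ℝ, ℝ) ∞ (fun y => θ y (frame x v y)) x) :
    ContMDiffAt (𝓡 2) ((𝓡 2).prod 𝓘(ℝ, Plane →L[ℝ] ℝ)) ∞
      (fun x => TotalSpace.mk' (Plane →L[ℝ] ℝ)
        (E := fun x : M => TangentSpace (𝓡 2) x →L[ℝ] Bundle.Trivial M ℝ x) x (θ x)) x := by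
  have hx := mem_chart_source Plane x
  rw [contMDiffAt_hom_bundle]
  refine ⟨contMDiffAt_id, ?_⟩
  rw [contMDiffAt_iff_contDiffAt_chart hx]
  refine contDiffAt_of_apply_stdVec fun i => ?_
  have h1 := (contMDiffAt_iff_contDiffAt_chart hx).1 (h (stdVec i))
  refine h1.congr_of_eventuallyEq (Eventually.of_forall fun q => ?_)
  simp only [Function.comp_apply, ContinuousLinearMap.inCoordinates,
    Bundle.Trivial.fiberBundle_trivializationAt',
    Bundle.Trivial.continuousLinearMapAt_trivialization]
  rfl

theorem IsSmoothFormOn.contMDiffAt_apply {θ : (y : M) → TangentSpace (𝓡 2) y →L[ℝ] ℝ}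
    (hθ : IsSmoothFormOn θ U) (hU : IsOpen U) (hx : x ∈ U) {Y : (y : M) → TangentSpace (𝓡 2) y}
    (hY : ContMDiffAt (𝓡 2) (𝓡 2).tangent ∞ (fun y => (⟨y, Y y⟩ : TangentBundle (𝓡 2) M)) x) :
    ContMDiffAt (𝓡 2) 𝓘(ℝ, ℝ) ∞ (fun y => θ y (Y y)) x := by
  have h := (ContMDiffOn.contMDiffAt hθ (hU.mem_nhds hx)).clm_bundle_apply (v := Y) hY
  exact (contMDiffAt_totalSpace.1 h).2

theorem IsSmoothFormOn.contDiffOn_chartForm {θ : (y : M) → TangentSpace (𝓡 2) y →L[ℝ] ℝ}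
    (hθ : IsSmoothFormOn θ U) (hU : IsOpen U) :
    ContDiffOn ℝ ∞ (chartForm P θ) (chartDomain P U) := by
  intro p hp
  obtain ⟨x, hx, hxU, rfl⟩ := mem_chartDomain_iff.1 hp
  exact (contDiffAt_of_apply_stdVec fun i => (contMDiffAt_iff_contDiffAt_chart hx).1
    (hθ.contMDiffAt_apply hU hxU (contMDiffAt_frame hx (stdVec i)))).contDiffWithinAt

/-- The projective change of a connection, in a chart. -/
theorem chartChrist_projective {θ : (y : M) → TangentSpace (𝓡 2) y →L[ℝ] ℝ}
    (hx : x ∈ (chartAt Plane P).source)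
    (hrel : ∀ Y : (y : M) → TangentSpace (𝓡 2) y,
      MDifferentiableAt (𝓡 2) (𝓡 2).tangent (fun y => (⟨y, Y y⟩ : TangentBundle (𝓡 2) M)) x →
        ∀ u : TangentSpace (𝓡 2) x, cov Y x u = cov' Y x u + θ x u • Y x + θ x (Y x) • u)
    (u v : Plane) : chartChrist cov P (extChartAt (𝓡 2) P x) u v =
      chartChrist cov' P (extChartAt (𝓡 2) P x) u v +
        chartForm P θ (extChartAt (𝓡 2) P x) u • v +
        chartForm P θ (extChartAt (𝓡 2) P x) v • u := by
  have hf : MDifferentiableAt (𝓡 2) (𝓡 2).tangent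
      (fun y => (⟨y, frame P v y⟩ : TangentBundle (𝓡 2) M)) x :=
    (contMDiffAt_frame hx v).mdifferentiableAt (by simp)
  have h := congrArg (chartVec P x) (hrel _ hf (frame P u x))
  simp only [map_add, map_smul, chartVec_cov hx hf, chartVec_frame hx,
    (chartRep_frame hx v).fderiv_eq, ← chartForm_apply hx θ] at h
  simpa using h

/-- In the chart at `P`, the solution space of a strongly projectively flat connection is the
whole space of jets. -/
theorem solValues_eq_top_of_isStronglyProjectivelyFlatNear [T2Space M]
    (hcov : ContMDiffCovariantDerivativeOn (I := 𝓡 2) Plane ∞ cov.toFun univ)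
    (h : IsStronglyProjectivelyFlatNear cov P) :
    solValues (quasiForm (chartChrist cov P) (-1)) (extChartAt (𝓡 2) P P) = ⊤ := by
  obtain ⟨U, hU, hPU, cov', ⟨hcov', htor', hcurv'⟩, θ, hθ, hclosed, hrel⟩ := h
  have hs := isOpen_chartDomain (P := P) hU
  have hθs := hθ.contDiffOn_chartForm (P := P) hU
  refine solValues_eq_top_of_projective (Γ' := chartChrist cov' P) (θ := chartForm P θ) hs
    ((contDiffOn_chartChrist isOpen_univ hcov).mono
      (inter_subset_inter_right _ (preimage_mono (subset_univ U))))
    (contDiffOn_chartChrist hU hcov') hθs ?_ ?_ ?_ ?_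
    (mem_chartDomain_iff.2 ⟨P, mem_chart_source _ P, hPU, rfl⟩)
  · intro p hp u v
    obtain ⟨x, hx, hxU, rfl⟩ := mem_chartDomain_iff.1 hp
    exact chartChrist_symm hx (htor' x hxU) u v
  · intro p hp u v
    have hd := (hθs.contDiffAt (hs.mem_nhds hp)).differentiableAt (by simp)
    obtain ⟨x, hx, hxU, rfl⟩ := mem_chartDomain_iff.1 hp
    have h1 := extDerivAt_eq_chart (htor' x hxU) hx hd (frame P u x) (frame P v x)
    rw [hclosed x hxU, chartVec_frame hx, chartVec_frame hx] at h1
    exact sub_eq_zero.1 h1.symm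
  · intro p hp u v
    obtain ⟨x, hx, hxU, rfl⟩ := mem_chartDomain_iff.1 hp
    exact chartChrist_projective hx (fun Y hY => hrel Y x hxU hY) u v
  · intro p hp u v w
    obtain ⟨x, hx, hxU, rfl⟩ := mem_chartDomain_iff.1 hp
    have h1 := chartVec_curvatureAt hU hcov' hxU (htor' x hxU) hx (frame P u x) (frame P v x)
      (frame P w x)
    rwa [hcurv' x hxU, chartVec_frame hx, chartVec_frame hx, chartVec_frame hx, map_zero,
      eq_comm] at h1

/-- The connection `∇' = ∇ - θ ⊗ 1 - 1 ⊗ θ`. -/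
def projChange (cov : Connection M) (θ : (y : M) → TangentSpace (𝓡 2) y →L[ℝ] ℝ) : Connection M :=
  cov.addOneForm (projForm θ)

theorem projChange_apply (θ : (y : M) → TangentSpace (𝓡 2) y →L[ℝ] ℝ)
    (Y : (y : M) → TangentSpace (𝓡 2) y) (u : TangentSpace (𝓡 2) x) :
    projChange cov θ Y x u = cov Y x u - (θ x u • Y x + θ x (Y x) • u) :=
  ((sub_eq_add_neg _ _).trans (congrArg _ (projForm_apply θ x (Y x) u).symm)).symm

theorem projChange_rel (θ : (y : M) → TangentSpace (𝓡 2) y →L[ℝ] ℝ)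
    (Y : (y : M) → TangentSpace (𝓡 2) y) (u : TangentSpace (𝓡 2) x) :
    cov Y x u = projChange cov θ Y x u + θ x u • Y x + θ x (Y x) • u := by
  rw [projChange_apply, sub_add_eq_add_sub]; abel

theorem torsion_projChange (θ : (y : M) → TangentSpace (𝓡 2) y →L[ℝ] ℝ) (h : cov.torsion x = 0) :
    (projChange cov θ).torsion x = 0 := by
  ext1 u; ext1 v
  have hu := (smoothFieldNear_coordField u).mdifferentiableAt
  have hv := (smoothFieldNear_coordField v).mdifferentiableAt
  have h1 := (projChange cov θ).torsion_apply hu hv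
  have h2 := cov.torsion_apply hu hv
  rw [h] at h2
  rw [projChange_apply, projChange_apply] at h1
  rw [coordField_self, coordField_self] at h1 h2
  rw [h1]
  refine Eq.trans ?_ h2.symm
  abel

theorem contMDiffCovariantDerivativeOn_projChange
    {θ : (y : M) → TangentSpace (𝓡 2) y →L[ℝ] ℝ} (hU : IsOpen U)
    (hθ : IsSmoothFormOn θ U)
    (hcov : ContMDiffCovariantDerivativeOn (I := 𝓡 2) Plane ∞ cov.toFun U) :
    ContMDiffCovariantDerivativeOn (I := 𝓡 2) Plane ∞ (projChange cov θ).toFun U := by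
  refine ⟨fun {Y} hY x hx => ?_⟩
  have h1 := (hcov.contMDiff hY).contMDiffAt (hU.mem_nhds hx)
  have hYx : ContMDiffAt (𝓡 2) (𝓡 2).tangent ∞ (fun y => (⟨y, Y y⟩ : TangentBundle (𝓡 2) M)) x :=
    hY.contMDiffAt (hU.mem_nhds hx)
  refine ContMDiffAt.contMDiffWithinAt (h1.add_section (t := fun y => projForm θ y (Y y)) ?_)
  refine contMDiffAt_endomorphism fun v => ?_
  have hf := contMDiffAt_frame (mem_chart_source Plane x) v
  refine ((((hθ.contMDiffAt_apply hU hx hf).smul_section hYx).add_section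
    ((hθ.contMDiffAt_apply hU hx hYx).smul_section hf)).neg_section).congr_of_eventuallyEq
    (Eventually.of_forall fun y => ?_)
  exact congrArg (TotalSpace.mk' Plane y) (projForm_apply θ y (Y y) (frame x v y))

end Forms

end AffineSurface

end

/-! ### Jets and germs of solutions -/

section

set_option maxSynthPendingDepth 3

namespace AffineSurface

variable {M : Type*} [TopologicalSpace M] [ChartedSpace Plane M]

section Jets

variable {P x : M} {U : Set M} {f g : M → ℝ}

/-- The 1-jet of a function at `x`, in the preferred chart at `P`. -/
def chartJet (P x : M) (f : M → ℝ) : Jet :=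
  (f x, fderiv ℝ (f ∘ (extChartAt (𝓡 2) P).symm) (extChartAt (𝓡 2) P x))

theorem eventuallyEq_chart (hx : x ∈ (chartAt Plane P).source) (h : f =ᶠ[𝓝 x] g) :
    f ∘ (extChartAt (𝓡 2) P).symm =ᶠ[𝓝 (extChartAt (𝓡 2) P x)] g ∘ (extChartAt (𝓡 2) P).symm :=
  (extChartAt_symm_tendsto hx).eventually h

theorem chartJet_congr (hx : x ∈ (chartAt Plane P).source) (h : f =ᶠ[𝓝 x] g) :
    chartJet P x f = chartJet P x g := by
  rw [chartJet, chartJet, (eventuallyEq_chart hx h).fderiv_eq, h.self_of_nhds]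

/-- The part of the domain of the preferred chart at `P` that corresponds to the ball of radius `r`
around the image of `P`. -/
def chartBall (P : M) (r : ℝ) : Set M :=
  (chartAt Plane P).source ∩ extChartAt (𝓡 2) P ⁻¹' Metric.ball (extChartAt (𝓡 2) P P) r

theorem isOpen_chartBall (P : M) (r : ℝ) : IsOpen (chartBall P r) := by
  have h := (continuousOn_extChartAt (I := 𝓡 2) P).isOpen_inter_preimage
    (isOpen_extChartAt_source P) (Metric.isOpen_ball (x := extChartAt (𝓡 2) P P) (ε := r))
  rwa [extChartAt_source] at h

theorem mem_chartBall_self {r : ℝ} (hr : 0 < r) : P ∈ chartBall P r :=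
  ⟨mem_chart_source _ P, Metric.mem_ball_self hr⟩

theorem exists_ball_subset_target (P : M) :
    ∃ r > 0, Metric.ball (extChartAt (𝓡 2) P P) r ⊆ (extChartAt (𝓡 2) P).target :=
  Metric.isOpen_iff.1 (isOpen_extChartAt_target P) _ (mem_extChartAt_target P)

variable [IsManifold (𝓡 2) ∞ M]

theorem contDiffOn_chart (hU : IsOpen U) (hf : ContMDiffOn (𝓡 2) 𝓘(ℝ, ℝ) ∞ f U) :
    ContDiffOn ℝ ∞ (f ∘ (extChartAt (𝓡 2) P).symm) (chartDomain P U) := by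
  intro p hp
  obtain ⟨x, hx, hxU, rfl⟩ := mem_chartDomain_iff.1 hp
  exact ((contMDiffAt_iff_contDiffAt_chart hx).1
    (hf.contMDiffAt (hU.mem_nhds hxU))).contDiffWithinAt

theorem chartJet_add (hx : x ∈ (chartAt Plane P).source)
    (hf : ContMDiffAt (𝓡 2) 𝓘(ℝ, ℝ) ∞ f x) (hg : ContMDiffAt (𝓡 2) 𝓘(ℝ, ℝ) ∞ g x) :
    chartJet P x (f + g) = chartJet P x f + chartJet P x g := by
  have h1 := ((contMDiffAt_iff_contDiffAt_chart hx).1 hf).differentiableAt (by simp)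
  have h2 := ((contMDiffAt_iff_contDiffAt_chart hx).1 hg).differentiableAt (by simp)
  exact Prod.ext rfl (fderiv_add h1 h2)

theorem chartJet_smul (hx : x ∈ (chartAt Plane P).source)
    (hf : ContMDiffAt (𝓡 2) 𝓘(ℝ, ℝ) ∞ f x) (c : ℝ) :
    chartJet P x (c • f) = c • chartJet P x f := by
  have h1 := ((contMDiffAt_iff_contDiffAt_chart hx).1 hf).differentiableAt (by simp)
  exact Prod.ext rfl (fderiv_const_smul h1 c)

variable [T2Space M] {cov : Connection M} {μ : ℝ}

/-- The jets of a solution of the quasi-Einstein equation solve a Pfaffian system. -/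
theorem isPfaffSol_of_quasiEinstein
    (hcov : ContMDiffCovariantDerivativeOn (I := 𝓡 2) Plane ∞ cov.toFun univ)
    (htor : cov.torsion = 0) (hU : IsOpen U)
    (hf : ContMDiffOn (𝓡 2) 𝓘(ℝ, ℝ) ∞ f U) (hq : ∀ x ∈ U, QuasiEinsteinAt cov μ f x) :
    IsPfaffSol (quasiForm (chartChrist cov P) μ)
      (fun q => (((f ∘ (extChartAt (𝓡 2) P).symm) q,
        fderiv ℝ (f ∘ (extChartAt (𝓡 2) P).symm) q) : Jet)) (chartDomain P U) := by
  refine isPfaffSol_jet (isOpen_chartDomain hU) (contDiffOn_chart hU hf) fun p hp => ?_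
  obtain ⟨x, hx, hxU, rfl⟩ := mem_chartDomain_iff.1 hp
  refine (quasiEinsteinAt_iff isOpen_univ hcov (mem_univ x) (congrFun htor x) hx ?_).1 (hq x hxU)
  filter_upwards [hU.mem_nhds hxU] with y hy using hf.contMDiffAt (hU.mem_nhds hy)

/-- Solutions on a coordinate ball are determined by their jet at one point. -/
theorem eq_zero_of_chartJet
    (hcov : ContMDiffCovariantDerivativeOn (I := 𝓡 2) Plane ∞ cov.toFun univ)
    (htor : cov.torsion = 0) (hU : IsOpen U)
    (hf : ContMDiffOn (𝓡 2) 𝓘(ℝ, ℝ) ∞ f U) (hq : ∀ x ∈ U, QuasiEinsteinAt cov μ f x)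
    {c : Plane} {r : ℝ} (hball : Metric.ball c r ⊆ chartDomain P U)
    (hx : x ∈ (chartAt Plane P).source) (hxr : extChartAt (𝓡 2) P x ∈ Metric.ball c r)
    (h0 : chartJet P x f = 0) {y : M} (hy : y ∈ (chartAt Plane P).source)
    (hyr : extChartAt (𝓡 2) P y ∈ Metric.ball c r) : f y = 0 := by
  have hJ := isPfaffSol_of_quasiEinstein (P := P) hcov htor hU hf hq
  have hA : ContinuousOn (quasiForm (chartChrist cov P) μ) (Metric.ball c r) :=
    ((contDiffOn_quasiForm (isOpen_chartDomain isOpen_univ)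
      (contDiffOn_chartChrist isOpen_univ hcov) μ).continuousOn).mono
        fun q hq => ⟨(hball hq).1, mem_univ _⟩
  have h1 := (hJ.mono hball).eq_zero_of_convex (convex_ball _ _) hA hxr
    (by rw [← h0, chartJet, Function.comp_apply, extChartAt_left_inv hx]) _ hyr
  have h2 := congrArg Prod.fst h1
  rwa [Function.comp_apply, extChartAt_left_inv hy] at h2

theorem eq_zero_on_chartBall
    (hcov : ContMDiffCovariantDerivativeOn (I := 𝓡 2) Plane ∞ cov.toFun univ)
    (htor : cov.torsion = 0) {r : ℝ}
    (hr : Metric.ball (extChartAt (𝓡 2) P P) r ⊆ (extChartAt (𝓡 2) P).target)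
    (hf : ContMDiffOn (𝓡 2) 𝓘(ℝ, ℝ) ∞ f (chartBall P r))
    (hq : ∀ x ∈ chartBall P r, QuasiEinsteinAt cov μ f x) (hx : x ∈ chartBall P r)
    (h0 : chartJet P x f = 0) : ∀ y ∈ chartBall P r, f y = 0 := by
  have hball : Metric.ball (extChartAt (𝓡 2) P P) r ⊆ chartDomain P (chartBall P r) := by
    intro q hq
    refine ⟨hr hq, ?_, ?_⟩
    · rw [← extChartAt_source (𝓡 2)]
      exact (extChartAt (𝓡 2) P).map_target (hr hq)
    · rwa [mem_preimage, (extChartAt (𝓡 2) P).right_inv (hr hq)]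
  exact fun y hy => eq_zero_of_chartJet hcov htor (isOpen_chartBall P r) hf hq hball hx.1 hx.2 h0
    hy.1 hy.2

/-- Germs of solutions are determined by their jet. -/
theorem eventually_eq_zero_of_chartJet
    (hcov : ContMDiffCovariantDerivativeOn (I := 𝓡 2) Plane ∞ cov.toFun univ)
    (htor : cov.torsion = 0) (hU : IsOpen U) (hx : x ∈ (chartAt Plane P).source) (hxU : x ∈ U)
    (hf : ContMDiffOn (𝓡 2) 𝓘(ℝ, ℝ) ∞ f U) (hq : ∀ x ∈ U, QuasiEinsteinAt cov μ f x)
    (h0 : chartJet P x f = 0) : f =ᶠ[𝓝 x] 0 := by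
  obtain ⟨r, hr, hball⟩ := Metric.isOpen_iff.1 (isOpen_chartDomain (P := P) hU) _
    (mem_chartDomain_iff.2 ⟨x, hx, hxU, rfl⟩)
  filter_upwards [eventually_mem_source hx,
    (extChartAt_tendsto hx).eventually (Metric.ball_mem_nhds _ hr)] with y hy hyr
  exact eq_zero_of_chartJet hcov htor hU hf hq hball hx (Metric.mem_ball_self hr) h0 hy hyr

/-- Every jet in the solution space is the jet of a solution near `P`. -/
theorem exists_solution_of_mem_solValues
    (hcov : ContMDiffCovariantDerivativeOn (I := 𝓡 2) Plane ∞ cov.toFun univ)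
    (htor : cov.torsion = 0) {j : Jet}
    (hj : j ∈ solValues (quasiForm (chartChrist cov P) μ) (extChartAt (𝓡 2) P P)) :
    ∃ (f : M → ℝ) (U : Set M), IsOpen U ∧ P ∈ U ∧ U ⊆ (chartAt Plane P).source ∧
      ContMDiffOn (𝓡 2) 𝓘(ℝ, ℝ) ∞ f U ∧ (∀ x ∈ U, QuasiEinsteinAt cov μ f x) ∧
      chartJet P P f = j := by
  obtain ⟨J, s, hs, hp, hJ, rfl⟩ := hj
  have hs' : IsOpen (s ∩ (extChartAt (𝓡 2) P).target) := hs.inter (isOpen_extChartAt_target P)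
  have hp' := mem_extChartAt_target (I := 𝓡 2) P
  obtain ⟨h1, h2, h3⟩ := (hJ.mono (inter_subset_left (t := (extChartAt (𝓡 2) P).target))).jet hs'
    ((contDiffOn_chartChrist isOpen_univ hcov).mono fun q hq => ⟨hq.2, mem_univ _⟩)
  set f : M → ℝ := fun x => (J (extChartAt (𝓡 2) P x)).1 with hfdef
  have hF : ∀ q ∈ s ∩ (extChartAt (𝓡 2) P).target,
      f ∘ (extChartAt (𝓡 2) P).symm =ᶠ[𝓝 q] fun q => (J q).1 := by
    intro q hq
    filter_upwards [hs'.mem_nhds hq] with q' hq'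
    rw [Function.comp_apply, hfdef]
    simp only [(extChartAt (𝓡 2) P).right_inv hq'.2]
  have hU : IsOpen ((chartAt Plane P).source ∩ extChartAt (𝓡 2) P ⁻¹' s) := by
    have h := (continuousOn_extChartAt (I := 𝓡 2) P).isOpen_inter_preimage
      (isOpen_extChartAt_source P) hs
    rwa [extChartAt_source] at h
  have hmem : ∀ x ∈ (chartAt Plane P).source ∩ extChartAt (𝓡 2) P ⁻¹' s,
      extChartAt (𝓡 2) P x ∈ s ∩ (extChartAt (𝓡 2) P).target := fun x hx =>
    ⟨hx.2, (extChartAt (𝓡 2) P).map_source (by rw [extChartAt_source]; exact hx.1)⟩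
  have hsm : ∀ x ∈ (chartAt Plane P).source ∩ extChartAt (𝓡 2) P ⁻¹' s,
      ContMDiffAt (𝓡 2) 𝓘(ℝ, ℝ) ∞ f x := fun x hx =>
    (contMDiffAt_iff_contDiffAt_chart hx.1).2
      ((h1.contDiffAt (hs'.mem_nhds (hmem x hx))).congr_of_eventuallyEq (hF _ (hmem x hx)))
  refine ⟨f, _, hU, ⟨mem_chart_source _ P, hp⟩, inter_subset_left,
    fun x hx => (hsm x hx).contMDiffWithinAt, fun x hx => ?_, ?_⟩
  · refine (quasiEinsteinAt_iff isOpen_univ hcov (mem_univ x) (congrFun htor x) hx.1 ?_).2 ?_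
    · filter_upwards [hU.mem_nhds hx] with y hy using hsm y hy
    · intro u v
      have he := hF _ (hmem x hx)
      rw [he.fderiv.fderiv_eq, he.fderiv_eq, he.self_of_nhds]
      exact h3 _ (hmem x hx) u v
  · rw [chartJet, (hF _ ⟨hp, hp'⟩).fderiv_eq, h2 _ ⟨hp, hp'⟩]

/-- The jet at `P` of a germ of solutions. -/
def germJet (cov : Connection M) (P : M) (μ : ℝ) : germEigenspace cov P μ →ₗ[ℝ] Jet where
  toFun g := Germ.liftOn (g : Germ (𝓝 P) ℝ) (chartJet P P)
    fun _ _ h => chartJet_congr (mem_chart_source _ P) h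
  map_add' := by
    rintro ⟨_, f, U, rfl, hU, hPU, hf, hq⟩ ⟨_, f', U', rfl, hU', hPU', hf', hq'⟩
    exact chartJet_add (mem_chart_source _ P) (hf.contMDiffAt (hU.mem_nhds hPU))
      (hf'.contMDiffAt (hU'.mem_nhds hPU'))
  map_smul' := by
    rintro c ⟨_, f, U, rfl, hU, hPU, hf, hq⟩
    exact chartJet_smul (mem_chart_source _ P) (hf.contMDiffAt (hU.mem_nhds hPU)) c

theorem germJet_injective
    (hcov : ContMDiffCovariantDerivativeOn (I := 𝓡 2) Plane ∞ cov.toFun univ)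
    (htor : cov.torsion = 0) : Function.Injective (germJet cov P μ) := by
  rw [← LinearMap.ker_eq_bot, LinearMap.ker_eq_bot']
  rintro ⟨_, f, U, rfl, hU, hPU, hf, hq⟩ h0
  exact Subtype.ext (Germ.coe_eq.2
    (eventually_eq_zero_of_chartJet hcov htor hU (mem_chart_source _ P) hPU hf hq h0))

theorem range_germJet
    (hcov : ContMDiffCovariantDerivativeOn (I := 𝓡 2) Plane ∞ cov.toFun univ)
    (htor : cov.torsion = 0) : LinearMap.range (germJet cov P μ) =
      solValues (quasiForm (chartChrist cov P) μ) (extChartAt (𝓡 2) P P) := by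
  refine le_antisymm ?_ fun j hj => ?_
  · rintro _ ⟨⟨_, f, U, rfl, hU, hPU, hf, hq⟩, rfl⟩
    have h := (isPfaffSol_of_quasiEinstein (P := P) hcov htor hU hf hq).mem_solValues
      (isOpen_chartDomain hU) (mem_chartDomain_iff.2 ⟨P, mem_chart_source _ P, hPU, rfl⟩)
    simp only [Function.comp_apply, extChartAt_left_inv (mem_chart_source Plane P)] at h
    exact h
  · obtain ⟨f, U, hU, hPU, -, hf, hq, rfl⟩ := exists_solution_of_mem_solValues hcov htor hj
    exact ⟨⟨_, f, U, rfl, hU, hPU, hf, hq⟩, rfl⟩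

theorem rank_germEigenspace
    (hcov : ContMDiffCovariantDerivativeOn (I := 𝓡 2) Plane ∞ cov.toFun univ)
    (htor : cov.torsion = 0) : Module.rank ℝ (germEigenspace cov P μ) =
      (Module.finrank ℝ (solValues (quasiForm (chartChrist cov P) μ) (extChartAt (𝓡 2) P P)) :
        Cardinal) := by
  have hi := germJet_injective (P := P) (μ := μ) hcov htor
  have : Module.Finite ℝ (germEigenspace cov P μ) := Module.Finite.of_injective _ hi
  rw [← Module.finrank_eq_rank, ← range_germJet hcov htor, LinearMap.finrank_range_of_inj hi]

end Jets

end AffineSurface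

end

/-! ### Germs of solutions -/

section

set_option maxSynthPendingDepth 3

namespace AffineSurface

variable {M : Type*} [TopologicalSpace M] [ChartedSpace Plane M] [IsManifold (𝓡 2) ∞ M]

section Germs

variable {cov : Connection M} {μ : ℝ} {P x : M}

theorem symm_on_chartDomain (htor : cov.torsion = 0) :
    ∀ q ∈ chartDomain P univ, ∀ u v, chartChrist cov P q u v = chartChrist cov P q v u := by
  intro q hq u v
  obtain ⟨x, hx, -, rfl⟩ := mem_chartDomain_iff.1 hq
  exact chartChrist_symm hx (congrFun htor x) u v

variable [T2Space M]

theorem finrank_eq_three_iff (W : Submodule ℝ Jet) : Module.finrank ℝ W = 3 ↔ W = ⊤ := by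
  constructor
  · intro h
    exact Submodule.eq_top_of_finrank_eq (h.trans finrank_jet.symm)
  · rintro rfl
    rw [finrank_top, finrank_jet]

theorem rank_germEigenspace_eq_three_iff
    (hcov : ContMDiffCovariantDerivativeOn (I := 𝓡 2) Plane ∞ cov.toFun univ)
    (htor : cov.torsion = 0) : Module.rank ℝ (germEigenspace cov P μ) = 3 ↔
      solValues (quasiForm (chartChrist cov P) μ) (extChartAt (𝓡 2) P P) = ⊤ := by
  rw [rank_germEigenspace hcov htor, ← finrank_eq_three_iff]
  norm_cast

theorem solValues_eq_top_of_two_le_rank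
    (hcov : ContMDiffCovariantDerivativeOn (I := 𝓡 2) Plane ∞ cov.toFun univ)
    (htor : cov.torsion = 0) (h : 2 ≤ Module.rank ℝ (germEigenspace cov P (-1))) :
    solValues (quasiForm (chartChrist cov P) (-1)) (extChartAt (𝓡 2) P P) = ⊤ := by
  refine solValues_eq_top_of_two_le_finrank (isOpen_chartDomain isOpen_univ)
    (contDiffOn_chartChrist isOpen_univ hcov) (symm_on_chartDomain htor)
    (mem_chartDomain_univ P) ?_
  rw [rank_germEigenspace hcov htor] at h
  exact_mod_cast h

theorem rank_germEigenspace_ne_two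
    (hcov : ContMDiffCovariantDerivativeOn (I := 𝓡 2) Plane ∞ cov.toFun univ)
    (htor : cov.torsion = 0) : Module.rank ℝ (germEigenspace cov P (-1)) ≠ 2 := by
  intro h
  have h1 := (rank_germEigenspace_eq_three_iff hcov htor).2
    (solValues_eq_top_of_two_le_rank hcov htor h.ge)
  rw [h] at h1
  exact absurd h1 (by norm_num)

/-- Smoothness restricts to open sets, although smooth vector fields on an open set need not
extend to `M`. -/
theorem _root_.ContMDiffCovariantDerivativeOn.restrict {U : Set M} (hU : IsOpen U)
    (hcov : ContMDiffCovariantDerivativeOn (I := 𝓡 2) Plane ∞ cov.toFun univ) :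
    ContMDiffCovariantDerivativeOn (I := 𝓡 2) Plane ∞ cov.toFun U := by
  refine ⟨fun {Y} hY x hx => (contMDiffAt_cov isOpen_univ hcov (mem_univ x)
    ?_).contMDiffWithinAt⟩
  filter_upwards [hU.mem_nhds hx] with y hy
  exact hY.contMDiffAt (hU.mem_nhds hy)

/-- A positive solution `f` with `μ = -1` gives the flat connection `∇ - ω ⊗ 1 - 1 ⊗ ω`, where
`ω = d log f`. -/
theorem isStronglyProjectivelyFlatNear_of_solValues_eq_top
    (hcov : ContMDiffCovariantDerivativeOn (I := 𝓡 2) Plane ∞ cov.toFun univ)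
    (htor : cov.torsion = 0)
    (htop : solValues (quasiForm (chartChrist cov P) (-1)) (extChartAt (𝓡 2) P P) = ⊤) :
    IsStronglyProjectivelyFlatNear cov P := by
  have hs := isOpen_chartDomain (P := P) (isOpen_univ (X := M))
  have hΓ := contDiffOn_chartChrist (P := P) isOpen_univ hcov
  have hp := mem_chartDomain_univ P
  have hRC := eventually_ricciCodazzi hs hΓ (symm_on_chartDomain htor) hp
    (by rw [htop, finrank_top, finrank_jet]; norm_num)
  obtain ⟨f, U₀, hU₀, hPU₀, hsub, hf, hq, hj⟩ := exists_solution_of_mem_solValues hcov htor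
    (show ((1, 0) : Jet) ∈ solValues (quasiForm (chartChrist cov P) (-1)) _ from
      htop ▸ Submodule.mem_top)
  -- The jet `(1, 0)` is that of a solution which is positive near `P`.
  have hfP : f P = 1 := congrArg Prod.fst hj
  have hpos : ∀ᶠ y in 𝓝 P, 0 < f y :=
    (hf.contMDiffAt (hU₀.mem_nhds hPU₀)).continuousAt.eventually_const_lt
      (by rw [hfP]; norm_num)
  obtain ⟨U, hUall, hU, hPU⟩ := eventually_nhds_iff.1 (hpos.and ((hU₀.eventually_mem hPU₀).and
    ((extChartAt_tendsto (mem_chart_source Plane P)).eventually hRC)))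
  have hfU : ∀ x ∈ U, ContMDiffAt (𝓡 2) 𝓘(ℝ, ℝ) ∞ f x := fun x hx =>
    hf.contMDiffAt (hU₀.mem_nhds (hUall x hx).2.1)
  have hfne : ∀ x ∈ U, ∀ᶠ y in 𝓝 x, ContMDiffAt (𝓡 2) 𝓘(ℝ, ℝ) ∞ f y := fun x hx => by
    filter_upwards [hU.mem_nhds hx] with y hy using hfU y hy
  let θ : (x : M) → TangentSpace (𝓡 2) x →L[ℝ] ℝ := fun x => (f x)⁻¹ • mvfderiv (𝓡 2) f x
  have hθ : ∀ Q : M, ∀ x ∈ U, x ∈ (chartAt Plane Q).source →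
      chartForm Q θ =ᶠ[𝓝 (extChartAt (𝓡 2) Q x)] fun q =>
        ((f ∘ (extChartAt (𝓡 2) Q).symm) q)⁻¹ • fderiv ℝ (f ∘ (extChartAt (𝓡 2) Q).symm) q := by
    intro Q x hx hxQ
    filter_upwards [chartForm_mvfderiv hxQ ((hfne x hx).mono fun y hy =>
      hy.mdifferentiableAt (by simp))] with q hq
    rw [← hq]
    rfl
  have hθd : ∀ Q : M, ∀ x ∈ U, x ∈ (chartAt Plane Q).source →
      ContDiffAt ℝ ∞ (chartForm Q θ) (extChartAt (𝓡 2) Q x) := by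
    intro Q x hx hxQ
    have hF := (contMDiffAt_iff_contDiffAt_chart hxQ).1 (hfU x hx)
    refine ContDiffAt.congr_of_eventuallyEq (ContDiffAt.smul (hF.inv ?_)
      (hF.fderiv_right (m := ∞) (by norm_cast))) (hθ Q x hx hxQ)
    rw [Function.comp_apply, extChartAt_left_inv hxQ]
    exact (hUall x hx).1.ne'
  have hθs : IsSmoothFormOn θ U := fun x hx => by
    refine (contMDiffAt_form fun v => ?_).contMDiffWithinAt
    rw [contMDiffAt_iff_contDiffAt_chart (mem_chart_source Plane x)]
    exact (hθd x x hx (mem_chart_source _ x)).clm_apply contDiffAt_const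
  have hcov' : ContMDiffCovariantDerivativeOn (I := 𝓡 2) Plane ∞ (projChange cov θ).toFun U :=
    contMDiffCovariantDerivativeOn_projChange hU hθs (hcov.restrict hU)
  have htor' : ∀ x ∈ U, (projChange cov θ).torsion x = 0 := fun x _ =>
    torsion_projChange θ (congrFun htor x)
  have hxP : ∀ x ∈ U, x ∈ (chartAt Plane P).source := fun x hx => hsub (hUall x hx).2.1
  refine ⟨U, hU, hPU, projChange cov θ, ⟨hcov', htor', fun x hx u v w => ?_⟩, θ, hθs,
    fun x hx u v => ?_, fun Y x hx hY u => projChange_rel θ Y u⟩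
  · apply chartVec_injective (hxP x hx)
    rw [chartVec_curvatureAt hU hcov' hx (htor' x hx) (hxP x hx), map_zero]
    have hxs : extChartAt (𝓡 2) P x ∈ chartDomain P univ :=
      mem_chartDomain_iff.2 ⟨x, hxP x hx, mem_univ _, rfl⟩
    have hxU : extChartAt (𝓡 2) P x ∈ chartDomain P U :=
      mem_chartDomain_iff.2 ⟨x, hxP x hx, hx, rfl⟩
    refine christCurv_eq_zero_of_solution (Γ := chartChrist cov P)
      (F := f ∘ (extChartAt (𝓡 2) P).symm) (θ := chartForm P θ)
      ((hΓ.contDiffAt (hs.mem_nhds hxs)).differentiableAt (by simp))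
      (((contDiffOn_chartChrist hU hcov').contDiffAt ((isOpen_chartDomain hU).mem_nhds
        hxU)).differentiableAt (by simp))
      ((contMDiffAt_iff_contDiffAt_chart (hxP x hx)).1 (hfU x hx)) ?_
      ((quasiEinsteinAt_iff isOpen_univ hcov (mem_univ x) (congrFun htor x) (hxP x hx)
        (hfne x hx)).1 (hq x (hUall x hx).2.1))
      (symm_on_chartDomain htor _ hxs) (hUall x hx).2.2.1 (hθ P x hx (hxP x hx)) ?_ _ _ _
    · rw [Function.comp_apply, extChartAt_left_inv (hxP x hx)]
      exact (hUall x hx).1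
    · filter_upwards [(isOpen_chartDomain hU).mem_nhds hxU] with q hq u v
      obtain ⟨y, hy, hyU, rfl⟩ := mem_chartDomain_iff.1 hq
      exact chartChrist_projective hy (fun Y _ => projChange_rel θ Y) u v
  · rw [extDerivAt_eq_chart (congrFun htor x) (hxP x hx)
      ((hθd P x hx (hxP x hx)).differentiableAt (by simp)), (hθ P x hx (hxP x hx)).fderiv_eq]
    have hF := (contMDiffAt_iff_contDiffAt_chart (hxP x hx)).1 (hfU x hx)
    have hne : (f ∘ (extChartAt (𝓡 2) P).symm) (extChartAt (𝓡 2) P x) ≠ 0 := by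
      rw [Function.comp_apply, extChartAt_left_inv (hxP x hx)]
      exact (hUall x hx).1.ne'
    have hsymm := (hF.isSymmSndFDerivAt (by
      rw [minSmoothness_of_isRCLikeNormedField]
      exact (WithTop.coe_le_coe.2 le_top : ((2 : ℕ∞) : WithTop ℕ∞) ≤ ∞))).eq
      (chartVec P x u) (chartVec P x v)
    have h2 := ((hasDerivAt_inv hne).comp_hasFDerivAt _
      (hF.differentiableAt (by simp)).hasFDerivAt).smul
      ((hF.fderiv_right (m := 1) (by norm_cast)).differentiableAt (by simp)).hasFDerivAt
    have h3 : ∀ a b : Plane, fderiv ℝ (fun q => ((f ∘ (extChartAt (𝓡 2) P).symm) q)⁻¹ •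
        fderiv ℝ (f ∘ (extChartAt (𝓡 2) P).symm) q) (extChartAt (𝓡 2) P x) a b = _ := fun a b =>
      congrArg (fun L => L a b) h2.fderiv
    rw [h3, h3]
    simp only [add_apply, smul_apply, ContinuousLinearMap.smulRight_apply, smul_eq_mul,
      Function.comp_apply]
    rw [hsymm]
    ring

theorem ricci_det_ne_zero
    (hcov : ContMDiffCovariantDerivativeOn (I := 𝓡 2) Plane ∞ cov.toFun univ)
    (htor : cov.torsion = 0) (hrank : ricciRank cov P = 2) :
    christRicci (chartChrist cov P) (extChartAt (𝓡 2) P P) (stdVec 0) (stdVec 0) *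
      christRicci (chartChrist cov P) (extChartAt (𝓡 2) P P) (stdVec 1) (stdVec 1) -
      christRicci (chartChrist cov P) (extChartAt (𝓡 2) P P) (stdVec 0) (stdVec 1) *
      christRicci (chartChrist cov P) (extChartAt (𝓡 2) P P) (stdVec 1) (stdVec 0) ≠ 0 := by
  have hc : ∀ i j : Fin 2, ricci cov P (coordVec P i) (coordVec P j) =
      christRicci (chartChrist cov P) (extChartAt (𝓡 2) P P) (stdVec i) (stdVec j) := by
    intro i j
    rw [ricci_eq_christRicci isOpen_univ hcov (mem_univ P) (congrFun htor P)
      (mem_chart_source _ P), chartVec_self, chartVec_self]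
    rfl
  simp only [← hc]
  rw [ricciRank, Matrix.rank] at hrank
  have hsurj : Function.Surjective
      (Matrix.of fun i j : Fin 2 => ricci cov P (coordVec P i) (coordVec P j)).mulVecLin :=
    LinearMap.range_eq_top.1 (Submodule.eq_top_of_finrank_eq
      (hrank.trans (Module.finrank_fin_fun ℝ).symm))
  have hu := (Matrix.isUnit_iff_isUnit_det _).1 (Matrix.mulVec_surjective_iff_isUnit.1 hsurj)
  have h := hu.ne_zero
  rwa [Matrix.det_fin_two] at h

/-- Strong projective flatness enters only through its consequence that the Ricci tensor is
symmetric and satisfies the Codazzi equation. -/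
theorem rank_germEigenspace_of_ricciRank
    (hcov : ContMDiffCovariantDerivativeOn (I := 𝓡 2) Plane ∞ cov.toFun univ)
    (htor : cov.torsion = 0) (hflat : IsStronglyProjectivelyFlatNear cov P)
    (hrank : ricciRank cov P = 2) :
    (∀ μ : ℝ, μ ≠ -1 → μ ≠ 0 → Module.rank ℝ (germEigenspace cov P μ) = 0) ∧
      Module.rank ℝ (germEigenspace cov P 0) = 1 := by
  have hs := isOpen_chartDomain (P := P) (isOpen_univ (X := M))
  have hΓ := contDiffOn_chartChrist (P := P) isOpen_univ hcov
  have hp := mem_chartDomain_univ P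
  have hRC := eventually_ricciCodazzi hs hΓ (symm_on_chartDomain htor) hp
    (by rw [solValues_eq_top_of_isStronglyProjectivelyFlatNear hcov hflat, finrank_top,
      finrank_jet]; norm_num)
  have hdet := ricci_det_ne_zero hcov htor hrank
  constructor
  · intro μ hμ hμ0
    rw [rank_germEigenspace hcov htor, solValues_eq_bot_of_det_ne_zero hs hΓ
      (symm_on_chartDomain htor) hp hμ hμ0 hRC hdet, finrank_bot, Nat.cast_zero]
  · rw [rank_germEigenspace hcov htor, finrank_solValues_zero_of_det_ne_zero hs hΓ
      (symm_on_chartDomain htor) hp hRC.self_of_nhds hdet, Nat.cast_one]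

/-- Maximality of the space of germs at `P` is inherited by nearby points, where it makes the Ricci
tensor vanish. -/
theorem ricci_eq_zero_of_rank_germEigenspace
    (hcov : ContMDiffCovariantDerivativeOn (I := 𝓡 2) Plane ∞ cov.toFun univ)
    (htor : cov.torsion = 0) (hμ : μ ≠ -1)
    (h : Module.rank ℝ (germEigenspace cov P μ) = 3) :
    ∀ᶠ x in 𝓝 P, ∀ u v, ricci cov x u v = 0 := by
  have hs := isOpen_chartDomain (P := P) (isOpen_univ (X := M))
  have hΓ := contDiffOn_chartChrist (P := P) isOpen_univ hcov
  have hp := mem_chartDomain_univ P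
  have htop := (rank_germEigenspace_eq_three_iff hcov htor).1 h
  have hev := eventually_finrank_solValues_le hs (contDiffOn_quasiForm hs hΓ μ) hp
  filter_upwards [(extChartAt_tendsto (mem_chart_source Plane P)).eventually hev,
    eventually_mem_source (mem_chart_source Plane P)] with x hx hxs u v
  rw [ricci_eq_christRicci isOpen_univ hcov (mem_univ x) (congrFun htor x) hxs]
  refine christRicci_eq_zero_of_solValues_eq_top hs hΓ (symm_on_chartDomain htor)
    (mem_chartDomain_iff.2 ⟨x, hxs, mem_univ x, rfl⟩) hμ ?_ _ _
  rw [htop, finrank_top] at hx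
  exact Submodule.eq_top_of_finrank_eq (le_antisymm (Submodule.finrank_le _) hx)

/-- A Ricci flat torsion free connection on a surface is flat. -/
theorem isStronglyProjectivelyFlatOn_of_ricci_eq_zero {U : Set M}
    (hcov : ContMDiffCovariantDerivativeOn (I := 𝓡 2) Plane ∞ cov.toFun univ)
    (hcovU : ContMDiffCovariantDerivativeOn (I := 𝓡 2) Plane ∞ cov.toFun U)
    (htor : cov.torsion = 0) (h : ∀ x ∈ U, ∀ u v, ricci cov x u v = 0) :
    IsStronglyProjectivelyFlatOn cov U := by
  refine ⟨cov, ⟨hcovU, fun x _ => congrFun htor x, fun x hx u v w => ?_⟩, 0, ?_, ?_, ?_⟩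
  · have hxs := mem_chart_source Plane x
    apply chartVec_injective hxs
    rw [chartVec_curvatureAt isOpen_univ hcov (mem_univ x) (congrFun htor x) hxs,
      christCurv_eq_ricci,
      ← ricci_eq_christRicci isOpen_univ hcov (mem_univ x) (congrFun htor x) hxs,
      ← ricci_eq_christRicci isOpen_univ hcov (mem_univ x) (congrFun htor x) hxs, h x hx, h x hx]
    simp
  · exact fun x _ => (contMDiffAt_form fun v => contMDiffAt_const).contMDiffWithinAt
  · intro x _ u v
    simp only [extDerivAt, Pi.zero_apply, zero_apply, mvfderiv_const]
    simp
  · intro Y x _ _ u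
    simp

end Germs

end AffineSurface

end

/-! ### Locally constant systems on simply connected spaces -/

section

namespace AffineSurface

section LocalSystems

variable {X F Y : Type*} [TopologicalSpace X] {N : X → Set X} {sol : X → F → X → Y}

open scoped Classical in
/-- The transition of a system of local functions: `sol j (transition sol i j x v)` has the same
germ at `x` as `sol i v`. -/
def transition (sol : X → F → X → Y) (i j x : X) (v : F) : F :=
  if h : ∃ w, sol j w =ᶠ[𝓝 x] sol i v then h.choose else v

theorem transition_spec {i j x : X} {v : F} (h : ∃ w, sol j w =ᶠ[𝓝 x] sol i v) :
    sol j (transition sol i j x v) =ᶠ[𝓝 x] sol i v := by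
  rw [transition, dif_pos h]
  exact h.choose_spec

/-- The fibre bundle with discrete fibre that is associated to a locally constant system of
functions. -/
def systemCore [TopologicalSpace F] [DiscreteTopology F] (hN : ∀ P, IsOpen (N P))
    (hmem : ∀ P, P ∈ N P)
    (hinj : ∀ P, ∀ x ∈ N P, ∀ v w, sol P v =ᶠ[𝓝 x] sol P w → v = w)
    (hsurj : ∀ P Q, ∀ x ∈ N P, x ∈ N Q → ∀ v, ∃ w, sol Q w =ᶠ[𝓝 x] sol P v) :
    FiberBundleCore X X F where
  baseSet := N
  isOpen_baseSet := hN
  indexAt := id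
  mem_baseSet_at := hmem
  coordChange := transition sol
  coordChange_self i x hx v := hinj i x hx _ _ (transition_spec ⟨v, EventuallyEq.rfl⟩)
  continuousOn_coordChange i j := by
    rintro ⟨x, v⟩ ⟨⟨hi, hj⟩, -⟩
    refine ContinuousAt.continuousWithinAt ?_
    refine continuousAt_const.congr (f := fun _ => transition sol i j x v) ?_
    have h1 := transition_spec (hsurj i j x hi hj v)
    have hv : ∀ᶠ w in 𝓝 v, w = v := discreteTopology_iff_singleton_mem_nhds.1 inferInstance v
    have h2 : ∀ᶠ p : X × F in 𝓝 (x, v), p.2 = v := (continuous_snd.tendsto (x, v)).eventually hv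
    have h3 : ∀ᶠ p : X × F in 𝓝 (x, v), p.1 ∈ N i ∧ p.1 ∈ N j ∧
        sol j (transition sol i j x v) =ᶠ[𝓝 p.1] sol i v :=
      (continuous_fst.tendsto (x, v)).eventually
        (((hN i).eventually_mem hi).and (((hN j).eventually_mem hj).and h1.eventuallyEq_nhds))
    filter_upwards [h2, h3] with p hp hp'
    obtain ⟨y, w⟩ := p
    obtain rfl : w = v := hp
    exact hinj j y hp'.2.1 _ _ (hp'.2.2.trans
      (transition_spec (hsurj i j y hp'.1 hp'.2.1 w)).symm)
  coordChange_comp i j k x hx v := by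
    have h1 := transition_spec (hsurj i j x hx.1.1 hx.1.2 v)
    have h2 := transition_spec (hsurj j k x hx.1.2 hx.2 (transition sol i j x v))
    exact hinj k x hx.2 _ _ ((h2.trans h1).trans
      (transition_spec (hsurj i k x hx.1.1 hx.2 v)).symm)

/-- On a simply connected space, a locally constant system of functions has no monodromy: every
local member extends to a global function that belongs to the system everywhere. -/
theorem exists_global_of_system [SimplyConnectedSpace X] [LocallyPathConnectedSpace X]
    (hN : ∀ P, IsOpen (N P)) (hmem : ∀ P, P ∈ N P)
    (hinj : ∀ P, ∀ x ∈ N P, ∀ v w, sol P v =ᶠ[𝓝 x] sol P w → v = w)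
    (hsurj : ∀ P Q, ∀ x ∈ N P, x ∈ N Q → ∀ v, ∃ w, sol Q w =ᶠ[𝓝 x] sol P v) (P : X) (v : F) :
    ∃ f : X → Y, f =ᶠ[𝓝 P] sol P v ∧ ∀ x, ∃ w, f =ᶠ[𝓝 x] sol x w := by
  let : TopologicalSpace F := ⊥
  have : DiscreteTopology F := ⟨rfl⟩
  let Z := systemCore hN hmem hinj hsurj
  have hcover : IsCoveringMap (TotalSpace.proj : Z.TotalSpace → X) := FiberBundle.isCoveringMap
  -- The section through `(P, v)` is a lift of the identity to a covering space.
  obtain ⟨s, ⟨hs0, hs⟩, -⟩ := hcover.existsUnique_continuousMap_lifts (ContinuousMap.id X) P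
    (⟨P, v⟩ : Z.TotalSpace) rfl
  have hproj : ∀ y, (s y).1 = y := fun y => congrFun hs y
  let val : (z : Z.TotalSpace) → F := fun z => z.2
  let f : X → Y := fun y => sol (s y).1 (val (s y)) (s y).1
  have hf : ∀ x, f =ᶠ[𝓝 x] sol x (val (s x)) := by
    intro x
    let c : X → F := fun y => (Z.localTriv x (s y)).2
    have hc : ContinuousAt c x := by
      have h1 : ContinuousAt (Z.localTriv x) (s x) :=
        (Z.localTriv x).continuousAt (x := s x) (by
          rw [Trivialization.mem_source]
          change (s x).1 ∈ N x
          rw [hproj x]; exact hmem x)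
      exact continuousAt_snd.comp (h1.comp s.continuous.continuousAt)
    have hcy : ∀ y ∈ N x, f y = sol x (c y) y := by
      intro y hy
      have hy1 : (s y).1 ∈ N x := by rw [hproj y]; exact hy
      have h1 := (transition_spec (hsurj (s y).1 x (s y).1 (hmem _) hy1 (val (s y)))).self_of_nhds
      have h2 : sol x (c y) (s y).1 = sol x (c y) y := by rw [hproj y]
      exact h1.symm.trans h2
    have hcx : c x = val (s x) := by
      have h1 : (s x).1 ∈ N x := by rw [hproj x]; exact hmem x
      have h2 := transition_spec (hsurj (s x).1 x (s x).1 (hmem _) h1 (val (s x)))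
      refine hinj x (s x).1 h1 _ _ (h2.trans ?_)
      rw [show sol (s x).1 = sol x from congrArg sol (hproj x)]
    have hev : ∀ᶠ y in 𝓝 x, c y = val (s x) := by
      rw [← hcx]
      exact hc.eventually (discreteTopology_iff_singleton_mem_nhds.1 inferInstance (c x))
    filter_upwards [hev, (hN x).mem_nhds (hmem x)] with y hy hyN
    rw [hcy y hyN, hy]
  refine ⟨f, ?_, fun x => ⟨_, hf x⟩⟩
  have h := hf P
  rwa [show val (s P) = v by rw [hs0]] at h

end LocalSystems

end AffineSurface

end

/-! ### Global solutions -/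

section

set_option maxSynthPendingDepth 3

namespace AffineSurface

variable {M : Type*} [TopologicalSpace M] [ChartedSpace Plane M] [IsManifold (𝓡 2) ∞ M]

section Global

variable {cov : Connection M} {μ : ℝ} {P x : M}

/-- The smooth solutions of the quasi-Einstein equation on an open set.  Functions are defined on
all of `M`, but nothing is required outside of `U`. -/
def solutionsOn (cov : Connection M) (μ : ℝ) (U : TopologicalSpace.Opens M) :
    Submodule ℝ (M → ℝ) where
  carrier := {f | ContMDiffOn (𝓡 2) 𝓘(ℝ, ℝ) ∞ f U ∧ ∀ x ∈ U, QuasiEinsteinAt cov μ f x}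
  zero_mem' := ⟨contMDiffOn_const, fun x _ u v => by simp [hessian_zero]⟩
  add_mem' := by
    rintro f g ⟨hf, hfe⟩ ⟨hg, hge⟩
    refine ⟨hf.add hg, fun x hx u v => ?_⟩
    rw [hessian_add cov U.isOpen hf hg hx, hfe x hx u v, hge x hx u v, Pi.add_apply]
    ring
  smul_mem' := by
    rintro c f ⟨hf, hfe⟩
    refine ⟨(contMDiffOn_const : ContMDiffOn (𝓡 2) 𝓘(ℝ, ℝ) ∞ (fun _ : M => c) U).smul hf,
      fun x hx u v => ?_⟩
    rw [hessian_smul cov c U.isOpen hf hx, hfe x hx u v, Pi.smul_apply, smul_eq_mul]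
    ring

/-- The jet of solutions at a point, as a linear map. -/
def solutionJet (cov : Connection M) (μ : ℝ) (U : TopologicalSpace.Opens M)
    (hx : x ∈ (chartAt Plane P).source) (hxU : x ∈ U) : solutionsOn cov μ U →ₗ[ℝ] Jet where
  toFun f := chartJet P x f
  map_add' f g := chartJet_add hx (f.2.1.contMDiffAt (U.isOpen.mem_nhds hxU))
    (g.2.1.contMDiffAt (U.isOpen.mem_nhds hxU))
  map_smul' c f := chartJet_smul hx (f.2.1.contMDiffAt (U.isOpen.mem_nhds hxU)) c

/-- The germ at `P` of a global solution. -/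
def toGerm (cov : Connection M) (P : M) (μ : ℝ) :
    eigenspace cov μ →ₗ[ℝ] germEigenspace cov P μ where
  toFun f := ⟨((f : C^∞⟮𝓡 2, M; 𝓘(ℝ, ℝ), ℝ⟯) : M → ℝ), _, univ, rfl, isOpen_univ, mem_univ P,
    (f : C^∞⟮𝓡 2, M; 𝓘(ℝ, ℝ), ℝ⟯).contMDiff.contMDiffOn, fun x _ => f.2 x⟩
  map_add' _ _ := rfl
  map_smul' _ _ := rfl

/-- Constant functions solve the equation with `μ = 0`. -/
theorem one_le_rank_eigenspace_zero [Nonempty M] (cov : Connection M) :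
    1 ≤ Module.rank ℝ (eigenspace cov 0) := by
  have h1 : ∀ x, QuasiEinsteinAt cov 0 (fun _ : M => (1 : ℝ)) x := by
    intro x u v
    simp only [hessian, mvfderiv_const, zero_apply, zero_mul]
    simp
  let f : eigenspace cov 0 := ⟨⟨fun _ => 1, contMDiff_const⟩, h1⟩
  have hf : f ≠ 0 := by
    intro h
    obtain ⟨x⟩ : Nonempty M := inferInstance
    have h2 := congrArg (fun g : eigenspace cov 0 => (g : C^∞⟮𝓡 2, M; 𝓘(ℝ, ℝ), ℝ⟯) x) h
    exact one_ne_zero h2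
  have : Nontrivial (eigenspace cov 0) := ⟨f, 0, hf⟩
  exact Cardinal.one_le_iff_pos.2 rank_pos

variable [T2Space M]

/-- Unique continuation: on a connected surface a solution is determined by its germ at a point. -/
theorem toGerm_injective [ConnectedSpace M]
    (hcov : ContMDiffCovariantDerivativeOn (I := 𝓡 2) Plane ∞ cov.toFun univ)
    (htor : cov.torsion = 0) (P : M) : Function.Injective (toGerm cov P μ) := by
  rw [← LinearMap.ker_eq_bot, LinearMap.ker_eq_bot']
  rintro ⟨f, hf⟩ h0
  have h0' : (f : M → ℝ) =ᶠ[𝓝 P] 0 := Germ.coe_eq.1 (congrArg Subtype.val h0)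
  -- A zero of the germ in the closure lies in a coordinate ball where the solution must vanish.
  have hclopen : IsClopen {x | (f : M → ℝ) =ᶠ[𝓝 x] 0} := by
    refine ⟨isClosed_of_closure_subset fun x hx => ?_, isOpen_iff_mem_nhds.2 fun x hx =>
      eventually_eventuallyEq_nhds.2 hx⟩
    obtain ⟨r, hr, hball⟩ := exists_ball_subset_target x
    obtain ⟨y, hyr, hy⟩ := mem_closure_iff.1 hx _ (isOpen_chartBall x r) (mem_chartBall_self hr)
    have h1 : chartJet x y f = 0 := by
      rw [chartJet_congr hyr.1 hy]
      exact Prod.ext rfl (fderiv_const_apply (0 : ℝ))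
    filter_upwards [(isOpen_chartBall x r).mem_nhds (mem_chartBall_self hr)] with z hz
    exact eq_zero_on_chartBall hcov htor hball f.contMDiff.contMDiffOn (fun x _ => hf x) hyr h1 z hz
  have huniv := hclopen.eq_univ ⟨P, h0'⟩
  apply Subtype.ext
  ext x
  have hx : x ∈ {x | (f : M → ℝ) =ᶠ[𝓝 x] 0} := huniv ▸ mem_univ x
  exact (show (f : M → ℝ) =ᶠ[𝓝 x] 0 from hx).self_of_nhds

theorem rank_eigenspace_le [ConnectedSpace M]
    (hcov : ContMDiffCovariantDerivativeOn (I := 𝓡 2) Plane ∞ cov.toFun univ)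
    (htor : cov.torsion = 0) (P : M) :
    Module.rank ℝ (eigenspace cov μ) ≤ Module.rank ℝ (germEigenspace cov P μ) :=
  LinearMap.rank_le_of_injective _ (toGerm_injective hcov htor P)

theorem rank_germEigenspace_eq_three_of_rank_eigenspace [ConnectedSpace M]
    (hcov : ContMDiffCovariantDerivativeOn (I := 𝓡 2) Plane ∞ cov.toFun univ)
    (htor : cov.torsion = 0) (h : Module.rank ℝ (eigenspace cov μ) = 3) (P : M) :
    Module.rank ℝ (germEigenspace cov P μ) = 3 := by
  refine le_antisymm ?_ (h.ge.trans (rank_eigenspace_le hcov htor P))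
  rw [rank_germEigenspace hcov htor]
  have h1 := Submodule.finrank_le (solValues (quasiForm (chartChrist cov P) μ)
    (extChartAt (𝓡 2) P P))
  rw [finrank_jet] at h1
  exact_mod_cast h1

theorem QuasiEinsteinAt.congr {f g : M → ℝ}
    (hcov : ContMDiffCovariantDerivativeOn (I := 𝓡 2) Plane ∞ cov.toFun univ)
    (htor : cov.torsion = 0) (hf : ∀ᶠ y in 𝓝 x, ContMDiffAt (𝓡 2) 𝓘(ℝ, ℝ) ∞ f y)
    (hq : QuasiEinsteinAt cov μ f x) (hfg : g =ᶠ[𝓝 x] f) : QuasiEinsteinAt cov μ g x := by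
  have hx := mem_chart_source Plane x
  have hg : ∀ᶠ y in 𝓝 x, ContMDiffAt (𝓡 2) 𝓘(ℝ, ℝ) ∞ g y := by
    filter_upwards [hf, hfg.eventuallyEq_nhds] with y hy hy' using hy.congr_of_eventuallyEq hy'
  rw [quasiEinsteinAt_iff isOpen_univ hcov (mem_univ x) (congrFun htor x) hx hf] at hq
  rw [quasiEinsteinAt_iff isOpen_univ hcov (mem_univ x) (congrFun htor x) hx hg]
  intro u v
  have he := eventuallyEq_chart hx hfg
  rw [he.fderiv.fderiv_eq, he.fderiv_eq, he.self_of_nhds]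
  exact hq u v

/-- If every jet at `P` is the jet of a solution, then there are solutions with arbitrary jets on
a common coordinate ball, depending linearly on the jet. -/
theorem exists_linear_solutions
    (hcov : ContMDiffCovariantDerivativeOn (I := 𝓡 2) Plane ∞ cov.toFun univ)
    (htor : cov.torsion = 0)
    (htop : solValues (quasiForm (chartChrist cov P) μ) (extChartAt (𝓡 2) P P) = ⊤) :
    ∃ r > 0, Metric.ball (extChartAt (𝓡 2) P P) r ⊆ (extChartAt (𝓡 2) P).target ∧
      ∃ s : Jet →ₗ[ℝ] solutionsOn cov μ ⟨chartBall P r, isOpen_chartBall P r⟩,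
        ∀ j, chartJet P P (s j) = j := by
  have hfb := Module.finBasis ℝ Jet
  choose f U hU hPU hsub hf hq hj using fun i => exists_solution_of_mem_solValues hcov htor
    (show hfb i ∈ solValues (quasiForm (chartChrist cov P) μ) (extChartAt (𝓡 2) P P) from
      htop ▸ Submodule.mem_top)
  have hV : IsOpen (⋂ i, U i) := isOpen_iInter_of_finite hU
  obtain ⟨r, hr, hball⟩ := Metric.isOpen_iff.1 (isOpen_chartDomain (P := P) hV) _
    (mem_chartDomain_iff.2 ⟨P, mem_chart_source _ P, mem_iInter.2 hPU, rfl⟩)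
  have hsub : ∀ i, chartBall P r ⊆ U i := fun i y hy => by
    have h1 := mem_iInter.1 (hball hy.2).2 i
    rwa [extChartAt_left_inv hy.1] at h1
  let W : TopologicalSpace.Opens M := ⟨chartBall P r, isOpen_chartBall P r⟩
  let F : Fin (Module.finrank ℝ Jet) → solutionsOn cov μ W := fun i =>
    ⟨f i, (hf i).mono (hsub i), fun x hx => hq i x (hsub i hx)⟩
  refine ⟨r, hr, fun q hq => (hball hq).1, hfb.constr ℝ F, fun j => ?_⟩
  have hid : (solutionJet cov μ W (mem_chart_source _ P) (mem_chartBall_self hr)) ∘ₗ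
      (hfb.constr ℝ F) = LinearMap.id := by
    refine hfb.ext fun i => ?_
    rw [LinearMap.comp_apply, Module.Basis.constr_basis]
    exact hj i
  exact congrArg (fun L => L j) hid

/-- On a simply connected surface, maximality of all the germ spaces implies that all germs of
solutions extend to global solutions. -/
theorem rank_eigenspace_eq_three [SimplyConnectedSpace M]
    (hcov : ContMDiffCovariantDerivativeOn (I := 𝓡 2) Plane ∞ cov.toFun univ)
    (htor : cov.torsion = 0)
    (htop : ∀ P, solValues (quasiForm (chartChrist cov P) μ) (extChartAt (𝓡 2) P P) = ⊤) :
    Module.rank ℝ (eigenspace cov μ) = 3 := by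
  have : LocallyPathConnectedSpace M := ChartedSpace.locallyPathConnectedSpace Plane M
  choose r hr hball s hs using fun P => exists_linear_solutions hcov htor (htop P)
  -- Unique continuation in a coordinate ball, from any of its points.
  have hinj : ∀ P, ∀ x ∈ chartBall P (r P), ∀ j, chartJet P x (s P j) = 0 → j = 0 := by
    intro P x hx j h
    rw [← hs P j]
    have h1 := eq_zero_on_chartBall hcov htor (hball P) (s P j).2.1 (s P j).2.2 hx h
    have h2 : ((s P j : solutionsOn cov μ _) : M → ℝ) =ᶠ[𝓝 P] 0 := by
      filter_upwards [(isOpen_chartBall P (r P)).mem_nhds (mem_chartBall_self (hr P))] with y hy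
        using h1 y hy
    rw [chartJet_congr (mem_chart_source _ P) h2]
    exact Prod.ext rfl (fderiv_const_apply (0 : ℝ))
  have hglob := exists_global_of_system (N := fun P => chartBall P (r P))
    (sol := fun P j => ((s P j : solutionsOn cov μ _) : M → ℝ))
    (fun P => isOpen_chartBall P (r P)) (fun P => mem_chartBall_self (hr P)) ?_ ?_
  · obtain ⟨P⟩ : Nonempty M := inferInstance
    have hsurj : Function.Surjective (toGerm cov P μ) := by
      rintro ⟨_, g, U, rfl, hU, hPU, hg, hq⟩
      obtain ⟨f, hfP, hf⟩ := hglob P (chartJet P P g)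
      have hsm : ∀ x, ContMDiffAt (𝓡 2) 𝓘(ℝ, ℝ) ∞ f x := fun x => by
        obtain ⟨j, hj⟩ := hf x
        exact ((s x j).2.1.contMDiffAt ((isOpen_chartBall x (r x)).mem_nhds
          (mem_chartBall_self (hr x)))).congr_of_eventuallyEq hj
      have hqe : ∀ x, QuasiEinsteinAt cov μ f x := fun x => by
        obtain ⟨j, hj⟩ := hf x
        refine ((s x j).2.2 x (mem_chartBall_self (hr x))).congr hcov htor ?_ hj
        filter_upwards [(isOpen_chartBall x (r x)).mem_nhds (mem_chartBall_self (hr x))] with y hy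
        exact (s x j).2.1.contMDiffAt ((isOpen_chartBall x (r x)).mem_nhds hy)
      refine ⟨⟨⟨f, hsm⟩, hqe⟩, germJet_injective hcov htor ?_⟩
      change chartJet P P f = chartJet P P g
      rw [chartJet_congr (mem_chart_source _ P) hfP, hs]
    have hrank := (LinearEquiv.ofBijective (toGerm cov P μ)
      ⟨toGerm_injective hcov htor P, hsurj⟩).rank_eq
    rw [hrank, rank_germEigenspace_eq_three_iff hcov htor, htop]
  · intro P x hx v w hvw
    have h1 : s P v - s P w = s P (v - w) := (map_sub _ _ _).symm
    refine sub_eq_zero.1 (hinj P x hx _ ?_)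
    rw [← h1]
    have h2 : (((s P v - s P w : solutionsOn cov μ _)) : M → ℝ) =ᶠ[𝓝 x] 0 := by
      filter_upwards [hvw] with y hy
      exact sub_eq_zero.2 hy
    rw [chartJet_congr hx.1 h2]
    exact Prod.ext rfl (fderiv_const_apply (0 : ℝ))
  · intro P Q x hxP hxQ v
    let L : Jet →ₗ[ℝ] Jet := (solutionJet cov μ ⟨chartBall Q (r Q), isOpen_chartBall Q (r Q)⟩
      hxQ.1 hxQ) ∘ₗ s Q
    -- The jets at `x` of the solutions on the ball at `Q` fill the space of jets, by dimension.
    have hL : Function.Surjective L := LinearMap.injective_iff_surjective.1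
      (LinearMap.ker_eq_bot.1 (LinearMap.ker_eq_bot'.2 fun j hj => hinj Q x hxQ j hj))
    obtain ⟨w, hw⟩ := hL (chartJet Q x (s P v : solutionsOn cov μ _))
    refine ⟨w, ?_⟩
    let V : TopologicalSpace.Opens M := ⟨chartBall P (r P) ∩ chartBall Q (r Q),
      (isOpen_chartBall P (r P)).inter (isOpen_chartBall Q (r Q))⟩
    let a : solutionsOn cov μ V := ⟨(s Q w : solutionsOn cov μ _),
      (s Q w).2.1.mono inter_subset_right, fun y hy => (s Q w).2.2 y hy.2⟩
    let b : solutionsOn cov μ V := ⟨(s P v : solutionsOn cov μ _),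
      (s P v).2.1.mono inter_subset_left, fun y hy => (s P v).2.2 y hy.1⟩
    have hab : chartJet Q x ((a - b : solutionsOn cov μ V) : M → ℝ) = 0 := by
      have h1 := map_sub (solutionJet cov μ V hxQ.1 ⟨hxP, hxQ⟩) a b
      exact h1.trans (sub_eq_zero.2 hw)
    have hz := eventually_eq_zero_of_chartJet hcov htor V.isOpen hxQ.1 ⟨hxP, hxQ⟩ (a - b).2.1
      (a - b).2.2 hab
    filter_upwards [hz] with y hy
    exact sub_eq_zero.1 hy

end Global

end AffineSurface

end

end

theorem theorem1p5 {M : Type*} [TopologicalSpace M] [T2Space M] [SecondCountableTopology M]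
    [ChartedSpace AffineSurface.Plane M] [IsManifold (𝓡 2) ∞ M]
    (cov : AffineSurface.Connection M) (hsmooth : cov.ContMDiffCovariantDerivative ∞)
    (htorsion : cov.torsion = 0) :
    -- global solutions on a simply connected surface
    (SimplyConnectedSpace M →
      Module.rank ℝ (AffineSurface.eigenspace cov (-1)) ≠ 2 ∧
      (AffineSurface.IsStronglyProjectivelyFlat cov ↔
        Module.rank ℝ (AffineSurface.eigenspace cov (-1)) = 3)) ∧
    -- global solutions on a connected surface
    (ConnectedSpace M →
      (Module.rank ℝ (AffineSurface.eigenspace cov (-1)) = 3 →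
        AffineSurface.IsStronglyProjectivelyFlat cov) ∧
      (AffineSurface.IsStronglyProjectivelyFlat cov →
        (∀ x, AffineSurface.ricciRank cov x = 2) →
        (∀ μ : ℝ, μ ≠ -1 → μ ≠ 0 → Module.rank ℝ (AffineSurface.eigenspace cov μ) = 0) ∧
        Module.rank ℝ (AffineSurface.eigenspace cov 0) = 1) ∧
      (∀ μ : ℝ, μ ≠ -1 → Module.rank ℝ (AffineSurface.eigenspace cov μ) = 3 →
        (∀ x u v, AffineSurface.ricci cov x u v = 0) ∧
        AffineSurface.IsStronglyProjectivelyFlatOn cov univ)) ∧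
    -- germs of solutions at a point of an arbitrary surface
    ∀ P : M,
      Module.rank ℝ (AffineSurface.germEigenspace cov P (-1)) ≠ 2 ∧
      (AffineSurface.IsStronglyProjectivelyFlatNear cov P ↔
        Module.rank ℝ (AffineSurface.germEigenspace cov P (-1)) = 3) ∧
      (AffineSurface.IsStronglyProjectivelyFlatNear cov P → AffineSurface.ricciRank cov P = 2 →
        (∀ μ : ℝ, μ ≠ -1 → μ ≠ 0 →
          Module.rank ℝ (AffineSurface.germEigenspace cov P μ) = 0) ∧
        Module.rank ℝ (AffineSurface.germEigenspace cov P 0) = 1) ∧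
      (∀ μ : ℝ, μ ≠ -1 → Module.rank ℝ (AffineSurface.germEigenspace cov P μ) = 3 →
        (∀ᶠ x in 𝓝 P, ∀ u v, AffineSurface.ricci cov x u v = 0) ∧
        AffineSurface.IsStronglyProjectivelyFlatNear cov P) := by
  have hcov := hsmooth.contMDiff
  have hflat_of_three : ConnectedSpace M → Module.rank ℝ (AffineSurface.eigenspace cov (-1)) = 3 →
      AffineSurface.IsStronglyProjectivelyFlat cov := fun _ h P =>
    AffineSurface.isStronglyProjectivelyFlatNear_of_solValues_eq_top hcov htorsion
      ((AffineSurface.rank_germEigenspace_eq_three_iff hcov htorsion).1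
        (AffineSurface.rank_germEigenspace_eq_three_of_rank_eigenspace hcov htorsion h P))
  refine ⟨fun _ => ⟨fun h => ?_, fun h => ?_, hflat_of_three inferInstance⟩,
    fun _ => ⟨hflat_of_three inferInstance, fun hflat hrank => ?_, fun μ hμ h => ?_⟩, fun P =>
    ⟨AffineSurface.rank_germEigenspace_ne_two hcov htorsion, ⟨fun h => ?_, fun h => ?_⟩,
      fun hflat hrank =>
        AffineSurface.rank_germEigenspace_of_ricciRank hcov htorsion hflat hrank,
      fun μ hμ h => ?_⟩⟩
  · -- Two independent solutions already force all the germ spaces to be three-dimensional.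
    have h3 := AffineSurface.rank_eigenspace_eq_three hcov htorsion fun P =>
      AffineSurface.solValues_eq_top_of_two_le_rank hcov htorsion
        (h.ge.trans (AffineSurface.rank_eigenspace_le hcov htorsion P))
    rw [h] at h3
    exact absurd h3 (by norm_num)
  · exact AffineSurface.rank_eigenspace_eq_three hcov htorsion fun P =>
      AffineSurface.solValues_eq_top_of_isStronglyProjectivelyFlatNear hcov (h P)
  · obtain ⟨P⟩ : Nonempty M := inferInstance
    obtain ⟨h0, h1⟩ := AffineSurface.rank_germEigenspace_of_ricciRank hcov htorsion (hflat P)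
      (hrank P)
    refine ⟨fun μ hμ hμ0 => ?_, ?_⟩
    · exact nonpos_iff_eq_zero.1
        ((AffineSurface.rank_eigenspace_le hcov htorsion P).trans (h0 μ hμ hμ0).le)
    · exact le_antisymm ((AffineSurface.rank_eigenspace_le hcov htorsion P).trans h1.le)
        (AffineSurface.one_le_rank_eigenspace_zero cov)
  · have hric : ∀ x u v, AffineSurface.ricci cov x u v = 0 := fun x =>
      (AffineSurface.ricci_eq_zero_of_rank_germEigenspace hcov htorsion hμ
        (AffineSurface.rank_germEigenspace_eq_three_of_rank_eigenspace hcov htorsion h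
          x)).self_of_nhds
    exact ⟨hric, AffineSurface.isStronglyProjectivelyFlatOn_of_ricci_eq_zero hcov hcov htorsion
      fun x _ => hric x⟩
  · exact (AffineSurface.rank_germEigenspace_eq_three_iff hcov htorsion).2
      (AffineSurface.solValues_eq_top_of_isStronglyProjectivelyFlatNear hcov h)
  · exact AffineSurface.isStronglyProjectivelyFlatNear_of_solValues_eq_top hcov htorsion
      ((AffineSurface.rank_germEigenspace_eq_three_iff hcov htorsion).1 h)
  · have hric := AffineSurface.ricci_eq_zero_of_rank_germEigenspace hcov htorsion hμ h
    obtain ⟨U, hUric, hU, hPU⟩ := eventually_nhds_iff.1 hric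
    exact ⟨hric, U, hU, hPU, AffineSurface.isStronglyProjectivelyFlatOn_of_ricci_eq_zero hcov
      (hcov.restrict hU) htorsion hUric⟩
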